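/- All 2-categories are small and strict. A *2-functor* preserves identities and composition strictly; $F : A \rightsquigarrow B$ denotes a pseudofunctor. *Icons.* Let $F, G : A \rightsquigarrow B$ be pseudofunctors with $Fa = Ga$ for all objects $a$. An *icon* $\alpha : F \Rightarrow G$ is a family of 2-cells $\alpha_f : Ff \Rightarrow Gf$, one for each 1-cell $f$ of $A$, natural with respect to the 2-cells of $A$ and compatible with the unit and composition comparison 2-cells of $F$ and $G$ (that is, an oplax transformation whose 1-cell components are identities). 2-categories, pseudofunctors and icons form a strict 2-category $\mathrm{Icon}$. *Gray tensor product.* $Ps(B,C)$ denotes the 2-category of 2-functors $B \to C$, pseudonatural transformations and modifications. A *Gray tensor product* of $A$ and $B$ is a representing object $A \otimes B$ of the functor $\text{2-Cat}(A, Ps(B,-)) : \text{2-Cat} \to \mathrm{Set}$, where 2-Cat is the category of 2-categories and 2-functors; so it comes with bijections $\text{2-Cat}(A \otimes B, C) \cong \text{2-Cat}(A, Ps(B,C))$ natural in $C$. *The comparison $Q$.* $Q : A \otimes B \to A \times B$ is the 2-functor corresponding to the 2-functor $A \to Ps(B, A \times B)$ that sends an object $a$ to the 2-functor $b \mapsto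 (a,b)$, a 1-cell $f$ to the 2-natural transformation with components $(f, 1_b)$, and a 2-cell $\alpha$ to the modification with components $(\alpha, 1)$. *The universal cubical functor $R$.* A *cubical functor* $F : A \times B \rightsquigarrow C$ is a strictly identity-preserving pseudofunctor such that, for composable 1-cells $(f_1,f_2) : (a_1,a_2) \to (b_1,b_2)$ and $(g_1,g_2) : (b_1,b_2) \to (c_1,c_2)$, the comparison 2-cell $F((g_1,g_2) \circ (f_1,f_2)) \cong F(g_1,g_2) \circ F(f_1,f_2)$ is an identity whenever $f_1$ or $g_2$ is an identity. Evaluation is the pseudofunctor $ev : Ps(B,C) \times B \rightsquigarrow C$ given by $(F,b) \mapsto Fb$ on objects and, on 1-cells, by sending $(\eta, g) : (F,b) \to (G,b')$ to $\eta_{b'} \circ Fg$; its comparison 2-cell at a composable pair $(\eta,g) : (F,b) \to (G,b')$, $(\mu,h) : (G,b') \to (H,b'')$ is given by the invertible 2-cell $\eta_h : \eta_{b''} \circ Fh \cong Gh \circ \eta_{b'}$. A 2-functor $K : A \to Ps(B,C)$ yields the cubical functor $ev \circ (K \times 1_B) : A \times B \rightsquigarrow C$. The *universal cubical functor* $R :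 A \times B \rightsquigarrow A \otimes B$ is the one obtained in this way from the 2-functor $A \to Ps(B, A \otimes B)$ that corresponds to the identity of $A \otimes B$. **Proposition.** Let $A$ and $B$ be 2-categories. A Gray tensor product $A \otimes B$ exists and, for every Gray tensor product $A \otimes B$ of $A$ and $B$, the comparison 2-functor $Q : A \otimes B \to A \times B$ is an equivalence in the 2-category $\mathrm{Icon}$ with inverse the universal cubical functor $R$: there are invertible icons $RQ \cong 1_{A \otimes B}$ and $QR \cong 1_{A \times B}$. In particular $Q$ is locally full and faithful: each functor $(A \otimes B)(x,y) \to (A \times B)(Qx, Qy)$ is full and faithful. -/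

import Mathlib

open CategoryTheory Bicategory

universe w v u w₁ v₁ u₁ w₂ v₂ u₂ w₃ v₃ u₃

namespace GrayTensorProduct

section Icon

/-- Transport of a 1-cell along equalities between its endpoints. -/
def castHom {C : Type u} [Bicategory.{w, v} C] {x y : C} :
    ∀ {x' y' : C}, x = x' → y = y' → (x ⟶ y) → (x' ⟶ y')
  | _, _, rfl, rfl, f => f

/-- Transport of a 2-cell along equalities between the endpoints of its boundary 1-cells. -/
def castHom₂ {C : Type u} [Bicategory.{w, v} C] {x y : C} {f g : x ⟶ y} :
    ∀ {x' y' : C} (p : x = x') (q : y = y'), (f ⟶ g) → (castHom p q f ⟶ castHom p q g)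
  | _, _, rfl, rfl, η => η

theorem castHom_id {C : Type u} [Bicategory.{w, v} C] {x x' : C} (p : x = x') :
    castHom p p (𝟙 x) = 𝟙 x' := by
  subst p; rfl

theorem castHom_comp {C : Type u} [Bicategory.{w, v} C] {x y z x' y' z' : C}
    (p : x = x') (q : y = y') (r : z = z') (f : x ⟶ y) (g : y ⟶ z) :
    castHom p r (f ≫ g) = castHom p q f ≫ castHom q r g := by
  subst p q r; rfl

theorem castHom_castHom {C : Type u} [Bicategory.{w, v} C] {x y x' y' x'' y'' : C}
    (p : x = x') (q : y = y') (p' : x' = x'') (q' : y' = y'') (f : x ⟶ y) :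
    castHom p' q' (castHom p q f) = castHom (p.trans p') (q.trans q') f := by
  subst p q p' q'; rfl

theorem castHom₂_vcomp {C : Type u} [Bicategory.{w, v} C] {x y x' y' : C} {f g h : x ⟶ y}
    (p : x = x') (q : y = y') (η : f ⟶ g) (θ : g ⟶ h) :
    castHom₂ p q (η ≫ θ) = castHom₂ p q η ≫ castHom₂ p q θ := by
  subst p q; rfl

theorem castHom₂_vcomp_assoc {C : Type u} [Bicategory.{w, v} C] {x y x' y' : C}
    {f g h : x ⟶ y} (p : x = x') (q : y = y') (η : f ⟶ g) (θ : g ⟶ h)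
    {k : x' ⟶ y'} (κ : castHom p q h ⟶ k) :
    castHom₂ p q (η ≫ θ) ≫ κ = castHom₂ p q η ≫ castHom₂ p q θ ≫ κ := by
  subst p q; exact Category.assoc η θ κ

theorem castHom₂_eqToHom {C : Type u} [Bicategory.{w, v} C] {x y x' y' : C} {f g : x ⟶ y}
    (p : x = x') (q : y = y') (h : f = g) :
    castHom₂ p q (eqToHom h) = eqToHom (congrArg (castHom p q) h) := by
  subst p q; rfl

theorem castHom₂_castHom₂ {C : Type u} [Bicategory.{w, v} C] {x y x' y' x'' y'' : C}
    (p : x = x') (q : y = y') (p' : x' = x'') (q' : y' = y'') {f g : x ⟶ y} (η : f ⟶ g) :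
    castHom₂ p' q' (castHom₂ p q η) = eqToHom (castHom_castHom p q p' q' f) ≫
      castHom₂ (p.trans p') (q.trans q') η ≫ eqToHom (castHom_castHom p q p' q' g).symm := by
  subst p q p' q'; exact (by simp : η = 𝟙 _ ≫ η ≫ 𝟙 _)

theorem eqToHom_castHom₂ {C : Type u} [Bicategory.{w, v} C] {x y x' y' x'' y'' : C}
    (p : x = x') (q : y = y') (p' : x' = x'') (q' : y' = y'') {f g : x ⟶ y} (η : f ⟶ g) :
    eqToHom (castHom_castHom p q p' q' f) ≫ castHom₂ (p.trans p') (q.trans q') η =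
      castHom₂ p' q' (castHom₂ p q η) ≫ eqToHom (castHom_castHom p q p' q' g) := by
  subst p q p' q'; exact (by simp : 𝟙 _ ≫ η = η ≫ 𝟙 _)

theorem castHom₂_whiskerRight {C : Type u} [Bicategory.{w, v} C] {x y z x' y' z' : C}
    (p : x = x') (q : y = y') (r : z = z') {f f' : x ⟶ y} (η : f ⟶ f') (g : y ⟶ z) :
    castHom₂ p r (η ▷ g) = eqToHom (castHom_comp p q r f g) ≫
      castHom₂ p q η ▷ castHom q r g ≫ eqToHom (castHom_comp p q r f' g).symm := by
  subst p q r; exact (by simp : η ▷ g = 𝟙 _ ≫ η ▷ g ≫ 𝟙 _)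

theorem castHom₂_whiskerLeft {C : Type u} [Bicategory.{w, v} C] {x y z x' y' z' : C}
    (p : x = x') (q : y = y') (r : z = z') (f : x ⟶ y) {g g' : y ⟶ z} (η : g ⟶ g') :
    castHom₂ p r (f ◁ η) = eqToHom (castHom_comp p q r f g) ≫
      castHom p q f ◁ castHom₂ q r η ≫ eqToHom (castHom_comp p q r f g').symm := by
  subst p q r; exact (by simp : f ◁ η = 𝟙 _ ≫ f ◁ η ≫ 𝟙 _)

theorem map_castHom {C : Type u₁} [Bicategory.{w₁, v₁} C] {D : Type u₂} [Bicategory.{w₂, v₂} D]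
    (H : C ⥤ᵖ D) {x y x' y' : C} (p : x = x') (q : y = y') (f : x ⟶ y) :
    H.map (castHom p q f) = castHom (congrArg H.obj p) (congrArg H.obj q) (H.map f) := by
  subst p q; rfl

theorem map₂_castHom₂ {C : Type u₁} [Bicategory.{w₁, v₁} C] {D : Type u₂} [Bicategory.{w₂, v₂} D]
    (H : C ⥤ᵖ D) {x y x' y' : C} (p : x = x') (q : y = y') {f g : x ⟶ y} (η : f ⟶ g) :
    H.map₂ (castHom₂ p q η) = eqToHom (map_castHom H p q f) ≫
      castHom₂ (congrArg H.obj p) (congrArg H.obj q) (H.map₂ η) ≫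
        eqToHom (map_castHom H p q g).symm := by
  subst p q; exact (by simp : H.map₂ η = 𝟙 _ ≫ H.map₂ η ≫ 𝟙 _)

theorem castHom₂_mapId {C : Type u₁} [Bicategory.{w₁, v₁} C] {D : Type u₂} [Bicategory.{w₂, v₂} D]
    (H : C ⥤ᵖ D) {x x' : C} (p : x = x') :
    castHom₂ (congrArg H.obj p) (congrArg H.obj p) (H.mapId x).hom =
      eqToHom ((map_castHom H p p (𝟙 x)).symm.trans (congrArg H.map (castHom_id p))) ≫
        (H.mapId x').hom ≫ eqToHom (castHom_id (congrArg H.obj p)).symm := by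
  subst p; exact (by simp : (H.mapId x).hom = 𝟙 _ ≫ (H.mapId x).hom ≫ 𝟙 _)

theorem castHom₂_mapComp {C : Type u₁} [Bicategory.{w₁, v₁} C] {D : Type u₂}
    [Bicategory.{w₂, v₂} D] (H : C ⥤ᵖ D) {x y z x' y' z' : C} (p : x = x') (q : y = y')
    (r : z = z') (f : x ⟶ y) (g : y ⟶ z) :
    castHom₂ (congrArg H.obj p) (congrArg H.obj r) (H.mapComp f g).hom =
      eqToHom ((map_castHom H p r (f ≫ g)).symm.trans (congrArg H.map (castHom_comp p q r f g))) ≫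
        (H.mapComp (castHom p q f) (castHom q r g)).hom ≫
          eqToHom (by rw [map_castHom, map_castHom, ← castHom_comp]) := by
  subst p q r
  exact (by simp : (H.mapComp f g).hom = 𝟙 _ ≫ (H.mapComp f g).hom ≫ 𝟙 _)

variable {A : Type u₁} [Bicategory.{w₁, v₁} A] {B : Type u₂} [Bicategory.{w₂, v₂} B]
  {C : Type u₃} [Bicategory.{w₃, v₃} C]

/-- An icon between pseudofunctors `F` and `G` that agree on objects: an oplax transformation
all of whose 1-cell components are identities, i.e. a family of 2-cells `F f ⟶ G f`
(the hom-categories `B(F a, F b)` and `B(G a, G b)` being identified along `F a = G a`,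
`F b = G b`), natural in `f` and compatible with the unit and composition comparison
2-cells. -/
structure Icon (F G : A ⥤ᵖ B) where
  obj_eq (a : A) : F.obj a = G.obj a
  app {a b : A} (f : a ⟶ b) :
    F.map f ⟶ castHom (obj_eq a).symm (obj_eq b).symm (G.map f)
  naturality {a b : A} {f g : a ⟶ b} (η : f ⟶ g) :
    F.map₂ η ≫ app g = app f ≫ castHom₂ (obj_eq a).symm (obj_eq b).symm (G.map₂ η)
  app_id (a : A) :
    app (𝟙 a) ≫ castHom₂ (obj_eq a).symm (obj_eq a).symm (G.mapId a).hom =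
      (F.mapId a).hom ≫ eqToHom (castHom_id (obj_eq a).symm).symm
  app_comp {a b c : A} (f : a ⟶ b) (g : b ⟶ c) :
    app (f ≫ g) ≫ castHom₂ (obj_eq a).symm (obj_eq c).symm (G.mapComp f g).hom =
      (F.mapComp f g).hom ≫ app f ▷ F.map g ≫
        castHom (obj_eq a).symm (obj_eq b).symm (G.map f) ◁ app g ≫
          eqToHom (castHom_comp _ (obj_eq b).symm _ (G.map f) (G.map g)).symm

namespace Icon

theorem ext {F G : A ⥤ᵖ B} {α β : Icon F G}
    (h : ∀ {a b : A} (f : a ⟶ b), α.app f = β.app f) : α = β := by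
  cases α; cases β
  congr 1
  funext a b f
  exact h f

/-- The identity icon. -/
def id (F : A ⥤ᵖ B) : Icon F F where
  obj_eq _ := rfl
  app f := 𝟙 (F.map f)
  naturality η := by simp [castHom₂, castHom]
  app_id a := by simp [castHom₂, castHom]
  app_comp f g := by simp [castHom₂, castHom]

/-- Vertical composition of icons. -/
def vcomp {F G H : A ⥤ᵖ B} (α : Icon F G) (β : Icon G H) : Icon F H where
  obj_eq a := (α.obj_eq a).trans (β.obj_eq a)
  app f := α.app f ≫ castHom₂ _ _ (β.app f) ≫ eqToHom (castHom_castHom _ _ _ _ _)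
  naturality {a b f g} η := by
    rw [reassoc_of% (α.naturality η), ← castHom₂_vcomp_assoc, β.naturality η]
    simp [castHom₂_vcomp, castHom₂_castHom₂]
  app_id a := by
    have h2 := congrArg (castHom₂ (α.obj_eq a).symm (α.obj_eq a).symm) (β.app_id a)
    simp only [castHom₂_vcomp, castHom₂_eqToHom] at h2
    have h1 := α.app_id a
    simp only [Category.assoc]
    rw [eqToHom_castHom₂, reassoc_of% h2, reassoc_of% h1]
    simp
  app_comp {a b c} f g := by
    have h2 := congrArg (castHom₂ (α.obj_eq a).symm (α.obj_eq c).symm) (β.app_comp f g)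
    simp only [castHom₂_vcomp, castHom₂_eqToHom, castHom₂_whiskerRight _ (α.obj_eq b).symm,
      castHom₂_whiskerLeft _ (α.obj_eq b).symm] at h2
    have h1 := α.app_comp f g
    simp only [Category.assoc]
    rw [eqToHom_castHom₂, reassoc_of% h2, reassoc_of% h1]
    simp only [Category.assoc, eqToHom_trans, eqToHom_trans_assoc, eqToHom_refl,
      Category.id_comp, comp_whiskerRight, Bicategory.whiskerLeft_comp, eqToHom_whiskerRight,
      whiskerLeft_eqToHom]
    rw [whisker_exchange_assoc (castHom₂ (α.obj_eq a).symm (α.obj_eq b).symm (β.app f)) (α.app g),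
      congr_whiskerLeft (castHom_castHom _ _ (α.obj_eq a).symm (α.obj_eq b).symm (H.map f)) (α.app g),
      congr_whiskerLeft (castHom_castHom _ _ (α.obj_eq a).symm (α.obj_eq b).symm (H.map f))
        (castHom₂ (α.obj_eq b).symm (α.obj_eq c).symm (β.app g))]
    simp

/-- Whiskering of an icon with a pseudofunctor on the source side. -/
def whiskerLeft (F : A ⥤ᵖ B) {G H : B ⥤ᵖ C} (α : Icon G H) :
    Icon (F.comp G) (F.comp H) where
  obj_eq a := α.obj_eq (F.obj a)
  app f := α.app (F.map f)
  naturality η := α.naturality (F.map₂ η)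
  app_id a := by
    have h := α.app_id (F.obj a)
    have h' := α.naturality (F.mapId a).hom
    change α.app (F.map (𝟙 a)) ≫ castHom₂ (α.obj_eq _).symm (α.obj_eq _).symm
        (H.map₂ (F.mapId a).hom ≫ (H.mapId (F.obj a)).hom) =
      (G.map₂ (F.mapId a).hom ≫ (G.mapId (F.obj a)).hom) ≫
        eqToHom (castHom_id (α.obj_eq _).symm).symm
    rw [castHom₂_vcomp, ← reassoc_of% h', h, Category.assoc]
  app_comp {a b c} f g := by
    have h := α.app_comp (F.map f) (F.map g)
    have h' := α.naturality (F.mapComp f g).hom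
    change α.app (F.map (f ≫ g)) ≫ castHom₂ (α.obj_eq _).symm (α.obj_eq _).symm
        (H.map₂ (F.mapComp f g).hom ≫ (H.mapComp (F.map f) (F.map g)).hom) =
      (G.map₂ (F.mapComp f g).hom ≫ (G.mapComp (F.map f) (F.map g)).hom) ≫
        α.app (F.map f) ▷ G.map (F.map g) ≫
          castHom (α.obj_eq _).symm (α.obj_eq _).symm (H.map (F.map f)) ◁ α.app (F.map g) ≫
            eqToHom (castHom_comp _ (α.obj_eq (F.obj b)).symm _ (H.map (F.map f))
              (H.map (F.map g))).symm
    rw [castHom₂_vcomp, ← reassoc_of% h', h, Category.assoc]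

/-- Whiskering of an icon with a pseudofunctor on the target side. -/
def whiskerRight {F G : A ⥤ᵖ B} (α : Icon F G) (H : B ⥤ᵖ C) :
    Icon (F.comp H) (G.comp H) where
  obj_eq a := congrArg H.obj (α.obj_eq a)
  app f := H.map₂ (α.app f) ≫ eqToHom (map_castHom H _ _ (G.map f))
  naturality {a b f g} η := by
    have h := congrArg H.map₂ (α.naturality η)
    rw [PrelaxFunctor.map₂_comp, PrelaxFunctor.map₂_comp, map₂_castHom₂] at h
    change H.map₂ (F.map₂ η) ≫ H.map₂ (α.app g) ≫ eqToHom _ =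
      (H.map₂ (α.app f) ≫ eqToHom _) ≫ castHom₂ (congrArg H.obj (α.obj_eq a).symm)
        (congrArg H.obj (α.obj_eq b).symm) (H.map₂ (G.map₂ η))
    rw [reassoc_of% h]
    simp only [Category.assoc, eqToHom_trans, eqToHom_refl, Category.comp_id]
  app_id a := by
    have h := congrArg H.map₂ (α.app_id a)
    rw [PrelaxFunctor.map₂_comp, PrelaxFunctor.map₂_comp, map₂_castHom₂,
      PrelaxFunctor.map₂_eqToHom] at h
    change (H.map₂ (α.app (𝟙 a)) ≫ eqToHom _) ≫ castHom₂ (congrArg H.obj (α.obj_eq a).symm)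
        (congrArg H.obj (α.obj_eq a).symm) (H.map₂ (G.mapId a).hom ≫ (H.mapId (G.obj a)).hom) =
      (H.map₂ (F.mapId a).hom ≫ (H.mapId (F.obj a)).hom) ≫ eqToHom _
    rw [castHom₂_vcomp, castHom₂_mapId H (α.obj_eq a).symm]
    have h2 := congrArg (fun t => t ≫ eqToHom (congrArg H.map
      (castHom_id (α.obj_eq a).symm)) ≫ (H.mapId (F.obj a)).hom ≫
        eqToHom (castHom_id (congrArg H.obj (α.obj_eq a).symm)).symm) h
    simp only [Category.assoc, eqToHom_trans, eqToHom_trans_assoc, eqToHom_refl,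
      Category.comp_id, Category.id_comp] at h2 ⊢
    exact h2
  app_comp {a b c} f g := by
    have h := congrArg H.map₂ (α.app_comp f g)
    rw [PrelaxFunctor.map₂_comp, PrelaxFunctor.map₂_comp, PrelaxFunctor.map₂_comp,
      PrelaxFunctor.map₂_comp, map₂_castHom₂, PrelaxFunctor.map₂_eqToHom,
      Pseudofunctor.map₂_whisker_left, Pseudofunctor.map₂_whisker_right] at h
    change (H.map₂ (α.app (f ≫ g)) ≫ eqToHom _) ≫ castHom₂ (congrArg H.obj (α.obj_eq a).symm)
        (congrArg H.obj (α.obj_eq c).symm)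
        (H.map₂ (G.mapComp f g).hom ≫ (H.mapComp (G.map f) (G.map g)).hom) =
      (H.map₂ (F.mapComp f g).hom ≫ (H.mapComp (F.map f) (F.map g)).hom) ≫
        (H.map₂ (α.app f) ≫
          eqToHom (map_castHom H (α.obj_eq a).symm (α.obj_eq b).symm (G.map f))) ▷
            H.map (F.map g) ≫
          castHom (congrArg H.obj (α.obj_eq a).symm) (congrArg H.obj (α.obj_eq b).symm)
            (H.map (G.map f)) ◁
              (H.map₂ (α.app g) ≫
                eqToHom (map_castHom H (α.obj_eq b).symm (α.obj_eq c).symm (G.map g))) ≫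
            eqToHom (castHom_comp _ (congrArg H.obj (α.obj_eq b).symm) _ (H.map (G.map f))
              (H.map (G.map g))).symm
    rw [castHom₂_vcomp, castHom₂_mapComp H _ (α.obj_eq b).symm]
    have h2 := congrArg (fun t => t ≫ eqToHom (congrArg H.map
      (castHom_comp (α.obj_eq a).symm (α.obj_eq b).symm (α.obj_eq c).symm (G.map f) (G.map g))) ≫
        (H.mapComp _ _).hom ≫
        eqToHom (by rw [map_castHom, map_castHom, ← castHom_comp])) h
    simp only [Category.assoc, eqToHom_trans, eqToHom_trans_assoc, eqToHom_refl,
      Category.comp_id, Category.id_comp, Iso.inv_hom_id_assoc, comp_whiskerRight,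
      Bicategory.whiskerLeft_comp, eqToHom_whiskerRight, whiskerLeft_eqToHom] at h2 ⊢
    refine h2.trans ?_
    rw [congr_whiskerLeft (map_castHom H (α.obj_eq a).symm (α.obj_eq b).symm (G.map f)).symm]
    simp

/-- The icon between equal pseudofunctors whose 2-cells are identities. -/
def ofEq {F G : A ⥤ᵖ B} (h : F = G) : Icon F G := h ▸ Icon.id F

theorem ofEq_app {F G : A ⥤ᵖ B} (h : F = G) {a b : A} (f : a ⟶ b) :
    (ofEq h).app f = eqToHom (by subst h; rfl) := by
  subst h; rfl

theorem castHom₂_self {C : Type u} [Bicategory.{w, v} C] {x y : C} {f g : x ⟶ y}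
    (p : x = x) (q : y = y) (η : f ⟶ g) : castHom₂ p q η = η := rfl

theorem pseudofunctor_comp_assoc {D : Type u} [Bicategory.{w, v} D]
    (F : A ⥤ᵖ B) (G : B ⥤ᵖ C) (H : C ⥤ᵖ D) : (F.comp G).comp H = F.comp (G.comp H) := by
  have h1 (a) : ((F.comp G).comp H).mapId a = (F.comp (G.comp H)).mapId a := by
    ext
    change H.map₂ (G.map₂ (F.mapId a).hom ≫ (G.mapId (F.obj a)).hom) ≫
        (H.mapId (G.obj (F.obj a))).hom =
      H.map₂ (G.map₂ (F.mapId a).hom) ≫ H.map₂ (G.mapId (F.obj a)).hom ≫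
        (H.mapId (G.obj (F.obj a))).hom
    rw [PrelaxFunctor.map₂_comp, Category.assoc]
  have h2 {a b c} (f : a ⟶ b) (g : b ⟶ c) :
      ((F.comp G).comp H).mapComp f g = (F.comp (G.comp H)).mapComp f g := by
    ext
    change H.map₂ (G.map₂ (F.mapComp f g).hom ≫ (G.mapComp (F.map f) (F.map g)).hom) ≫
        (H.mapComp (G.map (F.map f)) (G.map (F.map g))).hom =
      H.map₂ (G.map₂ (F.mapComp f g).hom) ≫ H.map₂ (G.mapComp (F.map f) (F.map g)).hom ≫
        (H.mapComp (G.map (F.map f)) (G.map (F.map g))).hom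
    rw [PrelaxFunctor.map₂_comp, Category.assoc]
  unfold Pseudofunctor.comp at h1 h2 ⊢
  dsimp only at h1 h2 ⊢
  congr 1
  · funext a; exact h1 a
  · funext a b c f g; exact h2 f g

theorem pseudofunctor_id_comp (F : A ⥤ᵖ B) : (Pseudofunctor.id A).comp F = F := by
  have h1 (a) : ((Pseudofunctor.id A).comp F).mapId a = F.mapId a := by
    ext
    change F.map₂ (𝟙 _) ≫ (F.mapId a).hom = (F.mapId a).hom
    rw [PrelaxFunctor.map₂_id, Category.id_comp]
  have h2 {a b c} (f : a ⟶ b) (g : b ⟶ c) :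
      ((Pseudofunctor.id A).comp F).mapComp f g = F.mapComp f g := by
    ext
    change F.map₂ (𝟙 _) ≫ (F.mapComp f g).hom = (F.mapComp f g).hom
    rw [PrelaxFunctor.map₂_id, Category.id_comp]
  cases F
  unfold Pseudofunctor.comp Pseudofunctor.id at h1 h2 ⊢
  dsimp only at h1 h2 ⊢
  congr 1
  · funext a; exact h1 a
  · funext a b c f g; exact h2 f g

theorem pseudofunctor_comp_id (F : A ⥤ᵖ B) : F.comp (Pseudofunctor.id B) = F := by
  have h1 (a) : (F.comp (Pseudofunctor.id B)).mapId a = F.mapId a := by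
    ext
    change (F.mapId a).hom ≫ 𝟙 _ = (F.mapId a).hom
    rw [Category.comp_id]
  have h2 {a b c} (f : a ⟶ b) (g : b ⟶ c) :
      (F.comp (Pseudofunctor.id B)).mapComp f g = F.mapComp f g := by
    ext
    change (F.mapComp f g).hom ≫ 𝟙 _ = (F.mapComp f g).hom
    rw [Category.comp_id]
  cases F
  unfold Pseudofunctor.comp Pseudofunctor.id at h1 h2 ⊢
  dsimp only at h1 h2 ⊢
  congr 1
  · funext a; exact h1 a
  · funext a b c f g; exact h2 f g

theorem ext_heq {F G : A ⥤ᵖ B} {α β : Icon F G}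
    (h : ∀ {a b : A} (f : a ⟶ b), α.app f ≍ β.app f) : α = β :=
  ext fun f => eq_of_heq (h f)

theorem vcomp_ofEq_app_heq {F G H : A ⥤ᵖ B} (α : Icon F G) (h : G = H) {a b : A} (f : a ⟶ b) :
    (α.vcomp (ofEq h)).app f ≍ α.app f := by
  subst h
  change α.app f ≫ castHom₂ _ _ (𝟙 _) ≫ eqToHom _ ≍ _
  erw [castHom₂_eqToHom _ _ rfl]
  simp

theorem ofEq_vcomp_app_heq {F G H : A ⥤ᵖ B} (h : F = G) (α : Icon G H) {a b : A} (f : a ⟶ b) :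
    ((ofEq h).vcomp α).app f ≍ α.app f := by
  subst h
  exact heq_of_eq (by simp : 𝟙 _ ≫ α.app f ≫ 𝟙 _ = α.app f)

theorem conj_app_heq {F F' G G' : A ⥤ᵖ B} (h : F' = F) (α : Icon F G) (h' : G = G') {a b : A}
    (f : a ⟶ b) : ((ofEq h).vcomp (α.vcomp (ofEq h'))).app f ≍ α.app f :=
  (ofEq_vcomp_app_heq h _ f).trans (vcomp_ofEq_app_heq α h' f)

theorem ofEq_vcomp_ofEq {F G H : A ⥤ᵖ B} (h : F = G) (h' : G = H) :
    (ofEq h).vcomp (ofEq h') = ofEq (h.trans h') := by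
  subst h h'
  exact ext_heq fun f => ofEq_vcomp_app_heq rfl _ f

theorem whiskerLeft_ofEq (F : A ⥤ᵖ B) {G H : B ⥤ᵖ C} (h : G = H) :
    whiskerLeft F (ofEq h) = ofEq (congrArg F.comp h) := by
  subst h; rfl

theorem id_whiskerRight (F : A ⥤ᵖ B) (H : B ⥤ᵖ C) :
    whiskerRight (Icon.id F) H = Icon.id (F.comp H) :=
  ext fun f => (by simp : H.map₂ (𝟙 (F.map f)) ≫ 𝟙 _ = 𝟙 (H.map (F.map f)))

theorem ofEq_whiskerRight {F G : A ⥤ᵖ B} (h : F = G) (H : B ⥤ᵖ C) :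
    whiskerRight (ofEq h) H = ofEq (congrArg (fun K => K.comp H) h) := by
  subst h; exact id_whiskerRight F H

theorem whiskerRight_app_heq {F G : A ⥤ᵖ B} (α : Icon F G) (H : B ⥤ᵖ C) {a b : A} (f : a ⟶ b) :
    (whiskerRight α H).app f ≍ H.map₂ (α.app f) := by
  change H.map₂ (α.app f) ≫ eqToHom (map_castHom H _ _ (G.map f)) ≍ _
  exact comp_eqToHom_heq _ _

theorem comp_whiskerRight {F G H : A ⥤ᵖ B} (α : Icon F G) (β : Icon G H) (K : B ⥤ᵖ C) :
    whiskerRight (α.vcomp β) K = (whiskerRight α K).vcomp (whiskerRight β K) := by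
  refine ext fun {a b} f => ?_
  change K.map₂ (α.app f ≫ castHom₂ (α.obj_eq a).symm (α.obj_eq b).symm (β.app f) ≫
        eqToHom (castHom_castHom _ _ (α.obj_eq a).symm (α.obj_eq b).symm (H.map f))) ≫
      eqToHom (map_castHom K ((α.obj_eq a).trans (β.obj_eq a)).symm
        ((α.obj_eq b).trans (β.obj_eq b)).symm (H.map f)) =
    (K.map₂ (α.app f) ≫
      eqToHom (map_castHom K (α.obj_eq a).symm (α.obj_eq b).symm (G.map f))) ≫
      castHom₂ (congrArg K.obj (α.obj_eq a).symm) (congrArg K.obj (α.obj_eq b).symm)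
        (K.map₂ (β.app f) ≫
          eqToHom (map_castHom K (β.obj_eq a).symm (β.obj_eq b).symm (H.map f))) ≫
        eqToHom (castHom_castHom _ _ _ _ (K.map (H.map f)))
  simp [map₂_castHom₂, castHom₂_vcomp, castHom₂_eqToHom, PrelaxFunctor.map₂_eqToHom]

theorem app_castHom {F G : A ⥤ᵖ B} (α : Icon F G) {x y x' y' : A} (p : x = x') (q : y = y')
    (f : x ⟶ y) : α.app (castHom p q f) = eqToHom (map_castHom F p q f) ≫
      castHom₂ (congrArg F.obj p) (congrArg F.obj q) (α.app f) ≫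
        eqToHom (by rw [map_castHom, castHom_castHom, castHom_castHom]) := by
  subst p q; exact (by simp : α.app f = 𝟙 _ ≫ α.app f ≫ 𝟙 _)

theorem whisker_exchange {F G : A ⥤ᵖ B} {H I : B ⥤ᵖ C} (η : Icon F G) (θ : Icon H I) :
    (whiskerLeft F θ).vcomp (whiskerRight η I) = (whiskerRight η H).vcomp (whiskerLeft G θ) := by
  refine ext fun {a b} f => ?_
  have h := θ.naturality (η.app f)
  rw [app_castHom] at h
  change θ.app (F.map f) ≫ castHom₂ (θ.obj_eq (F.obj a)).symm (θ.obj_eq (F.obj b)).symm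
      (I.map₂ (η.app f) ≫
        eqToHom (map_castHom I (η.obj_eq a).symm (η.obj_eq b).symm (G.map f))) ≫
      eqToHom (castHom_castHom _ _ _ _ (I.map (G.map f))) =
    (H.map₂ (η.app f) ≫ eqToHom (map_castHom H (η.obj_eq a).symm (η.obj_eq b).symm (G.map f))) ≫
      castHom₂ (congrArg H.obj (η.obj_eq a).symm) (congrArg H.obj (η.obj_eq b).symm)
        (θ.app (G.map f)) ≫ eqToHom (castHom_castHom _ _ _ _ (I.map (G.map f)))
  rw [castHom₂_vcomp, castHom₂_eqToHom]
  simp only [Category.assoc]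
  rw [← reassoc_of% h, eqToHom_trans, eqToHom_trans]

theorem id_whiskerLeft {F G : A ⥤ᵖ B} (η : Icon F G) :
    whiskerLeft (Pseudofunctor.id A) η = (ofEq (pseudofunctor_id_comp F)).vcomp
      (η.vcomp (ofEq (pseudofunctor_id_comp G).symm)) :=
  ext_heq fun f => (conj_app_heq _ η _ f).symm

theorem whiskerRight_id {F G : A ⥤ᵖ B} (η : Icon F G) :
    whiskerRight η (Pseudofunctor.id B) = (ofEq (pseudofunctor_comp_id F)).vcomp
      (η.vcomp (ofEq (pseudofunctor_comp_id G).symm)) :=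
  ext_heq fun f => (whiskerRight_app_heq η _ f).trans (conj_app_heq _ η _ f).symm

variable {D : Type u} [Bicategory.{w, v} D]

theorem comp_whiskerLeft (F : A ⥤ᵖ B) (G : B ⥤ᵖ C) {H H' : C ⥤ᵖ D} (η : Icon H H') :
    whiskerLeft (F.comp G) η = (ofEq (pseudofunctor_comp_assoc F G H)).vcomp
      ((whiskerLeft F (whiskerLeft G η)).vcomp
        (ofEq (pseudofunctor_comp_assoc F G H').symm)) :=
  ext_heq fun f => (conj_app_heq _ (whiskerLeft F (whiskerLeft G η)) _ f).symm

theorem whisker_assoc (F : A ⥤ᵖ B) {G G' : B ⥤ᵖ C} (η : Icon G G') (H : C ⥤ᵖ D) :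
    whiskerRight (whiskerLeft F η) H = (ofEq (pseudofunctor_comp_assoc F G H)).vcomp
      ((whiskerLeft F (whiskerRight η H)).vcomp
        (ofEq (pseudofunctor_comp_assoc F G' H).symm)) :=
  ext_heq fun f => (conj_app_heq _ (whiskerLeft F (whiskerRight η H)) _ f).symm

theorem whiskerRight_comp {F F' : A ⥤ᵖ B} (η : Icon F F') (G : B ⥤ᵖ C) (H : C ⥤ᵖ D) :
    whiskerRight η (G.comp H) = (ofEq (pseudofunctor_comp_assoc F G H).symm).vcomp
      ((whiskerRight (whiskerRight η G) H).vcomp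
        (ofEq (pseudofunctor_comp_assoc F' G H))) := by
  refine ext_heq fun {a b} f => (whiskerRight_app_heq η _ f).trans <| HEq.symm <|
    (conj_app_heq _ (whiskerRight (whiskerRight η G) H) _ f).trans <|
      (whiskerRight_app_heq _ H f).trans ?_
  change H.map₂ (G.map₂ (η.app f) ≫ eqToHom (map_castHom G (η.obj_eq a).symm (η.obj_eq b).symm
    (F'.map f))) ≍ H.map₂ (G.map₂ (η.app f))
  rw [PrelaxFunctor.map₂_comp, PrelaxFunctor.map₂_eqToHom]
  exact comp_eqToHom_heq _ _

end Icon

/-- A small (strict) 2-category. -/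
structure TwoCat where
  carrier : Type u
  [bicategory : Bicategory.{u, u} carrier]
  [strict : Bicategory.Strict carrier]

namespace TwoCat

instance : CoeSort TwoCat.{u} (Type u) := ⟨TwoCat.carrier⟩

attribute [instance] bicategory strict

/-- The category of pseudofunctors `A ⥤ᵖ B` and icons. -/
abbrev iconCategory (A : Type u₁) [Bicategory.{w₁, v₁} A] (B : Type u₂) [Bicategory.{w₂, v₂} B] :
    Category (A ⥤ᵖ B) where
  Hom F G := Icon F G
  id := Icon.id
  comp := Icon.vcomp
  id_comp α := by
    apply Icon.ext
    intro a b f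
    exact (by simp : 𝟙 _ ≫ α.app f ≫ 𝟙 _ = α.app f)
  comp_id α := by
    apply Icon.ext
    intro a b f
    change α.app f ≫ castHom₂ _ _ (𝟙 _) ≫ eqToHom _ = α.app f
    erw [castHom₂_eqToHom _ _ rfl]
    simp
  assoc α β γ := by
    apply Icon.ext
    intro a b f
    change (α.app f ≫ castHom₂ _ _ (β.app f) ≫ eqToHom _) ≫ castHom₂ _ _ (γ.app f) ≫ eqToHom _ =
      α.app f ≫ castHom₂ _ _ (β.app f ≫ castHom₂ _ _ (γ.app f) ≫ eqToHom _) ≫ eqToHom _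
    simp [castHom₂_vcomp, castHom₂_castHom₂, castHom₂_eqToHom]

instance : CategoryStruct TwoCat.{u} where
  Hom A B := A ⥤ᵖ B
  id A := Pseudofunctor.id A
  comp F G := F.comp G

instance (A B : TwoCat.{u}) : Category (A ⟶ B) := iconCategory A B

instance : Bicategory TwoCat.{u} where
  whiskerLeft F _ _ α := Icon.whiskerLeft F α
  whiskerRight α H := Icon.whiskerRight α H
  associator F G H :=
    { hom := Icon.ofEq (Icon.pseudofunctor_comp_assoc F G H)
      inv := Icon.ofEq (Icon.pseudofunctor_comp_assoc F G H).symm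
      hom_inv_id := Icon.ofEq_vcomp_ofEq _ _
      inv_hom_id := Icon.ofEq_vcomp_ofEq _ _ }
  leftUnitor F :=
    { hom := Icon.ofEq (Icon.pseudofunctor_id_comp F)
      inv := Icon.ofEq (Icon.pseudofunctor_id_comp F).symm
      hom_inv_id := Icon.ofEq_vcomp_ofEq _ _
      inv_hom_id := Icon.ofEq_vcomp_ofEq _ _ }
  rightUnitor F :=
    { hom := Icon.ofEq (Icon.pseudofunctor_comp_id F)
      inv := Icon.ofEq (Icon.pseudofunctor_comp_id F).symm
      hom_inv_id := Icon.ofEq_vcomp_ofEq _ _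
      inv_hom_id := Icon.ofEq_vcomp_ofEq _ _ }
  whiskerLeft_id _ _ := rfl
  whiskerLeft_comp _ _ _ _ _ _ := rfl
  id_whiskerLeft η := Icon.id_whiskerLeft η
  comp_whiskerLeft F G _ _ η := Icon.comp_whiskerLeft F G η
  id_whiskerRight F G := Icon.id_whiskerRight F G
  comp_whiskerRight η θ I := Icon.comp_whiskerRight η θ I
  whiskerRight_id η := Icon.whiskerRight_id η
  whiskerRight_comp η G H := Icon.whiskerRight_comp η G H
  whisker_assoc F _ _ η H := Icon.whisker_assoc F η H
  whisker_exchange η θ := Icon.whisker_exchange η θ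
  pentagon F G H K := by
    change (Icon.whiskerRight (Icon.ofEq _) _).vcomp ((Icon.ofEq _).vcomp
      (Icon.whiskerLeft _ (Icon.ofEq _))) = (Icon.ofEq _).vcomp (Icon.ofEq _)
    simp only [Icon.ofEq_whiskerRight, Icon.whiskerLeft_ofEq, Icon.ofEq_vcomp_ofEq]
  triangle F G := by
    change (Icon.ofEq _).vcomp (Icon.whiskerLeft _ (Icon.ofEq _)) =
      Icon.whiskerRight (Icon.ofEq _) _
    simp only [Icon.ofEq_whiskerRight, Icon.whiskerLeft_ofEq, Icon.ofEq_vcomp_ofEq]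

theorem ofEq_eq_eqToHom {X Y : TwoCat.{u}} {F G : X ⟶ Y} (h : F = G) :
    (Icon.ofEq h : F ⟶ G) = eqToHom h := by
  subst h; rfl

instance : Bicategory.Strict TwoCat.{u} where
  id_comp {X Y} F := Icon.pseudofunctor_id_comp (A := X) (B := Y) F
  comp_id {X Y} F := Icon.pseudofunctor_comp_id (A := X) (B := Y) F
  assoc {X Y Z W} F G H := Icon.pseudofunctor_comp_assoc (A := X) (B := Y) (C := Z) (D := W) F G H
  leftUnitor_eqToIso {X Y} F :=
    Iso.ext (ofEq_eq_eqToHom (Icon.pseudofunctor_id_comp (A := X) (B := Y) F))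
  rightUnitor_eqToIso {X Y} F :=
    Iso.ext (ofEq_eq_eqToHom (Icon.pseudofunctor_comp_id (A := X) (B := Y) F))
  associator_eqToIso {X Y Z W} F G H :=
    Iso.ext (ofEq_eq_eqToHom
      (Icon.pseudofunctor_comp_assoc (A := X) (B := Y) (C := Z) (D := W) F G H))

end TwoCat
end Icon

open scoped Pseudofunctor.StrongTrans

section Ps

variable {B : Type u₁} [Bicategory.{w₁, v₁} B] {C : Type u₂} [Bicategory.{w₂, v₂} C]

theorem strongTrans_ext {F G : B ⥤ᵖ C} {η θ : F ⟶ G} (h : ∀ a, η.app a = θ.app a)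
    (h' : ∀ {a b : B} (f : a ⟶ b), F.map f ◁ eqToHom (h b) ≫ (θ.naturality f).hom =
      (η.naturality f).hom ≫ eqToHom (h a) ▷ G.map f) : η = θ := by
  obtain ⟨ηa, ηn, _, _, _⟩ := η
  obtain ⟨θa, θn, _, _, _⟩ := θ
  obtain rfl : ηa = θa := funext h
  have : @ηn = @θn := by
    funext a b f
    ext
    simpa using (h' f).symm
  subst this
  rfl

theorem eqToHom_as_app {F G : B ⥤ᵖ C} {η θ : F ⟶ G} (h : η = θ) (a : B) :
    (eqToHom h).as.app a = eqToHom (by rw [h]) := by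
  subst h; rfl

theorem strongTrans_eq_of_modification {F G : B ⥤ᵖ C} {η θ : F ⟶ G} (m : η ⟶ θ)
    (h : ∀ a, η.app a = θ.app a) (hm : ∀ a, m.as.app a = eqToHom (h a)) : η = θ :=
  strongTrans_ext h fun {a b} f => by rw [← hm, ← hm]; exact m.as.naturality f

instance [Strict C] : Strict (B ⥤ᵖ C) :=
  have k1 {F G : B ⥤ᵖ C} (η : F ⟶ G) (a : B) :
      (λ_ η).hom.as.app a = eqToHom (Strict.id_comp (η.app a)) := by
    change (λ_ (η.app a)).hom = _
    rw [Strict.leftUnitor_eqToIso]; rfl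
  have k2 {F G : B ⥤ᵖ C} (η : F ⟶ G) (a : B) :
      (ρ_ η).hom.as.app a = eqToHom (Strict.comp_id (η.app a)) := by
    change (ρ_ (η.app a)).hom = _
    rw [Strict.rightUnitor_eqToIso]; rfl
  have k3 {F G H K : B ⥤ᵖ C} (η : F ⟶ G) (θ : G ⟶ H) (κ : H ⟶ K) (a : B) :
      (α_ η θ κ).hom.as.app a = eqToHom (Strict.assoc (η.app a) (θ.app a) (κ.app a)) := by
    change (α_ (η.app a) (θ.app a) (κ.app a)).hom = _
    rw [Strict.associator_eqToIso]; rfl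
  { id_comp := fun η => strongTrans_eq_of_modification _ _ (k1 η)
    comp_id := fun η => strongTrans_eq_of_modification _ _ (k2 η)
    assoc := fun η θ κ => strongTrans_eq_of_modification _ _ (k3 η θ κ)
    leftUnitor_eqToIso := fun η => by
      ext a
      exact (k1 η a).trans (eqToHom_as_app (strongTrans_eq_of_modification _ _ (k1 η)) a).symm
    rightUnitor_eqToIso := fun η => by
      ext a
      exact (k2 η a).trans (eqToHom_as_app (strongTrans_eq_of_modification _ _ (k2 η)) a).symm
    associator_eqToIso := fun η θ κ => by
      ext a
      exact (k3 η θ κ a).trans (eqToHom_as_app (strongTrans_eq_of_modification _ _ (k3 η θ κ)) a).symm }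

/-- The 2-category `Ps(B, C)` of 2-functors, pseudonatural transformations and modifications:
the full sub-2-category, on the 2-functors, of the 2-category of pseudofunctors. -/
abbrev Ps (B : Type u₁) [Bicategory.{w₁, v₁} B] (C : Type u₂) [Bicategory.{w₂, v₂} C] :=
  InducedBicategory (B ⥤ᵖ C) (fun F : StrictPseudofunctor B C => F.toPseudofunctor)

variable {D : Type u₃} [Bicategory.{w₃, v₃} D]

theorem map₂_associator_inv_eq (H : C ⥤ᵖ D) {a b c d : C} (f : a ⟶ b) (g : b ⟶ c) (h : c ⟶ d) :
    H.map₂ (α_ f g h).inv = (H.mapComp f (g ≫ h)).hom ≫ H.map f ◁ (H.mapComp g h).hom ≫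
      (α_ (H.map f) (H.map g) (H.map h)).inv ≫ (H.mapComp f g).inv ▷ H.map h ≫
        (H.mapComp (f ≫ g) h).inv := by
  have e : H.map₂Iso (α_ f g h) = H.mapComp (f ≫ g) h ≪≫ whiskerRightIso (H.mapComp f g) _ ≪≫
      α_ _ _ _ ≪≫ whiskerLeftIso _ (H.mapComp g h).symm ≪≫ (H.mapComp f (g ≫ h)).symm :=
    Iso.ext (H.map₂_associator f g h)
  refine (congrArg Iso.inv e).trans ?_
  simp

theorem map₂_rightUnitor_inv_eq (H : C ⥤ᵖ D) {a b : C} (f : a ⟶ b) :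
    H.map₂ (ρ_ f).inv = (ρ_ (H.map f)).inv ≫ H.map f ◁ (H.mapId b).inv ≫
      (H.mapComp f (𝟙 b)).inv := by
  have e : H.map₂Iso (ρ_ f) = H.mapComp f (𝟙 b) ≪≫ whiskerLeftIso _ (H.mapId b) ≪≫ ρ_ _ :=
    Iso.ext (H.map₂_right_unitor f)
  refine (congrArg Iso.inv e).trans ?_
  simp

/-- Whiskering of a pseudonatural transformation with a pseudofunctor on the target side. -/
def strongTransMap {F G : B ⥤ᵖ C} (η : F ⟶ G) (H : C ⥤ᵖ D) : F.comp H ⟶ G.comp H where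
  app b := H.map (η.app b)
  naturality f := (H.mapComp _ _).symm ≪≫ H.map₂Iso (η.naturality f) ≪≫ H.mapComp _ _
  naturality_naturality {a b f g} β := by
    change H.map₂ (F.map₂ β) ▷ H.map (η.app b) ≫ (H.mapComp _ _).inv ≫
        H.map₂ (η.naturality g).hom ≫ (H.mapComp _ _).hom =
      ((H.mapComp _ _).inv ≫ H.map₂ (η.naturality f).hom ≫ (H.mapComp _ _).hom) ≫
        H.map (η.app a) ◁ H.map₂ (G.map₂ β)
    have h := congrArg (fun t => (H.mapComp _ _).inv ≫ H.map₂ t ≫ (H.mapComp _ _).hom)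
      (η.naturality_naturality β)
    simp only [PrelaxFunctor.map₂_comp, Pseudofunctor.map₂_whisker_left,
      Pseudofunctor.map₂_whisker_right, Category.assoc, Iso.inv_hom_id_assoc, Iso.inv_hom_id,
      Category.comp_id] at h ⊢
    exact h
  naturality_id a := by
    change ((H.mapComp _ _).inv ≫ H.map₂ (η.naturality (𝟙 a)).hom ≫ (H.mapComp _ _).hom) ≫
        H.map (η.app a) ◁ (H.map₂ (G.mapId a).hom ≫ (H.mapId (G.obj a)).hom) =
      (H.map₂ (F.mapId a).hom ≫ (H.mapId (F.obj a)).hom) ▷ H.map (η.app a) ≫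
        (λ_ (H.map (η.app a))).hom ≫ (ρ_ (H.map (η.app a))).inv
    have h := congrArg (fun t => (H.mapComp _ _).inv ≫ H.map₂ t ≫ (H.mapComp _ _).hom ≫
      H.map (η.app a) ◁ (H.mapId (G.obj a)).hom) (η.naturality_id a)
    simp only [PrelaxFunctor.map₂_comp, Pseudofunctor.map₂_whisker_left,
      Pseudofunctor.map₂_whisker_right, Category.assoc, Iso.inv_hom_id_assoc, Iso.inv_hom_id,
      Category.comp_id, Pseudofunctor.map₂_left_unitor, map₂_rightUnitor_inv_eq,
      Bicategory.whiskerLeft_comp, comp_whiskerRight] at h ⊢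
    refine h.trans ?_
    simp
  naturality_comp {a b c} f g := by
    change ((H.mapComp _ _).inv ≫ H.map₂ (η.naturality (f ≫ g)).hom ≫ (H.mapComp _ _).hom) ≫
        H.map (η.app a) ◁ (H.map₂ (G.mapComp f g).hom ≫ (H.mapComp (G.map f) (G.map g)).hom) =
      (H.map₂ (F.mapComp f g).hom ≫ (H.mapComp (F.map f) (F.map g)).hom) ▷ H.map (η.app c) ≫
        (α_ _ _ _).hom ≫ H.map (F.map f) ◁ ((H.mapComp _ _).inv ≫
          H.map₂ (η.naturality g).hom ≫ (H.mapComp _ _).hom) ≫ (α_ _ _ _).inv ≫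
          ((H.mapComp _ _).inv ≫ H.map₂ (η.naturality f).hom ≫ (H.mapComp _ _).hom) ▷
            H.map (G.map g) ≫ (α_ _ _ _).hom
    have h := congrArg (fun t => (H.mapComp _ _).inv ≫ H.map₂ t ≫ (H.mapComp _ _).hom ≫
      H.map (η.app a) ◁ (H.mapComp (G.map f) (G.map g)).hom) (η.naturality_comp f g)
    simp only [PrelaxFunctor.map₂_comp, Pseudofunctor.map₂_whisker_left,
      Pseudofunctor.map₂_whisker_right, Category.assoc, Iso.inv_hom_id_assoc, Iso.inv_hom_id,
      Category.comp_id, Pseudofunctor.map₂_associator,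
      map₂_associator_inv_eq,
      Bicategory.whiskerLeft_comp, comp_whiskerRight] at h ⊢
    refine h.trans ?_
    simp

end Ps

section Ev

variable {B : Type u₁} [Bicategory.{w₁, v₁} B] {C : Type u₂} [Bicategory.{w₂, v₂} C]

/-- The comparison 2-cell of the evaluation pseudofunctor: `f₁₂ ≅ f₁ ≫ f₂` followed by
`n : f₂ ≫ s ≅ r ≫ g₂`, up to associativity. -/
abbrev evComp {x y z p q : C} {f₁₂ : x ⟶ z} {f₁ : x ⟶ y} {f₂ : y ⟶ z} (φ : f₁₂ ≅ f₁ ≫ f₂)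
    {s : z ⟶ q} {r : y ⟶ p} {g₂ : p ⟶ q} (n : f₂ ≫ s ≅ r ≫ g₂) {w : C} (t : q ⟶ w) :
    f₁₂ ≫ s ≫ t ≅ (f₁ ≫ r) ≫ g₂ ≫ t :=
  whiskerRightIso φ (s ≫ t) ≪≫ α_ f₁ f₂ (s ≫ t) ≪≫
    whiskerLeftIso f₁ ((α_ f₂ s t).symm ≪≫ whiskerRightIso n t ≪≫ α_ r g₂ t) ≪≫
      (α_ f₁ r (g₂ ≫ t)).symm

theorem evComp_left {x y z p q : C} {f₁₂ f₁₂' : x ⟶ z} {f₁ : x ⟶ y} {f₂ f₂' : y ⟶ z}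
    {φ : f₁₂ ≅ f₁ ≫ f₂} {φ' : f₁₂' ≅ f₁ ≫ f₂'} {s : z ⟶ q} {r : y ⟶ p} {g₂ g₂' : p ⟶ q}
    {n : f₂ ≫ s ≅ r ≫ g₂} {n' : f₂' ≫ s ≅ r ≫ g₂'} {w : C} {t t' : q ⟶ w}
    {β₁ : f₁₂ ⟶ f₁₂'} {β : f₂ ⟶ f₂'} {β' : g₂ ⟶ g₂'} {m : t ⟶ t'}
    (h : β₁ = φ.hom ≫ f₁ ◁ β ≫ φ'.inv) (h' : β ▷ s ≫ n'.hom = n.hom ≫ r ◁ β') :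
    β₁ ▷ (s ≫ t) ≫ f₁₂' ◁ s ◁ m =
      (evComp φ n t).hom ≫ (f₁ ≫ r) ◁ (β' ▷ t ≫ g₂' ◁ m) ≫ (evComp φ' n' t').inv := by
  rw [← Category.assoc, Iso.eq_comp_inv]
  subst h
  calc _ = φ.hom ▷ (s ≫ t) ⊗≫ f₁ ◁ β ▷ (s ≫ t) ⊗≫ φ'.inv ▷ (s ≫ t) ≫ (f₁₂' ◁ s ◁ m ≫
            φ'.hom ▷ (s ≫ t')) ⊗≫ f₁ ◁ n'.hom ▷ t' ⊗≫ 𝟙 _ := by simp; bicategory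
    _ = φ.hom ▷ (s ≫ t) ⊗≫ f₁ ◁ β ▷ (s ≫ t) ⊗≫ (φ'.inv ▷ (s ≫ t) ≫
            φ'.hom ▷ (s ≫ t)) ≫ (f₁ ≫ f₂') ◁ s ◁ m ⊗≫ f₁ ◁ n'.hom ▷ t' ⊗≫ 𝟙 _ := by
        rw [whisker_exchange]; bicategory
    _ = φ.hom ▷ (s ≫ t) ⊗≫ f₁ ◁ β ▷ (s ≫ t) ⊗≫ f₁ ◁ ((f₂' ≫ s) ◁ m ≫ n'.hom ▷ t') ⊗≫ 𝟙 _ := by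
        rw [inv_hom_whiskerRight]; bicategory
    _ = φ.hom ▷ (s ≫ t) ⊗≫ f₁ ◁ (β ▷ s ≫ n'.hom) ▷ t ⊗≫ f₁ ◁ r ◁ g₂' ◁ m ⊗≫ 𝟙 _ := by
        rw [whisker_exchange]; bicategory
    _ = _ := by
        rw [h']; simp; bicategory

theorem evComp_right {x y z p q : C} {f₁₂ f₁₂' : x ⟶ z} {f₁ f₁' : x ⟶ y} {f₂ : y ⟶ z}
    {φ : f₁₂ ≅ f₁ ≫ f₂} {φ' : f₁₂' ≅ f₁' ≫ f₂} {s s' : z ⟶ q} {r r' : y ⟶ p} {g₂ : p ⟶ q}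
    {n : f₂ ≫ s ≅ r ≫ g₂} {n' : f₂ ≫ s' ≅ r' ≫ g₂} {w : C} {t : q ⟶ w}
    {β₁ : f₁₂ ⟶ f₁₂'} {β : f₁ ⟶ f₁'} {m : s ⟶ s'} {m' : r ⟶ r'}
    (h : β₁ = φ.hom ≫ β ▷ f₂ ≫ φ'.inv) (h' : f₂ ◁ m ≫ n'.hom = n.hom ≫ m' ▷ g₂) :
    β₁ ▷ (s ≫ t) ≫ f₁₂' ◁ m ▷ t =
      (evComp φ n t).hom ≫ (β ▷ r ≫ f₁' ◁ m') ▷ (g₂ ≫ t) ≫ (evComp φ' n' t).inv := by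
  rw [← Category.assoc, Iso.eq_comp_inv]
  subst h
  calc _ = φ.hom ▷ (s ≫ t) ⊗≫ β ▷ f₂ ▷ (s ≫ t) ⊗≫ φ'.inv ▷ (s ≫ t) ⊗≫ (f₁₂' ◁ m ≫
            φ'.hom ▷ s') ▷ t ⊗≫ f₁' ◁ n'.hom ▷ t ⊗≫ 𝟙 _ := by simp; bicategory
    _ = φ.hom ▷ (s ≫ t) ⊗≫ β ▷ f₂ ▷ (s ≫ t) ⊗≫ (φ'.inv ▷ (s ≫ t) ≫
            φ'.hom ▷ (s ≫ t)) ⊗≫ (f₁' ≫ f₂) ◁ m ▷ t ⊗≫ f₁' ◁ n'.hom ▷ t ⊗≫ 𝟙 _ := by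
        rw [whisker_exchange]; bicategory
    _ = φ.hom ▷ (s ≫ t) ⊗≫ β ▷ f₂ ▷ (s ≫ t) ⊗≫ f₁' ◁ (f₂ ◁ m ≫ n'.hom) ▷ t ⊗≫ 𝟙 _ := by
        rw [inv_hom_whiskerRight]; bicategory
    _ = φ.hom ▷ (s ≫ t) ⊗≫ (β ▷ (f₂ ≫ s) ≫ f₁' ◁ n.hom) ▷ t ⊗≫ f₁' ◁ m' ▷ g₂ ▷ t ⊗≫ 𝟙 _ := by
        rw [h']; bicategory
    _ = _ := by
        rw [← whisker_exchange]; simp; bicategory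

theorem evComp_assoc {x y z w : C} {f₁ : x ⟶ y} {f₂ : y ⟶ z} {f₃ : z ⟶ w} {f₁₂ : x ⟶ z}
    {f₂₃ : y ⟶ w} {k k' : x ⟶ w} {a : k ⟶ k'} {φ₁₂ : f₁₂ ≅ f₁ ≫ f₂} {φ : k ≅ f₁₂ ≫ f₃}
    {φ₂₃ : f₂₃ ≅ f₂ ≫ f₃} {φ' : k' ≅ f₁ ≫ f₂₃}
    {y' z' w' z'' w'' w₃ : C} {g₂ : y' ⟶ z'} {g₃ : z' ⟶ w'} {g₂₃ : y' ⟶ w'} {γ : g₂₃ ≅ g₂ ≫ g₃}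
    {h₃ : z'' ⟶ w''} {ηy : y ⟶ y'} {ηz : z ⟶ z'} {ηw : w ⟶ w'} {θz : z' ⟶ z''} {θw : w' ⟶ w''}
    {κ : w'' ⟶ w₃} {n₂ : f₂ ≫ ηz ≅ ηy ≫ g₂} {n₃ : f₃ ≫ ηw ≅ ηz ≫ g₃}
    {n₂₃ : f₂₃ ≫ ηw ≅ ηy ≫ g₂₃} {m₃ : g₃ ≫ θw ≅ θz ≫ h₃}
    (h : a = φ.hom ≫ φ₁₂.hom ▷ f₃ ≫ (α_ f₁ f₂ f₃).hom ≫ f₁ ◁ φ₂₃.inv ≫ φ'.inv)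
    (h' : n₂₃.hom ≫ ηy ◁ γ.hom = φ₂₃.hom ▷ ηw ≫ (α_ _ _ _).hom ≫ f₂ ◁ n₃.hom ≫
      (α_ _ _ _).inv ≫ n₂.hom ▷ g₃ ≫ (α_ _ _ _).hom) :
    a ▷ ((ηw ≫ θw) ≫ κ) ≫ k' ◁ (α_ ηw θw κ).hom =
      (evComp φ ((α_ f₃ ηw θw).symm ≪≫ whiskerRightIso n₃ θw ≪≫ α_ ηz g₃ θw ≪≫
        whiskerLeftIso ηz m₃ ≪≫ (α_ ηz θz h₃).symm) κ).hom ≫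
      (evComp φ₁₂ n₂ θz).hom ▷ (h₃ ≫ κ) ≫ (α_ (f₁ ≫ ηy) (g₂ ≫ θz) (h₃ ≫ κ)).hom ≫
      (f₁ ≫ ηy) ◁ (evComp γ m₃ κ).inv ≫ (evComp φ' n₂₃ (θw ≫ κ)).inv := by
  have key : (a ▷ ((ηw ≫ θw) ≫ κ) ≫ k' ◁ (α_ ηw θw κ).hom) ≫ (evComp φ' n₂₃ (θw ≫ κ)).hom ≫
      (f₁ ≫ ηy) ◁ (evComp γ m₃ κ).hom =
      (evComp φ ((α_ f₃ ηw θw).symm ≪≫ whiskerRightIso n₃ θw ≪≫ α_ ηz g₃ θw ≪≫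
        whiskerLeftIso ηz m₃ ≪≫ (α_ ηz θz h₃).symm) κ).hom ≫
      (evComp φ₁₂ n₂ θz).hom ▷ (h₃ ≫ κ) ≫ (α_ (f₁ ≫ ηy) (g₂ ≫ θz) (h₃ ≫ κ)).hom := by
    have h2 : a ≫ φ'.hom ≫ f₁ ◁ φ₂₃.hom = φ.hom ≫ φ₁₂.hom ▷ f₃ ≫ (α_ f₁ f₂ f₃).hom := by
      rw [h]; simp
    calc _ = 𝟙 (k ≫ (ηw ≫ θw) ≫ κ) ⊗≫ a ▷ (ηw ≫ θw ≫ κ) ⊗≫ φ'.hom ▷ (ηw ≫ θw ≫ κ) ⊗≫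
          f₁ ◁ (n₂₃.hom ≫ ηy ◁ γ.hom) ▷ (θw ≫ κ) ⊗≫ f₁ ◁ ηy ◁ g₂ ◁ m₃.hom ▷ κ ⊗≫ 𝟙 ((f₁ ≫ ηy) ≫ (g₂ ≫ θz) ≫ h₃ ≫ κ) := by
          simp; bicategory
      _ = 𝟙 (k ≫ (ηw ≫ θw) ≫ κ) ⊗≫ (a ≫ φ'.hom ≫ f₁ ◁ φ₂₃.hom) ▷ (ηw ≫ θw ≫ κ) ⊗≫ f₁ ◁ f₂ ◁ n₃.hom ▷ (θw ≫ κ) ⊗≫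
          f₁ ◁ (n₂.hom ▷ (g₃ ≫ θw) ≫ (ηy ≫ g₂) ◁ m₃.hom) ▷ κ ⊗≫ 𝟙 ((f₁ ≫ ηy) ≫ (g₂ ≫ θz) ≫ h₃ ≫ κ) := by
          rw [h']; bicategory
      _ = 𝟙 (k ≫ (ηw ≫ θw) ≫ κ) ⊗≫ φ.hom ▷ (ηw ≫ θw ≫ κ) ⊗≫ (φ₁₂.hom ▷ (f₃ ≫ ηw) ≫ (f₁ ≫ f₂) ◁ n₃.hom) ▷ (θw ≫ κ) ⊗≫
          f₁ ◁ ((f₂ ≫ ηz) ◁ m₃.hom ≫ n₂.hom ▷ (θz ≫ h₃)) ▷ κ ⊗≫ 𝟙 ((f₁ ≫ ηy) ≫ (g₂ ≫ θz) ≫ h₃ ≫ κ) := by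
          rw [h2, whisker_exchange]; bicategory
      _ = 𝟙 (k ≫ (ηw ≫ θw) ≫ κ) ⊗≫ φ.hom ▷ (ηw ≫ θw ≫ κ) ⊗≫ f₁₂ ◁ n₃.hom ▷ (θw ≫ κ) ⊗≫
          (φ₁₂.hom ▷ (ηz ≫ g₃ ≫ θw) ≫ (f₁ ≫ f₂) ◁ ηz ◁ m₃.hom) ▷ κ ⊗≫
            f₁ ◁ n₂.hom ▷ (θz ≫ h₃ ≫ κ) ⊗≫ 𝟙 ((f₁ ≫ ηy) ≫ (g₂ ≫ θz) ≫ h₃ ≫ κ) := by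
          rw [← whisker_exchange]; bicategory
      _ = _ := by
          rw [← whisker_exchange]; simp; bicategory
  have k2 := congrArg (fun t => t ≫ (f₁ ≫ ηy) ◁ (evComp γ m₃ κ).inv ≫
    (evComp φ' n₂₃ (θw ≫ κ)).inv) key
  simp only [Category.assoc, whiskerLeft_hom_inv_assoc, Iso.hom_inv_id, Category.comp_id] at k2 ⊢
  exact k2

theorem evComp_leftUnitor {x y w : C} {f₁ : x ⟶ x} {f₂ k : x ⟶ y} {φ : k ≅ f₁ ≫ f₂}
    {a : k ⟶ f₂} {t : y ⟶ w} {i : f₁ ≅ 𝟙 x}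
    (h : a = φ.hom ≫ i.hom ▷ f₂ ≫ (λ_ f₂).hom) :
    a ▷ (𝟙 _ ≫ t) ≫ f₂ ◁ (λ_ t).hom =
      (evComp φ ((ρ_ f₂) ≪≫ (λ_ f₂).symm) t).hom ≫ ((ρ_ f₁).hom ≫ i.hom) ▷ (f₂ ≫ t) ≫
        (λ_ (f₂ ≫ t)).hom := by
  subst h; simp

theorem evComp_rightUnitor {x y w : C} {f₁ k : x ⟶ y} {f₂ : y ⟶ y} {φ : k ≅ f₁ ≫ f₂}
    {a : k ⟶ f₁} {s : y ⟶ w} {g₂ : w ⟶ w} {n : f₂ ≫ s ≅ s ≫ g₂} {i : f₂ ≅ 𝟙 y} {j : g₂ ≅ 𝟙 w}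
    (h : a = φ.hom ≫ f₁ ◁ i.hom ≫ (ρ_ f₁).hom)
    (h' : n.hom ≫ s ◁ j.hom = i.hom ▷ s ≫ (λ_ s).hom ≫ (ρ_ s).inv) :
    a ▷ (s ≫ 𝟙 w) ≫ f₁ ◁ (ρ_ s).hom =
      (evComp φ n (𝟙 w)).hom ≫ (f₁ ≫ s) ◁ ((ρ_ g₂).hom ≫ j.hom) ≫ (ρ_ (f₁ ≫ s)).hom := by
  symm
  calc _ = 𝟙 (k ≫ s ≫ 𝟙 w) ⊗≫ φ.hom ▷ s ⊗≫ f₁ ◁ (n.hom ≫ s ◁ j.hom) ⊗≫ 𝟙 (f₁ ≫ s) := by simp; bicategory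
    _ = _ := by rw [h', h]; simp; bicategory

/-- The evaluation pseudofunctor `(F, b) ↦ F b`, sending a 1-cell `(η, g) : (F, b) ⟶ (G, b')` to
`F g ≫ η b'`. Its comparison 2-cells are given by the naturality 2-cells of `η`. -/
def evaluation : ((B ⥤ᵖ C) × B) ⥤ᵖ C where
  obj x := x.1.obj x.2
  map {x y} φ := x.1.map φ.2 ≫ φ.1.app y.2
  map₂ {x y φ ψ} μ := x.1.map₂ μ.2 ▷ φ.1.app y.2 ≫ x.1.map ψ.2 ◁ μ.1.as.app y.2
  map₂_id {x y} φ := by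
    change x.1.map₂ (𝟙 φ.2) ▷ φ.1.app y.2 ≫ x.1.map φ.2 ◁ 𝟙 (φ.1.app y.2) = 𝟙 _
    simp
  map₂_comp {x y φ ψ χ} μ ν := by
    change x.1.map₂ (μ.2 ≫ ν.2) ▷ φ.1.app y.2 ≫
        x.1.map χ.2 ◁ (μ.1.as.app y.2 ≫ ν.1.as.app y.2) =
      (x.1.map₂ μ.2 ▷ φ.1.app y.2 ≫ x.1.map ψ.2 ◁ μ.1.as.app y.2) ≫
        x.1.map₂ ν.2 ▷ ψ.1.app y.2 ≫ x.1.map χ.2 ◁ ν.1.as.app y.2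
    simp [whisker_exchange_assoc]
  mapId x := (ρ_ (x.1.map (𝟙 x.2))) ≪≫ x.1.mapId x.2
  mapComp {x y z} φ ψ := evComp (x.1.mapComp φ.2 ψ.2) (φ.1.naturality ψ.2) (ψ.1.app z.2)
  map₂_whisker_left {x y z} φ ψ ψ' μ :=
    evComp_left (x.1.map₂_whisker_left φ.2 μ.2) (φ.1.naturality_naturality μ.2)
  map₂_whisker_right {x y z φ φ'} μ ψ :=
    evComp_right (x.1.map₂_whisker_right μ.2 ψ.2) (μ.1.as.naturality ψ.2)
  map₂_associator {x y z w} φ ψ χ :=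
    evComp_assoc (x.1.map₂_associator φ.2 ψ.2 χ.2) (φ.1.naturality_comp ψ.2 χ.2)
  map₂_left_unitor {x y} φ := evComp_leftUnitor (x.1.map₂_left_unitor φ.2)
  map₂_right_unitor {x y} φ :=
    evComp_rightUnitor (x.1.map₂_right_unitor φ.2) (φ.1.naturality_id y.2)

variable {A : Type u₃} [Bicategory.{w₃, v₃} A]

/-- The product of a pseudofunctor with an identity pseudofunctor. -/
def prodId (F : A ⥤ᵖ B) (C : Type u₂) [Bicategory.{w₂, v₂} C] : (A × C) ⥤ᵖ (B × C) where
  obj x := (F.obj x.1, x.2)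
  map φ := (F.map φ.1, φ.2)
  map₂ μ := (F.map₂ μ.1, μ.2)
  map₂_id φ := Prod.ext (F.map₂_id φ.1) rfl
  map₂_comp μ ν := Prod.ext (F.map₂_comp μ.1 ν.1) rfl
  mapId x := Iso.prod (F.mapId x.1) (Iso.refl (𝟙 x.2))
  mapComp φ ψ := Iso.prod (F.mapComp φ.1 ψ.1) (Iso.refl (φ.2 ≫ ψ.2))
  map₂_whisker_left φ _ _ μ := Prod.ext (F.map₂_whisker_left φ.1 μ.1)
    (by simp : φ.2 ◁ μ.2 = 𝟙 _ ≫ φ.2 ◁ μ.2 ≫ 𝟙 _)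
  map₂_whisker_right μ ψ := Prod.ext (F.map₂_whisker_right μ.1 ψ.1)
    (by simp : μ.2 ▷ ψ.2 = 𝟙 _ ≫ μ.2 ▷ ψ.2 ≫ 𝟙 _)
  map₂_associator φ ψ χ := Prod.ext (F.map₂_associator φ.1 ψ.1 χ.1)
    (by simp : (α_ φ.2 ψ.2 χ.2).hom =
      𝟙 _ ≫ 𝟙 _ ▷ χ.2 ≫ (α_ φ.2 ψ.2 χ.2).hom ≫ φ.2 ◁ 𝟙 _ ≫ 𝟙 _)
  map₂_left_unitor φ := Prod.ext (F.map₂_left_unitor φ.1)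
    (by simp : (λ_ φ.2).hom = 𝟙 _ ≫ 𝟙 _ ▷ φ.2 ≫ (λ_ φ.2).hom)
  map₂_right_unitor φ := Prod.ext (F.map₂_right_unitor φ.1)
    (by simp : (ρ_ φ.2).hom = 𝟙 _ ≫ φ.2 ◁ 𝟙 _ ≫ (ρ_ φ.2).hom)

end Ev

section Gray

variable {B : Type u₁} [Bicategory.{w₁, v₁} B] {C : Type u₂} [Bicategory.{w₂, v₂} C]
  {D : Type u₃} [Bicategory.{w₃, v₃} D]

/-- A 2-cell is an identity: its source and target are equal, and it is the identity 2-cell. -/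
def IsIdentity {x y : C} {f g : x ⟶ y} (η : f ⟶ g) : Prop := ∃ h : f = g, η = eqToHom h

namespace IsIdentity

theorem comp {x y : C} {f g h : x ⟶ y} {η : f ⟶ g} {θ : g ⟶ h} (p : IsIdentity η) (q : IsIdentity θ) :
    IsIdentity (η ≫ θ) := by
  obtain ⟨rfl, rfl⟩ := p; obtain ⟨rfl, rfl⟩ := q; exact ⟨rfl, by simp⟩

theorem id {x y : C} (f : x ⟶ y) : IsIdentity (𝟙 f) := ⟨rfl, rfl⟩

theorem hom {x y : C} {f g : x ⟶ y} (h : f = g) : IsIdentity (eqToHom h) := ⟨h, rfl⟩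

theorem whiskerLeft {x y z : C} (k : z ⟶ x) {f g : x ⟶ y} {η : f ⟶ g} (p : IsIdentity η) :
    IsIdentity (k ◁ η) := by
  obtain ⟨rfl, rfl⟩ := p; exact ⟨rfl, by simp⟩

theorem whiskerRight {x y z : C} {f g : x ⟶ y} {η : f ⟶ g} (p : IsIdentity η) (k : y ⟶ z) :
    IsIdentity (η ▷ k) := by
  obtain ⟨rfl, rfl⟩ := p; exact ⟨rfl, by simp⟩

theorem inv {x y : C} {f g : x ⟶ y} {η : f ≅ g} (p : IsIdentity η.hom) : IsIdentity η.inv := by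
  obtain ⟨rfl, h⟩ := p
  obtain rfl : η = Iso.refl _ := Iso.ext h
  exact ⟨rfl, rfl⟩

theorem map₂ (H : C ⥤ᵖ D) {x y : C} {f g : x ⟶ y} {η : f ⟶ g} (p : IsIdentity η) :
    IsIdentity (H.map₂ η) := by
  obtain ⟨rfl, rfl⟩ := p; exact ⟨rfl, by simp⟩

theorem eq {x y : C} {f g : x ⟶ y} {η θ : f ⟶ g} (p : IsIdentity η) (q : IsIdentity θ) : η = θ := by
  obtain ⟨_, rfl⟩ := p; obtain ⟨_, rfl⟩ := q; rfl

theorem mapComp (H : StrictPseudofunctor C D) {x y z : C} (f : x ⟶ y) (g : y ⟶ z) :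
    IsIdentity (H.mapComp f g).hom := by
  rw [H.mapComp_eq_eqToIso]; exact hom (H.map_comp f g)

theorem mapId (H : StrictPseudofunctor C D) (x : C) : IsIdentity (H.mapId x).hom := by
  rw [H.mapId_eq_eqToIso]; exact hom (H.map_id x)

theorem associator [Strict C] {x y z w : C} (f : x ⟶ y) (g : y ⟶ z) (h : z ⟶ w) :
    IsIdentity (α_ f g h).hom := by
  rw [Strict.associator_eqToIso]; exact hom (Strict.assoc f g h)

theorem leftUnitor [Strict C] {x y : C} (f : x ⟶ y) : IsIdentity (λ_ f).hom := by
  rw [Strict.leftUnitor_eqToIso]; exact hom (Strict.id_comp f)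

theorem rightUnitor [Strict C] {x y : C} (f : x ⟶ y) : IsIdentity (ρ_ f).hom := by
  rw [Strict.rightUnitor_eqToIso]; exact hom (Strict.comp_id f)

end IsIdentity

/-- Whiskering of a modification with a pseudofunctor on the target side. -/
def modificationMap {F G : B ⥤ᵖ C} {η θ : F ⟶ G} (m : η ⟶ θ) (H : C ⥤ᵖ D) :
    strongTransMap η H ⟶ strongTransMap θ H :=
  ⟨{ app := fun b => H.map₂ (m.as.app b)
     naturality := fun {a b} f => by
       change H.map (F.map f) ◁ H.map₂ (m.as.app b) ≫ (H.mapComp _ _).inv ≫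
           H.map₂ (θ.naturality f).hom ≫ (H.mapComp _ _).hom =
         ((H.mapComp _ _).inv ≫ H.map₂ (η.naturality f).hom ≫ (H.mapComp _ _).hom) ≫
           H.map₂ (m.as.app a) ▷ H.map (G.map f)
       have h := congrArg (fun t => (H.mapComp _ _).inv ≫ H.map₂ t ≫ (H.mapComp _ _).hom)
         (m.as.naturality f)
       simp only [PrelaxFunctor.map₂_comp, Pseudofunctor.map₂_whisker_left,
         Pseudofunctor.map₂_whisker_right, Category.assoc, Iso.inv_hom_id_assoc, Iso.inv_hom_id,
         Category.comp_id] at h ⊢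
       exact h }⟩

theorem map₂_leftUnitor_inv_eq (H : C ⥤ᵖ D) {a b : C} (f : a ⟶ b) :
    H.map₂ (λ_ f).inv = (λ_ (H.map f)).inv ≫ (H.mapId a).inv ▷ H.map f ≫
      (H.mapComp (𝟙 a) f).inv := by
  have e : H.map₂Iso (λ_ f) = H.mapComp (𝟙 a) f ≪≫ whiskerRightIso (H.mapId a) _ ≪≫ λ_ _ :=
    Iso.ext (H.map₂_left_unitor f)
  refine (congrArg Iso.inv e).trans ?_
  simp

theorem strongTransMap_id [Strict D] (F : B ⥤ᵖ C) (H : StrictPseudofunctor C D) :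
    strongTransMap (𝟙 F) H.toPseudofunctor = 𝟙 (F.comp H.toPseudofunctor) := by
  refine strongTrans_eq_of_modification (⟨{
    app := fun a => (H.mapId (F.obj a)).hom
    naturality := fun {a b} f => ?_ }⟩ : strongTransMap (𝟙 F) H.toPseudofunctor ⟶
      𝟙 (F.comp H.toPseudofunctor))
    (fun a => H.map_id (F.obj a)) (fun a => by
      change (H.mapId (F.obj a)).hom = _
      rw [H.mapId_eq_eqToIso]; rfl)
  change H.map (F.map f) ◁ (H.mapId (F.obj b)).hom ≫ (ρ_ _).hom ≫ (λ_ _).inv =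
    ((H.mapComp _ _).inv ≫ H.map₂ ((ρ_ (F.map f)).hom ≫ (λ_ (F.map f)).inv) ≫
      (H.mapComp _ _).hom) ≫ (H.mapId (F.obj a)).hom ▷ H.map (F.map f)
  simp only [PrelaxFunctor.map₂_comp, Category.assoc, Pseudofunctor.map₂_right_unitor,
    map₂_leftUnitor_inv_eq, Iso.inv_hom_id_assoc]
  simp

theorem strongTransMap_comp [Strict D] {F G K : B ⥤ᵖ C} (η : F ⟶ G) (θ : G ⟶ K)
    (H : StrictPseudofunctor C D) :
    strongTransMap (η ≫ θ) H.toPseudofunctor =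
      strongTransMap η H.toPseudofunctor ≫ strongTransMap θ H.toPseudofunctor := by
  refine strongTrans_eq_of_modification (⟨{
    app := fun a => (H.mapComp (η.app a) (θ.app a)).hom
    naturality := fun {a b} f => ?_ }⟩ : strongTransMap (η ≫ θ) H.toPseudofunctor ⟶
      strongTransMap η H.toPseudofunctor ≫ strongTransMap θ H.toPseudofunctor)
    (fun a => H.map_comp (η.app a) (θ.app a)) (fun a => by
      change (H.mapComp (η.app a) (θ.app a)).hom = _
      rw [H.mapComp_eq_eqToIso]; rfl)
  change H.map (F.map f) ◁ (H.mapComp (η.app b) (θ.app b)).hom ≫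
      (α_ _ _ _).inv ≫
        ((H.mapComp _ _).inv ≫ H.map₂ (η.naturality f).hom ≫ (H.mapComp _ _).hom) ▷ _ ≫
          (α_ _ _ _).hom ≫ _ ◁ ((H.mapComp _ _).inv ≫ H.map₂ (θ.naturality f).hom ≫
            (H.mapComp _ _).hom) ≫ (α_ _ _ _).inv =
    ((H.mapComp _ _).inv ≫ H.map₂ ((α_ _ _ _).inv ≫ (η.naturality f).hom ▷ _ ≫
          (α_ _ _ _).hom ≫ _ ◁ (θ.naturality f).hom ≫ (α_ _ _ _).inv) ≫
      (H.mapComp _ _).hom) ≫ (H.mapComp (η.app a) (θ.app a)).hom ▷ H.map (K.map f)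
  simp only [PrelaxFunctor.map₂_comp, Pseudofunctor.map₂_whisker_left,
    Pseudofunctor.map₂_whisker_right, Category.assoc, Iso.inv_hom_id_assoc, Iso.inv_hom_id,
    Category.comp_id, Pseudofunctor.map₂_associator, map₂_associator_inv_eq, comp_whiskerRight,
    Bicategory.whiskerLeft_comp]
  simp

namespace Ps

/-- The inclusion of the full sub-2-category of 2-functors. -/
abbrev inclusion (B : Type u₁) [Bicategory.{w₁, v₁} B] (C : Type u₂) [Bicategory.{w₂, v₂} C] :
    StrictPseudofunctor (Ps B C) (B ⥤ᵖ C) :=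
  InducedBicategory.forget

theorem eq_conj {F G : Ps B C} {η η' θ θ' : F ⟶ G} (p : η = η') (q : θ' = θ) (m : η ⟶ θ)
    (n : η' ⟶ θ') (h : ∀ a, m.hom.as.app a =
      eqToHom (by rw [p]) ≫ n.hom.as.app a ≫ eqToHom (by rw [q])) :
    m = eqToHom p ≫ n ≫ eqToHom q := by
  subst p q
  rw [eqToHom_refl, eqToHom_refl, Category.id_comp, Category.comp_id]
  ext a
  exact (h a).trans (by simp)

/-- The 2-functor `Ps(B, H) : Ps(B, C) ⥤ Ps(B, D)` of composition with a 2-functor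
`H : C ⥤ D`. -/
def postcomp (B : Type u₁) [Bicategory.{w₁, v₁} B] [Strict C] [Strict D]
    (H : StrictPseudofunctor C D) : StrictPseudofunctor (Ps B C) (Ps B D) :=
  .mk''
  { obj := fun F => (StrictPseudofunctor.comp F H : StrictPseudofunctor B D)
    map := fun η => InducedBicategory.mkHom (strongTransMap η.hom H.toPseudofunctor)
    map₂ := fun m => ⟨modificationMap m.hom H.toPseudofunctor⟩
    map₂_id := fun η => by
      ext a
      exact H.map₂_id _
    map₂_comp := fun m n => by
      ext a
      exact H.map₂_comp _ _
    map_id := fun F => InducedBicategory.hom_ext (strongTransMap_id _ H)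
    map_comp := fun η θ => InducedBicategory.hom_ext (strongTransMap_comp η.hom θ.hom H)
    map₂_whisker_left := fun η θ θ' m => eq_conj _ _ _ _ fun a => by
      refine (H.map₂_whisker_left (η.hom.app a) (m.hom.as.app a)).trans ?_
      rw [H.mapComp_eq_eqToIso, H.mapComp_eq_eqToIso]; rfl
    map₂_whisker_right := fun m η => eq_conj _ _ _ _ fun a => by
      refine (H.map₂_whisker_right (m.hom.as.app a) (η.hom.app a)).trans ?_
      rw [H.mapComp_eq_eqToIso, H.mapComp_eq_eqToIso]; rfl }

end Ps
theorem IsIdentity.prod {x y : B × C} {f g : x ⟶ y} {η : f ⟶ g} (h₁ : IsIdentity η.1) (h₂ : IsIdentity η.2) :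
    IsIdentity η := by
  obtain ⟨f₁, f₂⟩ := f
  obtain ⟨g₁, g₂⟩ := g
  obtain ⟨η₁, η₂⟩ := η
  obtain ⟨p, h₁⟩ := h₁
  obtain ⟨q, h₂⟩ := h₂
  dsimp only at p q h₁ h₂
  subst p q
  subst h₁ h₂
  exact ⟨rfl, rfl⟩

theorem eqToHom_prod {x y : B × C} {f g : x ⟶ y} (h : f = g) :
    eqToHom h = (eqToHom (congrArg Prod.fst h), eqToHom (congrArg Prod.snd h)) := by
  subst h; rfl

theorem IsIdentity.strongTrans_id [Strict C] (F : B ⥤ᵖ C) {x y : B} (f : x ⟶ y) :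
    IsIdentity ((𝟙 F : F ⟶ F).naturality f).hom :=
  .comp (.rightUnitor (F.map f)) (.inv (.leftUnitor (F.map f)))

theorem IsIdentity.strongTrans_comp [Strict C] {F G H : B ⥤ᵖ C} {η : F ⟶ G} {θ : G ⟶ H} {x y : B}
    {f : x ⟶ y} (h : IsIdentity (η.naturality f).hom) (h' : IsIdentity (θ.naturality f).hom) :
    IsIdentity ((η ≫ θ).naturality f).hom :=
  .comp (.inv (.associator _ _ _)) <| .comp (.whiskerRight h _) <| .comp (.associator _ _ _) <|
    .comp (.whiskerLeft _ h') (.inv (.associator _ _ _))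

end Gray

section Pairing

variable {A : Type u₁} [Bicategory.{w₁, v₁} A] [Strict A] (B : Type u₂) [Bicategory.{w₂, v₂} B]
  [Strict B]

/-- The 2-functor `b ↦ (a, b)` from `B` to `A × B`. -/
def pairingObj (a : A) : StrictPseudofunctor B (A × B) where
  toStrictlyUnitaryPseudofunctor := Bicategory.Prod.sectR a B
  map_comp _ _ := Prod.ext (Strict.id_comp (𝟙 a)).symm rfl
  mapComp_eq_eqToIso {x y z} f g := by
    have h : IsIdentity ((Bicategory.Prod.sectR a B).mapComp f g).hom :=
      IsIdentity.prod (IsIdentity.inv (IsIdentity.rightUnitor (𝟙 a)) : IsIdentity (ρ_ (𝟙 a)).inv)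
        (IsIdentity.id (f ≫ g) : IsIdentity (𝟙 (f ≫ g)))
    ext1
    exact h.choose_spec

/-- The 2-natural transformation from `b ↦ (a, b)` to `b ↦ (a', b)` with components `(f, 𝟙 b)`;
its naturality 2-cells are identities, being built from unit isomorphisms of the
2-categories `A` and `B`. -/
def pairingMap {a a' : A} (f : a ⟶ a') :
    (pairingObj B a).toPseudofunctor ⟶ (pairingObj B a').toPseudofunctor where
  app b := (f, 𝟙 b)
  naturality g := Iso.prod (λ_ f ≪≫ (ρ_ f).symm) (ρ_ g ≪≫ (λ_ g).symm)
  naturality_naturality {b b' g g'} β := Prod.ext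
    (by simp : 𝟙 (𝟙 a) ▷ f ≫ (λ_ f).hom ≫ (ρ_ f).inv = ((λ_ f).hom ≫ (ρ_ f).inv) ≫ f ◁ 𝟙 (𝟙 a'))
    (by simp : β ▷ 𝟙 b' ≫ (ρ_ g').hom ≫ (λ_ g').inv = ((ρ_ g).hom ≫ (λ_ g).inv) ≫ 𝟙 b ◁ β)
  naturality_id b := Prod.ext
    (by simp : ((λ_ f).hom ≫ (ρ_ f).inv) ≫ f ◁ 𝟙 (𝟙 a') =
      𝟙 (𝟙 a) ▷ f ≫ (λ_ f).hom ≫ (ρ_ f).inv)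
    (by simp [unitors_equal] : ((ρ_ (𝟙 b)).hom ≫ (λ_ (𝟙 b)).inv) ≫ 𝟙 b ◁ 𝟙 (𝟙 b) =
      𝟙 (𝟙 b) ▷ 𝟙 b ≫ (λ_ (𝟙 b)).hom ≫ (ρ_ (𝟙 b)).inv)
  naturality_comp {b c d} g h := Prod.ext
    (by bicategory : ((λ_ f).hom ≫ (ρ_ f).inv) ≫ f ◁ (ρ_ (𝟙 a')).inv =
      (ρ_ (𝟙 a)).inv ▷ f ≫ (α_ _ _ _).hom ≫ 𝟙 a ◁ ((λ_ f).hom ≫ (ρ_ f).inv) ≫ (α_ _ _ _).inv ≫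
        ((λ_ f).hom ≫ (ρ_ f).inv) ▷ 𝟙 a' ≫ (α_ _ _ _).hom)
    (by bicategory : ((ρ_ (g ≫ h)).hom ≫ (λ_ (g ≫ h)).inv) ≫ 𝟙 b ◁ 𝟙 (g ≫ h) =
      𝟙 (g ≫ h) ▷ 𝟙 d ≫ (α_ _ _ _).hom ≫ g ◁ ((ρ_ h).hom ≫ (λ_ h).inv) ≫ (α_ _ _ _).inv ≫
        ((ρ_ g).hom ≫ (λ_ g).inv) ▷ h ≫ (α_ _ _ _).hom)

theorem IsIdentity.pairingMap {a a' : A} (f : a ⟶ a') {b b' : B} (g : b ⟶ b') :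
    IsIdentity ((pairingMap B f).naturality g).hom :=
  IsIdentity.prod
    (.comp (.leftUnitor f) (.inv (.rightUnitor f)) : IsIdentity ((λ_ f).hom ≫ (ρ_ f).inv))
    (.comp (.rightUnitor g) (.inv (.leftUnitor g)) : IsIdentity ((ρ_ g).hom ≫ (λ_ g).inv))

theorem pairingMap_id (a : A) : pairingMap B (𝟙 a) = 𝟙 (pairingObj B a).toPseudofunctor :=
  strongTrans_ext (fun _ => rfl) fun g =>
    IsIdentity.eq (.comp (.whiskerLeft _ (.hom _)) (.strongTrans_id _ g))
      (.comp (.pairingMap B _ g) (.whiskerRight (.hom _) _))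

theorem pairingMap_comp {a a' a'' : A} (f : a ⟶ a') (f' : a' ⟶ a'') :
    pairingMap B (f ≫ f') = pairingMap B f ≫ pairingMap B f' :=
  strongTrans_ext (fun b => Prod.ext rfl (Strict.id_comp (𝟙 b)).symm) fun g =>
    IsIdentity.eq (.comp (.whiskerLeft _ (.hom _))
        (.strongTrans_comp (.pairingMap B f g) (.pairingMap B f' g)))
      (.comp (.pairingMap B _ g) (.whiskerRight (.hom _) _))

/-- The 2-functor from `A` to `Ps(B, A × B)` corresponding to the identity of `A × B`. -/
def pairing (A : Type u₁) [Bicategory.{w₁, v₁} A] [Strict A] (B : Type u₂)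
    [Bicategory.{w₂, v₂} B] [Strict B] : StrictPseudofunctor A (Ps B (A × B)) :=
  .mk''
  { obj := fun a => pairingObj B a
    map := fun f => InducedBicategory.mkHom (pairingMap B f)
    map₂ := fun {a a' f f'} α => ⟨⟨
      { app := fun b => (α, 𝟙 (𝟙 b))
        naturality := fun {b b'} g => Prod.ext
          (by simp : 𝟙 a ◁ α ≫ (λ_ f').hom ≫ (ρ_ f').inv =
            ((λ_ f).hom ≫ (ρ_ f).inv) ≫ α ▷ 𝟙 a')
          (by simp : g ◁ 𝟙 (𝟙 b') ≫ (ρ_ g).hom ≫ (λ_ g).inv =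
            ((ρ_ g).hom ≫ (λ_ g).inv) ≫ 𝟙 (𝟙 b) ▷ g) }⟩⟩
    map₂_id := fun _ => rfl
    map₂_comp := fun α α' => by
      ext b
      exact Prod.ext rfl (Category.id_comp (𝟙 (𝟙 b))).symm
    map_id := fun a => InducedBicategory.hom_ext (pairingMap_id B a)
    map_comp := fun f f' => InducedBicategory.hom_ext (pairingMap_comp B f f')
    map₂_whisker_left := fun f _ _ α => Ps.eq_conj _ _ _ _ fun b => by
      rw [eqToHom_prod, eqToHom_prod]
      exact Prod.ext (by simp : f ◁ α = 𝟙 _ ≫ f ◁ α ≫ 𝟙 _)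
        (by simp : 𝟙 (𝟙 b) = eqToHom (Strict.id_comp (𝟙 b)).symm ≫ 𝟙 b ◁ 𝟙 (𝟙 b) ≫
          eqToHom (Strict.id_comp (𝟙 b)))
    map₂_whisker_right := fun α f => Ps.eq_conj _ _ _ _ fun b => by
      rw [eqToHom_prod, eqToHom_prod]
      exact Prod.ext (by simp : α ▷ f = 𝟙 _ ≫ α ▷ f ≫ 𝟙 _)
        (by simp : 𝟙 (𝟙 b) = eqToHom (Strict.id_comp (𝟙 b)).symm ≫ 𝟙 (𝟙 b) ▷ 𝟙 b ≫
          eqToHom (Strict.id_comp (𝟙 b))) }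

end Pairing

section Cubical

variable {A : Type u₁} [Bicategory.{w₁, v₁} A] {B : Type u₂} [Bicategory.{w₂, v₂} B]
  {C : Type u₃} [Bicategory.{w₃, v₃} C]

/-- A cubical functor `A × B ⇝ C`: a normal (strictly identity-preserving) pseudofunctor whose
comparison 2-cell `F (f ≫ g) ≅ F f ≫ F g` is an identity as soon as the component of `f` in `A`
or the component of `g` in `B` is an identity. -/
structure CubicalFunctor (A : Type u₁) [Bicategory.{w₁, v₁} A] (B : Type u₂)
    [Bicategory.{w₂, v₂} B] (C : Type u₃) [Bicategory.{w₃, v₃} C] extends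
    StrictlyUnitaryPseudofunctor (A × B) C where
  mapComp_of_fst {a : A} {b b' : B} {z : A × B} (f₂ : b ⟶ b') (g : (a, b') ⟶ z) :
    IsIdentity (mapComp ((𝟙 a, f₂) : (a, b) ⟶ (a, b')) g).hom
  mapComp_of_snd {x : A × B} {a a' : A} {b : B} (f : x ⟶ (a, b)) (g₁ : a ⟶ a') :
    IsIdentity (mapComp f ((g₁, 𝟙 b) : (a, b) ⟶ (a', b))).hom

theorem IsIdentity.evComp [Strict C] {x y z p q : C} {f₁₂ : x ⟶ z} {f₁ : x ⟶ y} {f₂ : y ⟶ z}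
    {φ : f₁₂ ≅ f₁ ≫ f₂} {s : z ⟶ q} {r : y ⟶ p} {g₂ : p ⟶ q} {n : f₂ ≫ s ≅ r ≫ g₂} {w : C}
    (t : q ⟶ w) (hφ : IsIdentity φ.hom) (hn : IsIdentity n.hom) : IsIdentity (evComp φ n t).hom :=
  .comp (.whiskerRight hφ _) <| .comp (.associator _ _ _) <| .comp (.whiskerLeft _ <|
    .comp (.inv (.associator _ _ _)) <| .comp (.whiskerRight hn t) (.associator _ _ _))
      (.inv (.associator _ _ _))

theorem IsIdentity.naturality_of_eq [Strict C] {F : B ⥤ᵖ C} {η : F ⟶ F} (h : η = 𝟙 F) {b b' : B}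
    (f : b ⟶ b') : IsIdentity (η.naturality f).hom := by
  subst h; exact .strongTrans_id F f

theorem IsIdentity.naturality_id [Strict C] {F G : StrictPseudofunctor B C}
    (η : F.toPseudofunctor ⟶ G.toPseudofunctor) (b : B) : IsIdentity (η.naturality (𝟙 b)).hom := by
  have h : (η.naturality (𝟙 b)).hom = ((F.mapId b).hom ▷ η.app b ≫ (λ_ (η.app b)).hom ≫
      (ρ_ (η.app b)).inv) ≫ η.app b ◁ (G.mapId b).inv := by
    rw [← η.naturality_id b, Category.assoc, whiskerLeft_hom_inv, Category.comp_id]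
  rw [h]
  exact .comp (.comp (.whiskerRight (.mapId F b) _) <| .comp (.leftUnitor _)
    (.inv (.rightUnitor _))) (.whiskerLeft _ (.inv (.mapId G b)))

/-- The pseudofunctor `A × B ⇝ C` corresponding to a 2-functor `K : A ⥤ Ps(B, C)`: the composite
of `K × B` with the evaluation pseudofunctor. -/
def uncurryPseudofunctor [Strict C] (K : StrictPseudofunctor A (Ps B C)) : (A × B) ⥤ᵖ C :=
  (prodId (K.toPseudofunctor.comp (Ps.inclusion B C).toPseudofunctor) B).comp evaluation

theorem IsIdentity.uncurry_mapId [Strict C] (K : StrictPseudofunctor A (Ps B C)) (x : A × B) :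
    IsIdentity ((uncurryPseudofunctor K).mapId x).hom :=
  .comp (.map₂ evaluation <| .prod
      (.comp (.map₂ (Ps.inclusion B C).toPseudofunctor (.mapId K x.1))
        (.mapId (Ps.inclusion B C) (K.obj x.1)))
      (.id (𝟙 x.2)))
    (.comp (.rightUnitor _) (.mapId (K.obj x.1 : StrictPseudofunctor B C) x.2))

theorem IsIdentity.uncurry_mapComp [Strict C] (K : StrictPseudofunctor A (Ps B C)) {x y z : A × B}
    (f : x ⟶ y) (g : y ⟶ z) (h : IsIdentity ((K.map f.1).hom.naturality g.2).hom) :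
    IsIdentity ((uncurryPseudofunctor K).mapComp f g).hom :=
  .comp (.map₂ evaluation <| .prod
      (.comp (.map₂ (Ps.inclusion B C).toPseudofunctor (.mapComp K f.1 g.1))
        (.mapComp (Ps.inclusion B C) (K.map f.1) (K.map g.1)))
      (.id (f.2 ≫ g.2)))
    (.evComp _ (.mapComp (K.obj x.1 : StrictPseudofunctor B C) f.2 g.2) h)

/-- The cubical functor `A × B ⇝ C` corresponding to a 2-functor `K : A ⥤ Ps(B, C)`. -/
def uncurry [Strict C] (K : StrictPseudofunctor A (Ps B C)) : CubicalFunctor A B C where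
  toPseudofunctor := uncurryPseudofunctor K
  map_id x := (IsIdentity.uncurry_mapId K x).choose
  mapId_eq_eqToIso x := Iso.ext (IsIdentity.uncurry_mapId K x).choose_spec
  mapComp_of_fst {a _ _ _} _ g := .uncurry_mapComp K _ _
    (.naturality_of_eq (congrArg InducedBicategory.Hom.hom (K.map_id a)) g.2)
  mapComp_of_snd {_ _ _ b} f _ := .uncurry_mapComp K _ _ (.naturality_id (K.map f.1).hom b)

end Cubical

namespace TwoCat

/-- The product of 2-categories. -/
abbrev prod (A B : TwoCat.{u}) : TwoCat.{u} := ⟨A × B⟩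

end TwoCat

/-- A Gray tensor product of the 2-categories `A` and `B`: a 2-category `tensor` representing the
functor `2-Cat(A, Ps(B, -))`, i.e. equipped with bijections, natural in the 2-category `C`,
between 2-functors `tensor ⥤ C` and 2-functors `A ⥤ Ps(B, C)`. -/
structure GrayTensor (A B : TwoCat.{u}) where
  tensor : TwoCat.{u}
  homEquiv (C : TwoCat.{u}) : StrictPseudofunctor tensor C ≃ StrictPseudofunctor A (Ps B C)
  homEquiv_comp {C D : TwoCat.{u}} (F : StrictPseudofunctor tensor C)
    (H : StrictPseudofunctor C D) :
    homEquiv D (F.comp H) = (homEquiv C F).comp (Ps.postcomp B H)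

namespace GrayTensor

variable {A B : TwoCat.{u}} (T : GrayTensor A B)

/-- The comparison 2-functor `Q : A ⊗ B ⥤ A × B`. -/
def comparison : StrictPseudofunctor T.tensor (A.prod B) :=
  (T.homEquiv (A.prod B)).symm (pairing A B)

/-- The universal cubical functor `R : A × B ⇝ A ⊗ B`: it corresponds to the identity of `A ⊗ B`
under the bijections of the 2-functors `A ⊗ B ⥤ C` with the 2-functors `A ⥤ Ps(B, C)` and
of those with the cubical functors `A × B ⇝ C`. -/
def universalCubical : CubicalFunctor A B T.tensor :=
  uncurry (T.homEquiv T.tensor (StrictPseudofunctor.id T.tensor))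

/-- The comparison `Q`, as a 1-cell of the 2-category of 2-categories, pseudofunctors
and icons. -/
def Q : T.tensor ⟶ A.prod B := T.comparison.toPseudofunctor

/-- The universal cubical functor `R`, as a 1-cell of the 2-category of 2-categories,
pseudofunctors and icons. -/
def R : A.prod B ⟶ T.tensor := T.universalCubical.toPseudofunctor

end GrayTensor

/-- A pseudofunctor is locally full and faithful if all its functors between hom-categories
are full and faithful. -/
def LocallyFullyFaithful {C : Type u₁} [Bicategory.{w₁, v₁} C] {D : Type u₂}
    [Bicategory.{w₂, v₂} D] (F : C ⥤ᵖ D) : Prop :=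
  ∀ x y : C, (F.mapFunctor x y).Full ∧ (F.mapFunctor x y).Faithful
end GrayTensorProduct

-- The main construction: given a category `D` with an identity-on-objects functor to the underlying
-- category of a 2-category `X`, form a 2-category `D.Total` whose 1-cells are the morphisms of `D`
-- and whose 2-cells are those of `X` between the projections. Its projection to `X` is locally full
-- and faithful by construction, and any equation between parallel 2-cells can be checked in `X`. A
-- section of `D` over `A × B`, that is, functorial lifts of the 1-cells `(f, 𝟙 b)` and `(𝟙 a, g)`,
-- yields a 2-functor from `A` to `Ps(B, D.Total)` (`liftPairing`). Its interchange 2-cells lie over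
-- identities of `A × B` but need not be identities upstairs.
--
-- Two instances matter. The first, `words A B`, is the free category over `A × B` with a section.
-- The second, `isoOver G`, belongs to a pseudofunctor `G` from `X` to `C`: its morphisms are
-- 1-cells `p` of `X` with a 1-cell of `C` and an isomorphism from the latter to `G p`. Its total
-- 2-category has a strict 2-functor `toTarget` to `C` and an invertible icon from `toTarget` to the
-- projection followed by `G`. Thus it replaces the pseudofunctor `G` by a 2-functor.
--
-- Existence: `words A B` gives a Gray tensor product. A 2-functor `K` from `A` to `Ps(B, C)`
-- determines a cubical functor `G`, and cubicality is exactly what makes the values of `K` a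
-- section of `isoOver G` with identity isomorphisms. Freeness followed by `toTarget` then gives a
-- factorization of `K` (`liftPairing_comp_toTarget`, `words.exists_factorization`). It is unique
-- because 1-cells are words in the generators, and every 2-cell is a composite of whiskered 2-cells
-- of `A` and `B` with isomorphisms to normal forms, which are themselves composites of whiskered
-- interchanges (`words.cell_eq_normal`, `words.agreeOn_normalIso`).
--
-- Equivalence, for an arbitrary Gray tensor product: the universal property, applied to the section
-- of `isoOver R` given by the unit, produces a 2-functor `toIsoOver`. Followed by `toTarget` it is
-- the identity, and followed by the projection it is `Q`; whiskering the icon of `isoOver R` with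
-- it compares the identity with `Q` followed by `R`. In the other order, `R` followed by `Q` is, up
-- to an icon, the cubical functor of `pairing A B`, whose value at `(f, g)` is `(𝟙 ≫ f, g ≫ 𝟙)`.
-- Since both composites are bijective on 2-cells, `Q` is locally full and faithful.

universe t w₄ v₄ u₄

namespace GrayTensorProduct

open scoped Pseudofunctor.StrongTrans

/-! ### Categories over a 2-category and their total 2-categories -/

section CategoryOver

/-- A category with the objects of a 2-category `X`, together with an identity-on-objects
functor to the underlying category of `X`. -/
structure CategoryOver (X : Type u) [Bicategory.{w, v} X] where
  Hom : X → X → Type t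
  id (x : X) : Hom x x
  comp {x y z : X} : Hom x y → Hom y z → Hom x z
  id_comp {x y : X} (f : Hom x y) : comp (id x) f = f
  comp_id {x y : X} (f : Hom x y) : comp f (id y) = f
  assoc {x y z w : X} (f : Hom x y) (g : Hom y z) (h : Hom z w) :
    comp (comp f g) h = comp f (comp g h)
  proj {x y : X} : Hom x y → (x ⟶ y)
  proj_id (x : X) : proj (id x) = 𝟙 x
  proj_comp {x y z : X} (f : Hom x y) (g : Hom y z) : proj (comp f g) = proj f ≫ proj g

namespace CategoryOver

variable {X : Type u} [Bicategory.{w, v} X] (D : CategoryOver X)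

/-- The 2-category obtained from a category `D` over the underlying category of `X` by taking as
2-cells those of `X` between the projections. -/
@[nolint unusedArguments]
def Total (_D : CategoryOver X) : Type u := X

/-- A 1-cell of the total 2-category. -/
structure THom (x y : X) where
  base : x ⟶ y
  lift : D.Hom x y
  w : D.proj lift = base

variable {D}

/-- The field `base` is redundant, being determined by `lift`. It is stored so that the projections
of identities and composites are by definition identities and composites in `X`, which lets 2-cells
be composed without transport. -/
theorem THom.ext {x y : X} {f g : D.THom x y} (h : f.lift = g.lift) : f = g := by
  obtain ⟨_, f, rfl⟩ := f
  obtain ⟨_, g, rfl⟩ := g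
  obtain rfl : f = g := h
  rfl

instance : CategoryStruct D.Total where
  Hom x y := D.THom x y
  id x := ⟨𝟙 (show X from x), D.id x, D.proj_id x⟩
  comp f g := ⟨f.base ≫ g.base, D.comp f.lift g.lift,
    (D.proj_comp f.lift g.lift).trans (by rw [f.w, g.w])⟩

/-- The object of `X` underlying an object of the total 2-category. -/
abbrev Total.ob (x : D.Total) : X := x

/-- The object of the total 2-category given by an object of `X`. -/
def Total.of (D : CategoryOver X) (x : X) : D.Total := x

/-- The 1-cell of `X` underlying a 1-cell of the total 2-category. -/
abbrev Total.base {x y : D.Total} (f : x ⟶ y) : x.ob ⟶ y.ob := THom.base f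

/-- The morphism of `D` underlying a 1-cell of the total 2-category. -/
abbrev Total.lift {x y : D.Total} (f : x ⟶ y) : D.Hom x.ob y.ob := THom.lift f

open Total

instance (x y : D.Total) : Category (x ⟶ y) where
  Hom f g := base f ⟶ base g
  id f := 𝟙 (base f)
  comp η θ := CategoryStruct.comp (obj := x.ob ⟶ y.ob) η θ
  id_comp η := Category.id_comp (obj := x.ob ⟶ y.ob) η
  comp_id η := Category.comp_id (obj := x.ob ⟶ y.ob) η
  assoc η θ κ := Category.assoc (obj := x.ob ⟶ y.ob) η θ κ

/-- The 2-cell of `X` underlying a 2-cell of the total 2-category. -/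
abbrev Total.cell {x y : D.Total} {f g : x ⟶ y} (η : f ⟶ g) : base f ⟶ base g := η

/-- The 2-cell of the total 2-category given by a 2-cell of `X`. -/
abbrev Total.mkCell {x y : D.Total} {f g : x ⟶ y} (η : base f ⟶ base g) : f ⟶ g := η

/-- Isomorphisms in the total 2-category are isomorphisms of the underlying 1-cells. -/
abbrev isoMk {x y : D.Total} {f g : x ⟶ y} (e : base f ≅ base g) : f ≅ g where
  hom := e.hom
  inv := e.inv
  hom_inv_id := e.hom_inv_id
  inv_hom_id := e.inv_hom_id

/-- The axioms concern 2-cells only, and these live in `X`; hence each axiom is the corresponding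
one of `X`. -/
instance : Bicategory D.Total where
  whiskerLeft {x y z} f _ _ η :=
    Bicategory.whiskerLeft (a := x.ob) (b := y.ob) (c := z.ob) (base f) η
  whiskerRight {x y z _ _} η h :=
    Bicategory.whiskerRight (a := x.ob) (b := y.ob) (c := z.ob) η (base h)
  associator f g h := isoMk (α_ (base f) (base g) (base h))
  leftUnitor f := isoMk (λ_ (base f))
  rightUnitor f := isoMk (ρ_ (base f))
  whiskerLeft_id f g := Bicategory.whiskerLeft_id (base f) (base g)
  whiskerLeft_comp f _ _ _ η θ := Bicategory.whiskerLeft_comp (B := X) (base f) η θ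
  id_whiskerLeft η := Bicategory.id_whiskerLeft (B := X) η
  comp_whiskerLeft f g _ _ η := Bicategory.comp_whiskerLeft (B := X) (base f) (base g) η
  id_whiskerRight f g := Bicategory.id_whiskerRight (base f) (base g)
  comp_whiskerRight η θ h := Bicategory.comp_whiskerRight (B := X) η θ (base h)
  whiskerRight_id η := Bicategory.whiskerRight_id (B := X) η
  whiskerRight_comp η g h := Bicategory.whiskerRight_comp (B := X) η (base g) (base h)
  whisker_assoc f _ _ η h := Bicategory.whisker_assoc (B := X) (base f) η (base h)
  whisker_exchange η θ := Bicategory.whisker_exchange (B := X) η θ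
  pentagon f g h k := Bicategory.pentagon (base f) (base g) (base h) (base k)
  triangle f g := Bicategory.triangle (base f) (base g)

theorem eqToIso_total {x y : D.Total} {f g : x ⟶ y} (h : f = g) :
    (eqToIso h : f ≅ g) = isoMk (eqToIso (congrArg base h)) := by
  subst h; rfl

/-- An equality of 1-cells upstairs gives an identity 2-cell of `X` downstairs. This reduces the
whiskering axioms of strict 2-functors into `D.Total` to equations in `X`. -/
theorem conj_eqToHom_total {x y : D.Total} {f f' g g' : x ⟶ y} (p : f = f') (θ : f' ⟶ g')
    (q : g' = g) : (eqToHom p ≫ θ ≫ eqToHom q : f ⟶ g) =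
      (eqToHom (congrArg base p) ≫ cell θ ≫ eqToHom (congrArg base q) : base f ⟶ base g) := by
  subst p q; rfl

/-- The equalities of 1-cells come from the category axioms of `D`, and the description of the
structural 2-cells comes from strictness of `X`. -/
instance [Strict X] : Strict D.Total where
  id_comp f := THom.ext (D.id_comp (Total.lift f))
  comp_id f := THom.ext (D.comp_id (Total.lift f))
  assoc f g h := THom.ext (D.assoc (Total.lift f) (Total.lift g) (Total.lift h))
  leftUnitor_eqToIso f := Iso.ext <| by
    rw [eqToIso_total]
    exact congrArg (Iso.hom (C := Quiver.Hom (V := X) _ _)) (Strict.leftUnitor_eqToIso (base f))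
  rightUnitor_eqToIso f := Iso.ext <| by
    rw [eqToIso_total]
    exact congrArg (Iso.hom (C := Quiver.Hom (V := X) _ _)) (Strict.rightUnitor_eqToIso (base f))
  associator_eqToIso f g h := Iso.ext <| by
    rw [eqToIso_total]
    exact congrArg (Iso.hom (C := Quiver.Hom (V := X) _ _)) (Strict.associator_eqToIso (base f) (base g) (base h))

/-- The lift to the total 2-category of a 2-functor to `X` along lifts of the images
of the 1-cells. -/
def lift {Y : Type u₁} [Bicategory.{w₁, v₁} Y] [Strict Y] [Strict X] (H : StrictPseudofunctor Y X)
    (s : ∀ {x y : Y}, (x ⟶ y) → D.Hom (H.obj x) (H.obj y))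
    (hs : ∀ {x y : Y} (f : x ⟶ y), D.proj (s f) = H.map f)
    (s_id : ∀ x : Y, s (𝟙 x) = D.id (H.obj x))
    (s_comp : ∀ {x y z : Y} (f : x ⟶ y) (g : y ⟶ z), s (f ≫ g) = D.comp (s f) (s g)) :
    StrictPseudofunctor Y D.Total :=
  .mk''
  { obj := fun x => (H.obj x : X)
    map := fun f => (⟨H.map f, s f, hs f⟩ : D.THom _ _)
    map₂ := fun η => H.map₂ η
    map₂_id := fun f => H.map₂_id f
    map₂_comp := fun η θ => H.map₂_comp η θ
    map_id := fun x => THom.ext (s_id x)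
    map_comp := fun f g => THom.ext (s_comp f g)
    map₂_whisker_left := fun f _ _ η => by
      refine Eq.trans ?_ (conj_eqToHom_total _ _ _).symm
      refine (H.map₂_whisker_left f η).trans ?_
      rw [H.mapComp_eq_eqToIso, H.mapComp_eq_eqToIso]; rfl
    map₂_whisker_right := fun η f => by
      refine Eq.trans ?_ (conj_eqToHom_total _ _ _).symm
      refine (H.map₂_whisker_right η f).trans ?_
      rw [H.mapComp_eq_eqToIso, H.mapComp_eq_eqToIso]; rfl }

/-- The projection from the total 2-category. -/
def projection (D : CategoryOver X) : StrictPseudofunctor D.Total X :=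
  .mk'
  { obj := fun x => x
    map := fun f => (base f)
    map₂ := fun η => η
    map₂_id := fun _ => rfl
    map₂_comp := fun _ _ => rfl
    map_id := fun _ => rfl
    map_comp := fun _ _ => rfl
    -- The comparison 2-cells of the projection are identities by definition, so each axiom is, up
    -- to unfolding, a unit law in a hom-category of `X`.
    map₂_whisker_left := fun {a b c} f _ _ η =>
      (by simp : ∀ {x y : X} {f g : x ⟶ y} (η : f ⟶ g), η = 𝟙 _ ≫ η ≫ 𝟙 _) _
    map₂_whisker_right := fun η f =>
      (by simp : ∀ {x y : X} {f g : x ⟶ y} (η : f ⟶ g), η = 𝟙 _ ≫ η ≫ 𝟙 _) _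
    map₂_left_unitor := fun f =>
      (by simp : ∀ {x y : X} {f g : x ⟶ y} (η : f ⟶ g), η = 𝟙 _ ≫ η) _
    map₂_right_unitor := fun f =>
      (by simp : ∀ {x y : X} {f g : x ⟶ y} (η : f ⟶ g), η = 𝟙 _ ≫ η) _
    map₂_associator := fun f g h =>
      (by simp : ∀ {x y : X} {f g : x ⟶ y} (η : f ⟶ g), η = 𝟙 _ ≫ η ≫ 𝟙 _) _ }

/-- A morphism of categories over `X`. -/
structure Morphism (D D' : CategoryOver X) where
  map {x y : X} : D.Hom x y → D'.Hom x y
  map_id (x : X) : map (D.id x) = D'.id x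
  map_comp {x y z : X} (f : D.Hom x y) (g : D.Hom y z) :
    map (D.comp f g) = D'.comp (map f) (map g)
  proj_map {x y : X} (f : D.Hom x y) : D'.proj (map f) = D.proj f

/-- The 2-functor between total 2-categories given by a morphism over `X`. -/
def Morphism.total [Strict X] {D D' : CategoryOver X} (φ : Morphism D D') :
    StrictPseudofunctor D.Total D'.Total :=
  lift D.projection (fun f => φ.map (Total.lift f)) (fun f => (φ.proj_map (Total.lift f)).trans (THom.w f))
    φ.map_id (fun f g => φ.map_comp (Total.lift f) (Total.lift g))

end CategoryOver

end CategoryOver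

/-! ### Sections over `A × B` and the 2-functors into `Ps(B, -)` that they induce -/

section Sections

open CategoryOver CategoryOver.Total

theorem IsIdentity.cell {X : Type u} [Bicategory.{w, v} X] {D : CategoryOver X} {x y : D.Total}
    {f g : x ⟶ y} {η : f ⟶ g} (h : IsIdentity η) : IsIdentity (Total.cell η) := by
  obtain ⟨rfl, rfl⟩ := h; exact ⟨rfl, rfl⟩

variable {A : Type u₁} [Bicategory.{w₁, v₁} A] {B : Type u₂} [Bicategory.{w₂, v₂} B]

namespace CategoryOver

/-- Lifts of the 1-cells `(f, 𝟙 b)` and `(𝟙 a, g)` of `A × B` to a category over `A × B`,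
functorial in `f` and in `g`. -/
structure Section (D : CategoryOver (A × B)) where
  left {a a' : A} (f : a ⟶ a') (b : B) : D.Hom (a, b) (a', b)
  right (a : A) {b b' : B} (g : b ⟶ b') : D.Hom (a, b) (a, b')
  left_id (a : A) (b : B) : left (𝟙 a) b = D.id (a, b)
  left_comp {a a' a'' : A} (f : a ⟶ a') (f' : a' ⟶ a'') (b : B) :
    left (f ≫ f') b = D.comp (left f b) (left f' b)
  right_id (a : A) (b : B) : right a (𝟙 b) = D.id (a, b)
  right_comp (a : A) {b b' b'' : B} (g : b ⟶ b') (g' : b' ⟶ b'') :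
    right a (g ≫ g') = D.comp (right a g) (right a g')
  proj_left {a a' : A} (f : a ⟶ a') (b : B) : D.proj (left f b) = (f, 𝟙 b)
  proj_right (a : A) {b b' : B} (g : b ⟶ b') : D.proj (right a g) = (𝟙 a, g)

namespace Section

variable {D : CategoryOver (A × B)} (S : D.Section)

/-- The 1-cell of the total 2-category over `(f, 𝟙 b)`. -/
abbrev leftHom {a a' : A} (f : a ⟶ a') (b : B) :
    Total.of D (a, b) ⟶ Total.of D (a', b) :=
  (⟨(f, 𝟙 b), S.left f b, S.proj_left f b⟩ : D.THom _ _)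

/-- The 1-cell of the total 2-category over `(𝟙 a, g)`. -/
abbrev rightHom (a : A) {b b' : B} (g : b ⟶ b') :
    Total.of D (a, b) ⟶ Total.of D (a, b') :=
  (⟨(𝟙 a, g), S.right a g, S.proj_right a g⟩ : D.THom _ _)

variable [Strict A] [Strict B]

/-- The 2-functor `b ↦ (a, b)` from `B` to the total 2-category. -/
def liftObj (a : A) : StrictPseudofunctor B D.Total :=
  lift (pairingObj B a) (fun g => S.right a g) (fun g => S.proj_right a g)
    (fun b => S.right_id a b) (fun g g' => S.right_comp a g g')

/-- The pseudonatural transformation with components `(f, 𝟙 b)`. -/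
def liftMap {a a' : A} (f : a ⟶ a') :
    (S.liftObj a).toPseudofunctor ⟶ (S.liftObj a').toPseudofunctor where
  app b := S.leftHom f b
  naturality g := isoMk (Iso.prod (λ_ f ≪≫ (ρ_ f).symm) (ρ_ g ≪≫ (λ_ g).symm))
  naturality_naturality β := (pairingMap B f).naturality_naturality β
  -- Both sides are parallel 2-cells of `A × B` built from identity 2-cells, hence equal. The
  -- comparison cells upstairs are not reflexive, so they are first pushed down by
  -- `IsIdentity.cell`.
  naturality_id b := IsIdentity.eq (C := A × B)
    (.comp (.pairingMap B f (𝟙 b)) (.whiskerLeft _ (IsIdentity.mapId (S.liftObj a') b).cell))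
    (.comp (.whiskerRight (IsIdentity.mapId (S.liftObj a) b).cell _)
      (.comp (.leftUnitor _) (.inv (.rightUnitor _))))
  naturality_comp g h := IsIdentity.eq (C := A × B)
    (.comp (.pairingMap B f (g ≫ h))
      (.whiskerLeft _ (IsIdentity.mapComp (S.liftObj a') g h).cell))
    (.comp (.whiskerRight (IsIdentity.mapComp (S.liftObj a) g h).cell _) <|
      .comp (.associator _ _ _) <| .comp (.whiskerLeft _ (.pairingMap B f h)) <|
        .comp (.inv (.associator _ _ _)) <| .comp (.whiskerRight (.pairingMap B f g) _)
          (.associator _ _ _))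

/-- Only the underlying 2-cell is an identity: the two composites around the square agree in `A × B`
but may be different morphisms of `D`. -/
theorem isIdentity_liftMap {a a' : A} (f : a ⟶ a') {b b' : B} (g : b ⟶ b') :
    IsIdentity (Total.cell ((S.liftMap f).naturality g).hom) := .pairingMap B f g

theorem liftMap_id (a : A) : S.liftMap (𝟙 a) = 𝟙 (S.liftObj a).toPseudofunctor :=
  strongTrans_ext (fun b => THom.ext (S.left_id a b)) fun g =>
    IsIdentity.eq (C := A × B)
      (.comp (.whiskerLeft _ (IsIdentity.hom _).cell) (IsIdentity.strongTrans_id _ g).cell)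
      (.comp (.pairingMap B _ g) (.whiskerRight (IsIdentity.hom _).cell _))

theorem liftMap_comp {a a' a'' : A} (f : a ⟶ a') (f' : a' ⟶ a'') :
    S.liftMap (f ≫ f') = S.liftMap f ≫ S.liftMap f' :=
  strongTrans_ext (fun b => THom.ext (S.left_comp f f' b)) fun g =>
    IsIdentity.eq (C := A × B)
      (.comp (.whiskerLeft _ (IsIdentity.hom _).cell)
        (.comp (.inv (.associator _ _ _)) <| .comp (.whiskerRight (.pairingMap B f g) _) <|
          .comp (.associator _ _ _) <| .comp (.whiskerLeft _ (.pairingMap B f' g))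
            (.inv (.associator _ _ _))))
      (.comp (.pairingMap B _ g) (.whiskerRight (IsIdentity.hom _).cell _))

/-- The 2-functor from `A` to `Ps(B, D.Total)` lifting `pairing A B`. -/
def liftPairing : StrictPseudofunctor A (Ps B D.Total) :=
  .mk''
  { obj := fun a => S.liftObj a
    map := fun f => InducedBicategory.mkHom (S.liftMap f)
    map₂ := fun {a a' f f'} α => ⟨⟨
      { app := fun b => Total.mkCell (f := S.leftHom f b) (g := S.leftHom f' b) (α, 𝟙 (𝟙 b))
        -- The modification axiom is an equation of 2-cells, so it is the one already known in `A ×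
        -- B`.
        naturality := fun g => ((pairing A B).map₂ α).hom.as.naturality g }⟩⟩
    map₂_id := fun _ => rfl
    map₂_comp := fun α α' => by
      ext b
      exact Prod.ext rfl (Category.id_comp (𝟙 (𝟙 b))).symm
    map_id := fun a => InducedBicategory.hom_ext (S.liftMap_id a)
    map_comp := fun f f' => InducedBicategory.hom_ext (S.liftMap_comp f f')
    map₂_whisker_left := fun f g g' α => Ps.eq_conj _ _ _ _ fun b => by
      refine Eq.trans ?_ (conj_eqToHom_total _ (S.leftHom f b ◁ Total.mkCell (f := S.leftHom g b)
        (g := S.leftHom g' b) (α, 𝟙 (𝟙 b))) _).symm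
      rw [eqToHom_prod, eqToHom_prod]
      exact Prod.ext (by simp : f ◁ α = 𝟙 _ ≫ f ◁ α ≫ 𝟙 _)
        (by simp : 𝟙 (𝟙 b) = eqToHom (Strict.id_comp (𝟙 b)).symm ≫ 𝟙 b ◁ 𝟙 (𝟙 b) ≫
          eqToHom (Strict.id_comp (𝟙 b)))
    map₂_whisker_right := fun {_ _ _ g g'} α f => Ps.eq_conj _ _ _ _ fun b => by
      refine Eq.trans ?_ (conj_eqToHom_total _ (Total.mkCell (f := S.leftHom g b)
        (g := S.leftHom g' b) (α, 𝟙 (𝟙 b)) ▷ S.leftHom f b) _).symm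
      rw [eqToHom_prod, eqToHom_prod]
      exact Prod.ext (by simp : α ▷ f = 𝟙 _ ≫ α ▷ f ≫ 𝟙 _)
        (by simp : 𝟙 (𝟙 b) = eqToHom (Strict.id_comp (𝟙 b)).symm ≫ 𝟙 (𝟙 b) ▷ 𝟙 b ≫
          eqToHom (Strict.id_comp (𝟙 b))) }

end Section

end CategoryOver

end Sections

/-! ### Extensionality up to heterogeneous equality -/

section Ext

variable {A : Type u₁} [Bicategory.{w₁, v₁} A] {B : Type u₂} [Bicategory.{w₂, v₂} B]
  {C : Type u₃} [Bicategory.{w₃, v₃} C]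

/-- The comparison 2-cells of a 2-functor are the canonical ones, so they carry no further data.
Heterogeneous equality replaces transport along the equalities of objects and 1-cells. -/
theorem strictPseudofunctor_hext {F G : StrictPseudofunctor B C} (h₀ : ∀ b, F.obj b = G.obj b)
    (h₁ : ∀ {b b' : B} (f : b ⟶ b'), F.map f ≍ G.map f)
    (h₂ : ∀ {b b' : B} {f f' : b ⟶ b'} (η : f ⟶ f'), F.map₂ η ≍ G.map₂ η) : F = G := by
  obtain ⟨⟨⟨⟨⟨⟨Fo, Fm⟩, Fm₂⟩, _, _⟩, Fi, Fc, _, _, _, _, _⟩, Fi', hFi⟩, Fc', hFc⟩ := F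
  obtain ⟨⟨⟨⟨⟨⟨Go, Gm⟩, Gm₂⟩, _, _⟩, Gi, Gc, _, _, _, _, _⟩, Gi', hGi⟩, Gc', hGc⟩ := G
  dsimp only at h₀ h₁ h₂ hFi hGi hFc hGc Fi' Fc' Gi' Gc'
  obtain rfl : Fo = Go := funext h₀
  obtain rfl : @Fm = @Gm := by
    funext b b' f; exact eq_of_heq (h₁ f)
  obtain rfl : @Fm₂ = @Gm₂ := by
    funext b b' f f' η; exact eq_of_heq (h₂ η)
  obtain rfl : Fi = Gi := by
    funext b; exact (hFi b).trans (hGi b).symm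
  obtain rfl : @Fc = @Gc := by
    funext b b' b'' f g; exact (hFc f g).trans (hGc f g).symm
  rfl

theorem strongTrans_hext {F F' G G' : B ⥤ᵖ C} (hF : F = F') (hG : G = G') {η : F ⟶ G}
    {η' : F' ⟶ G'} (h : ∀ b, η.app b ≍ η'.app b)
    (h' : ∀ {b b' : B} (g : b ⟶ b'), (η.naturality g).hom ≍ (η'.naturality g).hom) : η ≍ η' := by
  subst hF hG
  obtain ⟨ηa, ηn, _, _, _⟩ := η
  obtain ⟨θa, θn, _, _, _⟩ := η'
  obtain rfl : ηa = θa := funext fun b => eq_of_heq (h b)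
  obtain rfl : @ηn = @θn := by
    funext a b f
    exact Iso.ext (eq_of_heq (h' f))
  rfl

theorem modification_hext {F F' G G' : B ⥤ᵖ C} (hF : F = F') (hG : G = G') {η θ : F ⟶ G}
    {η' θ' : F' ⟶ G'} (hη : η ≍ η') (hθ : θ ≍ θ') {m : η ⟶ θ} {m' : η' ⟶ θ'}
    (h : ∀ b, m.as.app b ≍ m'.as.app b) : m ≍ m' := by
  subst hF hG hη hθ
  exact heq_of_eq (Pseudofunctor.StrongTrans.homCategory.ext fun b => eq_of_heq (h b))

theorem Ps.hom_heq {F F' G G' : Ps B C} (hF : F = F') (hG : G = G') {η : F ⟶ G} {η' : F' ⟶ G'}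
    (h : η.hom ≍ η'.hom) : η ≍ η' := by
  subst hF hG
  exact heq_of_eq (InducedBicategory.hom_ext (eq_of_heq h))

theorem Ps.hom₂_heq {F F' G G' : Ps B C} (hF : F = F') (hG : G = G') {η θ : F ⟶ G}
    {η' θ' : F' ⟶ G'} (hη : η ≍ η') (hθ : θ ≍ θ') {m : η ⟶ θ} {m' : η' ⟶ θ'}
    (h : m.hom ≍ m'.hom) : m ≍ m' := by
  subst hF hG hη hθ
  exact heq_of_eq (InducedBicategory.hom₂_ext (eq_of_heq h))

/-- Two 2-functors into `Ps(B, C)` are equal if they agree in every variable. -/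
theorem Ps.functor_hext {K K' : StrictPseudofunctor A (Ps B C)}
    (obj : ∀ a b, (K.obj a).obj b = (K'.obj a).obj b)
    (right : ∀ (a : A) {b b' : B} (g : b ⟶ b'), (K.obj a).map g ≍ (K'.obj a).map g)
    (right₂ : ∀ (a : A) {b b' : B} {g g' : b ⟶ b'} (β : g ⟶ g'),
      (K.obj a).map₂ β ≍ (K'.obj a).map₂ β)
    (left : ∀ {a a' : A} (f : a ⟶ a') (b : B), (K.map f).hom.app b ≍ (K'.map f).hom.app b)
    (swap : ∀ {a a' : A} (f : a ⟶ a') {b b' : B} (g : b ⟶ b'),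
      ((K.map f).hom.naturality g).hom ≍ ((K'.map f).hom.naturality g).hom)
    (left₂ : ∀ {a a' : A} {f f' : a ⟶ a'} (α : f ⟶ f') (b : B),
      (K.map₂ α).hom.as.app b ≍ (K'.map₂ α).hom.as.app b) : K = K' := by
  have h₀ (a : A) : K.obj a = K'.obj a := strictPseudofunctor_hext (obj a) (right a) (right₂ a)
  have h₀' (a : A) : (K.obj a).toPseudofunctor = (K'.obj a).toPseudofunctor := by rw [h₀]
  have h₁ {a a' : A} (f : a ⟶ a') : (K.map f).hom ≍ (K'.map f).hom :=
    strongTrans_hext (h₀' a) (h₀' a') (left f) (swap f)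
  have h₁' {a a' : A} (f : a ⟶ a') : K.map f ≍ K'.map f :=
    Ps.hom_heq (h₀ a) (h₀ a') (h₁ f)
  exact strictPseudofunctor_hext h₀ h₁' fun α => Ps.hom₂_heq (h₀ _) (h₀ _) (h₁' _) (h₁' _) <|
    modification_hext (h₀' _) (h₀' _) (h₁ _) (h₁ _) (left₂ α)

end Ext

/-! ### Congruence of the 2-categorical operations under heterogeneous equality -/

section CompHEq

variable {C : Type u} [Bicategory.{w, v} C]

theorem hom_comp_heq {x y z x' y' z' : C} (hx : x = x') (hy : y = y') (hz : z = z')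
    {f : x ⟶ y} {f' : x' ⟶ y'} (hf : f ≍ f') {g : y ⟶ z} {g' : y' ⟶ z'} (hg : g ≍ g') :
    f ≫ g ≍ f' ≫ g' := by
  subst hx hy hz hf hg; rfl

theorem cell_comp_heq {x y x' y' : C} (hx : x = x') (hy : y = y') {f g h : x ⟶ y}
    {f' g' h' : x' ⟶ y'} (hf : f ≍ f') (hg : g ≍ g') (hh : h ≍ h') {η : f ⟶ g} {η' : f' ⟶ g'}
    (hη : η ≍ η') {θ : g ⟶ h} {θ' : g' ⟶ h'} (hθ : θ ≍ θ') : η ≫ θ ≍ η' ≫ θ' := by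
  subst hx hy hf hg hh hη hθ; rfl

theorem whiskerLeft_heq {x y z x' y' z' : C} (hx : x = x') (hy : y = y') (hz : z = z')
    {f : x ⟶ y} {f' : x' ⟶ y'} (hf : f ≍ f') {g h : y ⟶ z} {g' h' : y' ⟶ z'} (hg : g ≍ g')
    (hh : h ≍ h') {η : g ⟶ h} {η' : g' ⟶ h'} (hη : η ≍ η') : f ◁ η ≍ f' ◁ η' := by
  subst hx hy hz hf hg hh hη; rfl

theorem whiskerRight_heq {x y z x' y' z' : C} (hx : x = x') (hy : y = y') (hz : z = z')
    {f g : x ⟶ y} {f' g' : x' ⟶ y'} (hf : f ≍ f') (hg : g ≍ g') {η : f ⟶ g} {η' : f' ⟶ g'}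
    (hη : η ≍ η') {h : y ⟶ z} {h' : y' ⟶ z'} (hh : h ≍ h') : η ▷ h ≍ η' ▷ h' := by
  subst hx hy hz hf hg hh hη; rfl

theorem iso_inv_heq {x y x' y' : C} (hx : x = x') (hy : y = y') {f g : x ⟶ y}
    {f' g' : x' ⟶ y'} (hf : f ≍ f') (hg : g ≍ g') {η : f ≅ g} {η' : f' ≅ g'}
    (hη : η.hom ≍ η'.hom) : η.inv ≍ η'.inv := by
  subst hx hy hf hg
  obtain rfl : η = η' := Iso.ext (eq_of_heq hη)
  rfl

theorem eqToHom_hom_heq {x y x' y' : C} (hx : x = x') (hy : y = y') {f g : x ⟶ y}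
    {f' g' : x' ⟶ y'} (hf : f ≍ f') (p : f = g) (q : f' = g') : eqToHom p ≍ eqToHom q := by
  subst hx hy hf p q; rfl

/-- Up to heterogeneous equality, identity 2-cells between syntactically different 1-cells can be
discarded. This is how strict coherence is handled from here on. -/
theorem IsIdentity.heq_comp {x y : C} {f g h : x ⟶ y} {η : f ⟶ g} (p : IsIdentity η)
    (θ : g ⟶ h) : η ≫ θ ≍ θ := by
  obtain ⟨rfl, rfl⟩ := p; simp

theorem IsIdentity.comp_heq {x y : C} {f g h : x ⟶ y} (η : f ⟶ g) {θ : g ⟶ h}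
    (p : IsIdentity θ) : η ≫ θ ≍ η := by
  obtain ⟨rfl, rfl⟩ := p; simp

theorem IsIdentity.conj_heq {x y : C} {f g h k : x ⟶ y} {η : f ⟶ g} (p : IsIdentity η)
    (θ : g ⟶ h) {κ : h ⟶ k} (q : IsIdentity κ) : η ≫ θ ≫ κ ≍ θ :=
  (p.heq_comp _).trans (q.comp_heq θ)

end CompHEq

/-! ### Invertible icons -/

section IconIso

variable {A : Type u₁} [Bicategory.{w₁, v₁} A] {B : Type u₂} [Bicategory.{w₂, v₂} B]

/-- An icon with invertible 2-cells has an inverse. -/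
theorem Icon.exists_inverse {F G : A ⥤ᵖ B} (α : Icon F G)
    (h : ∀ {a b : A} (f : a ⟶ b), IsIso (α.app f)) :
    ∃ β : Icon G F, α.vcomp β = Icon.id F ∧ β.vcomp α = Icon.id G := by
  obtain ⟨⟨⟨⟨Fo, Fm⟩, Fm₂⟩, _, _⟩, Fi, Fc, _, _, _, _, _⟩ := F
  obtain ⟨⟨⟨⟨Go, Gm⟩, Gm₂⟩, _, _⟩, Gi, Gc, _, _, _, _, _⟩ := G
  obtain ⟨h₀, app, nat, app_id, app_comp⟩ := α
  dsimp only at h₀ app nat app_id app_comp h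
  obtain rfl : Fo = Go := funext h₀
  -- Once the object maps coincide, each `castHom` is along a proof of `x = x` and reduces by
  -- definition, so the fields can be restated without transports.
  change ∀ {a b : A} (f : a ⟶ b), Fm f ⟶ Gm f at app
  replace nat : ∀ {a b : A} {f g : a ⟶ b} (η : f ⟶ g), Fm₂ η ≫ app g = app f ≫ Gm₂ η := nat
  replace app_id : ∀ a, app (𝟙 a) ≫ (Gi a).hom = (Fi a).hom ≫ 𝟙 _ := app_id
  replace app_comp : ∀ {a b c : A} (f : a ⟶ b) (g : b ⟶ c), app (f ≫ g) ≫ (Gc f g).hom =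
      (Fc f g).hom ≫ app f ▷ Fm g ≫ Gm f ◁ app g ≫ 𝟙 _ := app_comp
  replace h : ∀ {a b : A} (f : a ⟶ b), IsIso (app f) := h
  refine ⟨⟨fun _ => rfl, fun {a b} f => (inv (app f) : Gm f ⟶ Fm f), fun {a b f g} η => ?_, fun a => ?_,
    fun {a b c} f g => ?_⟩, Icon.ext fun {a b} f => ?_, Icon.ext fun {a b} f => ?_⟩
  · change Gm₂ η ≫ inv (app g) = inv (app f) ≫ Fm₂ η
    have e := congrArg (fun t => inv (app f) ≫ t ≫ inv (app g)) (nat η)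
    refine Eq.trans ?_ (e.symm.trans ?_) <;> simp
  · change inv (app (𝟙 a)) ≫ (Fi a).hom = (Gi a).hom ≫ 𝟙 _
    rw [IsIso.inv_comp_eq, Category.comp_id, app_id, Category.comp_id]
  · change inv (app (f ≫ g)) ≫ (Fc f g).hom =
      (Gc f g).hom ≫ inv (app f) ▷ Gm g ≫ Fm f ◁ inv (app g) ≫ 𝟙 _
    rw [IsIso.inv_comp_eq, ← Category.assoc, app_comp]
    have e : Gm f ◁ app g ≫ inv (app f) ▷ Gm g = inv (app f) ▷ Fm g ≫ Fm f ◁ app g :=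
      Bicategory.whisker_exchange _ _
    simp only [Category.assoc, Category.comp_id]
    rw [reassoc_of% e, ← Bicategory.comp_whiskerRight_assoc, ← Bicategory.whiskerLeft_comp]
    simp
  · change app f ≫ inv (app f) ≫ 𝟙 _ = 𝟙 _
    simp
  · change inv (app f) ≫ app f ≫ 𝟙 _ = 𝟙 _
    simp

/-- An isomorphism in the 2-category of 2-categories, pseudofunctors and icons, from an icon
with invertible 2-cells. -/
theorem nonempty_iso_of_icon {X Y : TwoCat.{u}} {F G : X ⟶ Y}
    (α : Icon (A := X) (B := Y) F G) (h : ∀ {a b : X} (f : a ⟶ b), IsIso (α.app f)) :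
    Nonempty (F ≅ G) := by
  obtain ⟨β, h₁, h₂⟩ := α.exists_inverse h
  exact ⟨⟨α, β, h₁, h₂⟩⟩

/-- A pseudofunctor that is isomorphic to the identity by an icon is locally bijective on
2-cells. -/
theorem map₂_bijective_of_icon {F : A ⥤ᵖ A} (α : Icon F (Pseudofunctor.id A))
    (β : Icon (Pseudofunctor.id A) F) (h₁ : α.vcomp β = Icon.id F)
    (h₂ : β.vcomp α = Icon.id (Pseudofunctor.id A)) {a b : A} (f g : a ⟶ b) :
    Function.Bijective (fun η : f ⟶ g => F.map₂ η) := by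
  obtain ⟨⟨⟨⟨Fo, Fm⟩, Fm₂⟩, _, _⟩, Fi, Fc, _, _, _, _, _⟩ := F
  have h₁' {a b : A} (f : a ⟶ b) : (α.vcomp β).app f = (Icon.id _).app f := by rw [h₁]
  have h₂' {a b : A} (f : a ⟶ b) : (β.vcomp α).app f = (Icon.id _).app f := by rw [h₂]
  obtain ⟨h₀, app, nat, _, _⟩ := α
  obtain ⟨h₀', app', nat', _, _⟩ := β
  obtain rfl : Fo = fun a => a := funext h₀
  change ∀ {a b : A} (f : a ⟶ b), Fm f ⟶ f at app
  change ∀ {a b : A} (f : a ⟶ b), f ⟶ Fm f at app'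
  replace nat : ∀ {a b : A} {f g : a ⟶ b} (η : f ⟶ g), Fm₂ η ≫ app g = app f ≫ η := nat
  replace h₁' : ∀ {a b : A} (f : a ⟶ b), app f ≫ app' f = 𝟙 _ := fun f =>
    (by simp : app f ≫ app' f = app f ≫ app' f ≫ 𝟙 _).trans (h₁' f)
  replace h₂' : ∀ {a b : A} (f : a ⟶ b), app' f ≫ app f = 𝟙 _ := fun f =>
    (by simp : app' f ≫ app f = app' f ≫ app f ≫ 𝟙 _).trans (h₂' f)
  change Function.Bijective fun η : f ⟶ g => (Fm₂ η : Fm f ⟶ Fm g)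
  have i {a b : A} (f : a ⟶ b) : IsIso (app f) := ⟨app' f, h₁' f, h₂' f⟩
  -- Naturality says that the image of `η` is `η` conjugated by the invertible 2-cells `app f` and
  -- `app g`, and conjugation is a bijection.
  exact ⟨fun η θ h => (cancel_epi (app f)).1 <| (nat η).symm.trans <|
      (congrArg (fun t => t ≫ app g) h).trans (nat θ),
    fun ζ => ⟨inv (app f) ≫ ζ ≫ app g, (cancel_mono (app g)).1 ((nat _).trans (by simp))⟩⟩

end IconIso

/-! ### Replacing a pseudofunctor `G` by a 2-functor: the 2-category of `isoOver G` -/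

section Pseudolimit

open CategoryOver CategoryOver.Total

variable {X : Type u₁} [Bicategory.{w₁, v₁} X] {C : Type u₂} [Bicategory.{w₂, v₂} C]

/-- A 1-cell of `X` together with a 1-cell of `C` isomorphic to its image under `G`. -/
structure IsoOver (G : X ⥤ᵖ C) (x y : X) where
  base : x ⟶ y
  hom : G.obj x ⟶ G.obj y
  iso : hom ≅ G.map base

namespace IsoOver

variable {G : X ⥤ᵖ C}

/-- Equality of triples is witnessed by identity 2-cells on both 1-cell components that are
compatible with the isomorphisms. With unitors and associators as witnesses, the category laws of
`isoOver G` become the coherence axioms of `G`. -/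
theorem ext_of_isIdentity {x y : X} {f g : IsoOver G x y} {e : f.base ⟶ g.base}
    (he : IsIdentity e) {e' : f.hom ⟶ g.hom} (he' : IsIdentity e')
    (h : f.iso.hom ≫ G.map₂ e = e' ≫ g.iso.hom) : f = g := by
  obtain ⟨p, c, i⟩ := f
  obtain ⟨q, d, j⟩ := g
  obtain ⟨hp, he⟩ := he
  obtain ⟨hc, he'⟩ := he'
  dsimp only at hp hc he he' h
  subst hp hc
  obtain rfl : i = j := Iso.ext (by simpa [he, he'] using h)
  rfl

/-- The identity. -/
abbrev id (G : X ⥤ᵖ C) (x : X) : IsoOver G x x := ⟨𝟙 x, 𝟙 (G.obj x), (G.mapId x).symm⟩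

/-- Composition. -/
abbrev comp {x y z : X} (f : IsoOver G x y) (g : IsoOver G y z) : IsoOver G x z :=
  ⟨f.base ≫ g.base, f.hom ≫ g.hom, whiskerRightIso f.iso g.hom ≪≫
    whiskerLeftIso (G.map f.base) g.iso ≪≫ (G.mapComp f.base g.base).symm⟩

end IsoOver

/-- The comparison cells of `G` cancel and `i` passes through by interchange. Conjugation by the
chosen isomorphisms thus commutes with whiskering strictly, and this is what makes `toTarget` a
2-functor although `G` is only a pseudofunctor. The trivial identity factors match the axiom of a
strict functor. -/
theorem conj_whiskerLeft (G : X ⥤ᵖ C) {x y z : X} {f : x ⟶ y} {g h : y ⟶ z}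
    {c : G.obj x ⟶ G.obj y} {d e : G.obj y ⟶ G.obj z} (i : c ≅ G.map f) (j : d ≅ G.map g)
    (k : e ≅ G.map h) (η : g ⟶ h) :
    (whiskerRightIso i d ≪≫ whiskerLeftIso (G.map f) j ≪≫ (G.mapComp f g).symm).hom ≫
      G.map₂ (f ◁ η) ≫
        (whiskerRightIso i e ≪≫ whiskerLeftIso (G.map f) k ≪≫ (G.mapComp f h).symm).inv =
      𝟙 _ ≫ c ◁ (j.hom ≫ G.map₂ η ≫ k.inv) ≫ 𝟙 _ := by
  have h' := congrArg (fun t => t ≫ i.inv ▷ e)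
    (whisker_exchange i.hom (j.hom ≫ G.map₂ η ≫ k.inv))
  simp only [Category.assoc, hom_inv_whiskerRight, Category.comp_id] at h'
  rw [h']
  simp

theorem conj_whiskerRight (G : X ⥤ᵖ C) {x y z : X} {f g : x ⟶ y} {h : y ⟶ z}
    {c d : G.obj x ⟶ G.obj y} {e : G.obj y ⟶ G.obj z} (i : c ≅ G.map f) (j : d ≅ G.map g)
    (k : e ≅ G.map h) (η : f ⟶ g) :
    (whiskerRightIso i e ≪≫ whiskerLeftIso (G.map f) k ≪≫ (G.mapComp f h).symm).hom ≫
      G.map₂ (η ▷ h) ≫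
        (whiskerRightIso j e ≪≫ whiskerLeftIso (G.map g) k ≪≫ (G.mapComp g h).symm).inv =
      𝟙 _ ≫ (i.hom ≫ G.map₂ η ≫ j.inv) ▷ e ≫ 𝟙 _ := by
  simp [whisker_exchange_assoc]

variable [Strict X] [Strict C]

/-- The category over `X` whose morphisms are the 1-cells of `X` together with a 1-cell of `C`
isomorphic to their image under `G`. -/
def isoOver (G : X ⥤ᵖ C) : CategoryOver X where
  Hom x y := IsoOver G x y
  id x := .id G x
  comp f g := f.comp g
  id_comp f := IsoOver.ext_of_isIdentity (.leftUnitor f.base) (.leftUnitor f.hom) (by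
    simp [Pseudofunctor.map₂_left_unitor, whisker_exchange_assoc])
  comp_id f := IsoOver.ext_of_isIdentity (.rightUnitor f.base) (.rightUnitor f.hom) (by
    simp [Pseudofunctor.map₂_right_unitor])
  assoc f g h := IsoOver.ext_of_isIdentity (.associator f.base g.base h.base)
    (.associator f.hom g.hom h.hom) (by
      simp [Pseudofunctor.map₂_associator, whisker_exchange_assoc])
  proj f := f.base
  proj_id _ := rfl
  proj_comp _ _ := rfl

namespace isoOver

variable (G : X ⥤ᵖ C)

/-- The isomorphism attached to a 1-cell of the total 2-category of `isoOver G`. -/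
def iso {x y : (isoOver G).Total} (f : x ⟶ y) : (Total.lift f).hom ≅ G.map (base f) :=
  (Total.lift f).iso ≪≫ eqToIso (congrArg G.map (THom.w f))

theorem iso_id (x : (isoOver G).Total) : iso G (𝟙 x) = (G.mapId x.ob).symm := by
  ext; exact Category.comp_id _

theorem iso_comp {x y z : (isoOver G).Total} (f : x ⟶ y) (g : y ⟶ z) :
    iso G (f ≫ g) = whiskerRightIso (iso G f) (Total.lift g).hom ≪≫
      whiskerLeftIso (G.map (base f)) (iso G g) ≪≫ (G.mapComp (base f) (base g)).symm := by
  obtain ⟨_, f, rfl⟩ := f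
  obtain ⟨_, g, rfl⟩ := g
  -- With `base` replaced by the projection of `lift`, the correction by `eqToIso` is a reflexive
  -- isomorphism.
  change ((isoOver G).comp f g).iso ≪≫ Iso.refl _ = whiskerRightIso (f.iso ≪≫ Iso.refl _) g.hom ≪≫
    whiskerLeftIso (G.map f.base) (g.iso ≪≫ Iso.refl _) ≪≫ _
  simp only [Iso.trans_refl]
  rfl

/-- The 2-functor from the total 2-category of `isoOver G` to `C`. -/
def toTarget : StrictPseudofunctor (isoOver G).Total C :=
  .mk''
  { obj := fun x => G.obj x.ob
    map := fun f => (Total.lift f).hom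
    map₂ := fun {x y f g} η => (iso G f).hom ≫ G.map₂ (Total.cell η) ≫ (iso G g).inv
    map₂_id := fun f => by
      change (iso G f).hom ≫ G.map₂ (𝟙 (base f)) ≫ (iso G f).inv = _
      simp
    map₂_comp := fun {x y f g h} η θ => by
      change (iso G f).hom ≫ G.map₂ (Total.cell η ≫ Total.cell θ) ≫ (iso G h).inv = _
      simp
    map_id := fun _ => rfl
    map_comp := fun _ _ => rfl
    map₂_whisker_left := fun f g h η => by
      change (iso G (f ≫ g)).hom ≫ G.map₂ (base f ◁ Total.cell η) ≫ (iso G (f ≫ h)).inv =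
        𝟙 _ ≫ (Total.lift f).hom ◁ ((iso G g).hom ≫ G.map₂ (Total.cell η) ≫ (iso G h).inv) ≫ 𝟙 _
      rw [iso_comp, iso_comp]
      exact conj_whiskerLeft G (iso G f) (iso G g) (iso G h) η
    map₂_whisker_right := fun {_ _ _ f g} η h => by
      change (iso G (f ≫ h)).hom ≫ G.map₂ (Total.cell η ▷ base h) ≫ (iso G (g ≫ h)).inv =
        𝟙 _ ≫ ((iso G f).hom ≫ G.map₂ (Total.cell η) ≫ (iso G g).inv) ▷ (Total.lift h).hom ≫ 𝟙 _
      rw [iso_comp, iso_comp]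
      exact conj_whiskerRight G (iso G f) (iso G g) (iso G h) η }

/-- The invertible icon between `toTarget G` and the composite of the projection with `G`. -/
def icon : Icon (toTarget G).toPseudofunctor ((isoOver G).projection.toPseudofunctor.comp G) where
  obj_eq _ := rfl
  app f := (iso G f).hom
  naturality {x y f g} η := by
    change ((iso G f).hom ≫ G.map₂ (Total.cell η) ≫ (iso G g).inv) ≫ (iso G g).hom =
      (iso G f).hom ≫ G.map₂ (Total.cell η)
    simp
  app_id x := by
    change (iso G (𝟙 x)).hom ≫ G.map₂ (𝟙 (𝟙 x.ob)) ≫ (G.mapId x.ob).hom = 𝟙 _ ≫ 𝟙 _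
    rw [iso_id]
    exact (by simp : (G.mapId x.ob).inv ≫ G.map₂ (𝟙 (𝟙 x.ob)) ≫ (G.mapId x.ob).hom = 𝟙 _ ≫ 𝟙 _)
  app_comp {x y z} f g := by
    change (iso G (f ≫ g)).hom ≫ G.map₂ (𝟙 (base f ≫ base g)) ≫
        (G.mapComp (base f) (base g)).hom =
      𝟙 _ ≫ (iso G f).hom ▷ (Total.lift g).hom ≫ G.map (base f) ◁ (iso G g).hom ≫ 𝟙 _
    rw [iso_comp]
    exact (by simp : ∀ {p q r : G.obj x ⟶ G.obj z} (i : p ⟶ q) (j : q ⟶ r)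
      (k : G.map (base f ≫ base g) ≅ r), (i ≫ j ≫ k.inv) ≫ G.map₂ (𝟙 (base f ≫ base g)) ≫ k.hom =
        𝟙 _ ≫ i ≫ j ≫ 𝟙 _) _ _ _

end isoOver

end Pseudolimit

/-! ### Naturality 2-cells after composition with a 2-functor -/

section Postcomp

variable {B : Type u₁} [Bicategory.{w₁, v₁} B] {C : Type u₂} [Bicategory.{w₂, v₂} C]
  {D : Type u₃} [Bicategory.{w₃, v₃} D]

theorem strongTransMap_naturality_heq {F G : B ⥤ᵖ C} (η : F ⟶ G) (H : StrictPseudofunctor C D)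
    {b b' : B} (g : b ⟶ b') :
    ((strongTransMap η H.toPseudofunctor).naturality g).hom ≍ H.map₂ (η.naturality g).hom :=
  IsIdentity.conj_heq (.inv (.mapComp H _ _)) _ (.mapComp H _ _)

end Postcomp

/-! ### Discarding strict units -/

section Unit

variable {C : Type u} [Bicategory.{w, v} C] [Strict C]

theorem id_whiskerLeft_heq {x y : C} {f g : x ⟶ y} (η : f ⟶ g) : 𝟙 x ◁ η ≍ η := by
  rw [id_whiskerLeft]
  exact IsIdentity.conj_heq (.leftUnitor f) η (.inv (.leftUnitor g))

theorem whiskerRight_id_heq {x y : C} {f g : x ⟶ y} (η : f ⟶ g) : η ▷ 𝟙 y ≍ η := by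
  rw [whiskerRight_id]
  exact IsIdentity.conj_heq (.rightUnitor f) η (.inv (.rightUnitor g))

theorem whiskerLeft_heq_of_eq_id {x y : C} {e : x ⟶ x} (he : e = 𝟙 x) {f g : x ⟶ y}
    (η : f ⟶ g) : e ◁ η ≍ η := by
  subst he; exact id_whiskerLeft_heq η

theorem whiskerRight_heq_of_eq_id {x y : C} {e : y ⟶ y} (he : e = 𝟙 y) {f g : x ⟶ y}
    (η : f ⟶ g) : η ▷ e ≍ η := by
  subst he; exact whiskerRight_id_heq η

/-- When the outer 1-cells are identities, only the naturality 2-cell `n` survives in the comparison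
2-cell of evaluation; all other factors are identities. This is how pseudonaturality cells are
recovered from a cubical functor. -/
theorem evComp_heq {x y p q : C} {f₁₂ : x ⟶ y} {f₁ : x ⟶ x} {f₂ : x ⟶ y}
    {φ : f₁₂ ≅ f₁ ≫ f₂} {s : y ⟶ q} {r : x ⟶ p} {g₂ : p ⟶ q} {n : f₂ ≫ s ≅ r ≫ g₂}
    {t : q ⟶ q} (hφ : IsIdentity φ.hom) (hf : f₁ = 𝟙 x) (ht : t = 𝟙 q) :
    (evComp φ n t).hom ≍ n.hom := by
  refine ((IsIdentity.whiskerRight hφ _).heq_comp _).trans <|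
    ((IsIdentity.associator _ _ _).heq_comp _).trans <|
    (IsIdentity.comp_heq _ (.inv (.associator _ _ _))).trans <|
    (whiskerLeft_heq_of_eq_id hf _).trans <|
    ((IsIdentity.inv (.associator _ _ _)).conj_heq _ (.associator _ _ _)).trans <|
    whiskerRight_heq_of_eq_id ht _

end Unit

/-! ### Identity isomorphisms in `isoOver G` -/

section IsoOver

open CategoryOver

variable {X : Type u₁} [Bicategory.{w₁, v₁} X] {C : Type u₂} [Bicategory.{w₂, v₂} C]
  {G : X ⥤ᵖ C}

theorem IsoOver.ext_of_iso {x y : X} {f g : IsoOver G x y} (h : f.base = g.base)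
    (h' : f.hom = g.hom) (hf : IsIdentity f.iso.hom) (hg : IsIdentity g.iso.hom) : f = g :=
  ext_of_isIdentity (.hom h) (.hom h')
    (IsIdentity.eq (.comp hf (.map₂ G (.hom h))) (.comp (.hom h') hg))

theorem isoOver.isIdentity_iso_comp [Strict X] [Strict C] {x y z : (isoOver G).Total} {f : x ⟶ y}
    {g : y ⟶ z} (hf : IsIdentity (isoOver.iso G f).hom) (hg : IsIdentity (isoOver.iso G g).hom)
    (h : IsIdentity (G.mapComp (Total.base f) (Total.base g)).hom) :
    IsIdentity (isoOver.iso G (f ≫ g)).hom := by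
  rw [isoOver.iso_comp]
  exact .comp (.whiskerRight hf _) (.comp (.whiskerLeft _ hg) (.inv h))

/-- The isomorphism of a composite contains the inverse comparison 2-cell of `G`. If those of the
factors are identities, nothing else remains; so composing generators is where the comparison cells
of `G` enter. -/
theorem isoOver.iso_comp_inv_heq [Strict X] [Strict C] {x y z : (isoOver G).Total} {f : x ⟶ y}
    {g : y ⟶ z} (hf : IsIdentity (isoOver.iso G f).hom) (hg : IsIdentity (isoOver.iso G g).hom) :
    (isoOver.iso G (f ≫ g)).inv ≍ (G.mapComp (Total.base f) (Total.base g)).hom := by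
  rw [isoOver.iso_comp]
  exact (IsIdentity.comp_heq _ (.inv (.whiskerRight hf _ :
    IsIdentity (whiskerRightIso (isoOver.iso G f) _).hom))).trans
      (IsIdentity.comp_heq _ (.inv (.whiskerLeft _ hg :
        IsIdentity (whiskerLeftIso _ (isoOver.iso G g)).hom)))

theorem IsoOver.isIdentity_comp {x y z : X} {f : IsoOver G x y} {g : IsoOver G y z}
    (hf : IsIdentity f.iso.hom) (hg : IsIdentity g.iso.hom)
    (h : IsIdentity (G.mapComp f.base g.base).hom) : IsIdentity (f.comp g).iso.hom :=
  .comp (.whiskerRight hf _) (.comp (.whiskerLeft _ hg) (.inv h))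

end IsoOver

/-! ### Recovering a 2-functor into `Ps(B, C)` from its cubical functor -/

section UncurrySection

open CategoryOver CategoryOver.Total

variable {A : Type u₁} [Bicategory.{w₁, v₁} A] [Strict A] {B : Type u₂} [Bicategory.{w₂, v₂} B]
  [Strict B] {C : Type u₃} [Bicategory.{w₃, v₃} C] [Strict C]
  (K : StrictPseudofunctor A (Ps B C))

theorem app_map_id (a : A) (b : B) : (K.map (𝟙 a)).hom.app b = 𝟙 ((K.obj a).obj b) := by
  rw [K.map_id]; rfl

theorem app_map_comp {a a' a'' : A} (f : a ⟶ a') (f' : a' ⟶ a'') (b : B) :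
    (K.map (f ≫ f')).hom.app b = (K.map f).hom.app b ≫ (K.map f').hom.app b := by
  rw [K.map_comp]; rfl

/-- The cubical functor takes `(f, g)` to `(K a) g` followed by a component of `K f`, and the first
factor is an identity when `g` is. -/
theorem uncurry_map_left {a a' : A} (f : a ⟶ a') (b : B) :
    (K.map f).hom.app b =
      (uncurryPseudofunctor K).map ((f, 𝟙 b) : ((a, b) : A × B) ⟶ (a', b)) :=
  (Strict.id_comp _).symm.trans <|
    congrArg (fun e => e ≫ (K.map f).hom.app b) ((K.obj a).map_id b).symm

theorem uncurry_map_right (a : A) {b b' : B} (g : b ⟶ b') :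
    (K.obj a).map g =
      (uncurryPseudofunctor K).map ((𝟙 a, g) : ((a, b) : A × B) ⟶ (a, b')) :=
  (Strict.comp_id _).symm.trans <|
    congrArg (fun e => (K.obj a).map g ≫ e) (app_map_id K a b').symm

/-- The 1-cell `K f b` over `(f, 𝟙 b)`. -/
def uncurryLeft {a a' : A} (f : a ⟶ a') (b : B) :
    IsoOver (uncurryPseudofunctor K) (a, b) (a', b) where
  base := (f, 𝟙 b)
  hom := (K.map f).hom.app b
  iso := eqToIso (uncurry_map_left K f b)

/-- The 1-cell `K a g` over `(𝟙 a, g)`. -/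
def uncurryRight (a : A) {b b' : B} (g : b ⟶ b') :
    IsoOver (uncurryPseudofunctor K) (a, b) (a, b') where
  base := (𝟙 a, g)
  hom := (K.obj a).map g
  iso := eqToIso (uncurry_map_right K a g)

theorem isIdentity_uncurryLeft {a a' : A} (f : a ⟶ a') (b : B) :
    IsIdentity (uncurryLeft K f b).iso.hom :=
  .hom (uncurry_map_left K f b)

theorem isIdentity_uncurryRight (a : A) {b b' : B} (g : b ⟶ b') :
    IsIdentity (uncurryRight K a g).iso.hom :=
  .hom (uncurry_map_right K a g)

theorem uncurryLeft_id (a : A) (b : B) : uncurryLeft K (𝟙 a) b = .id _ (a, b) :=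
  IsoOver.ext_of_iso rfl (app_map_id K a b) (isIdentity_uncurryLeft K _ _)
    (.inv (.uncurry_mapId K (a, b)))

/-- Cubicality enters here: the second factor is an identity in `B`, so the comparison 2-cell is an
identity and the composite again carries an identity isomorphism. The companion `uncurryRight_comp`
uses the other half of cubicality. -/
theorem uncurryLeft_comp {a a' a'' : A} (f : a ⟶ a') (f' : a' ⟶ a'') (b : B) :
    uncurryLeft K (f ≫ f') b = (uncurryLeft K f b).comp (uncurryLeft K f' b) :=
  IsoOver.ext_of_iso (Prod.ext rfl (Strict.id_comp (𝟙 b)).symm)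
    (app_map_comp K f f' b) (isIdentity_uncurryLeft K _ _)
    (IsoOver.isIdentity_comp (isIdentity_uncurryLeft K _ _) (isIdentity_uncurryLeft K _ _)
      ((uncurry K).mapComp_of_snd (x := (a, b)) (a := a') (b := b) (f, 𝟙 b) f'))

theorem uncurryRight_id (a : A) (b : B) : uncurryRight K a (𝟙 b) = .id _ (a, b) :=
  IsoOver.ext_of_iso rfl ((K.obj a).map_id b) (isIdentity_uncurryRight K _ _)
    (.inv (.uncurry_mapId K (a, b)))

theorem uncurryRight_comp (a : A) {b b' b'' : B} (g : b ⟶ b') (g' : b' ⟶ b'') :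
    uncurryRight K a (g ≫ g') = (uncurryRight K a g).comp (uncurryRight K a g') :=
  IsoOver.ext_of_iso (Prod.ext (Strict.id_comp (𝟙 a)).symm rfl)
    ((K.obj a).map_comp g g') (isIdentity_uncurryRight K _ _)
    (IsoOver.isIdentity_comp (isIdentity_uncurryRight K _ _) (isIdentity_uncurryRight K _ _)
      ((uncurry K).mapComp_of_fst (a := a) (z := (a, b'')) g (𝟙 a, g')))

/-- The section of `isoOver` of the cubical functor of `K` given by the values of `K`. -/
def uncurrySection : (isoOver (uncurryPseudofunctor K)).Section where
  left f b := uncurryLeft K f b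
  right a _ _ g := uncurryRight K a g
  left_id := uncurryLeft_id K
  left_comp := uncurryLeft_comp K
  right_id := uncurryRight_id K
  right_comp := uncurryRight_comp K
  proj_left _ _ := rfl
  proj_right _ _ _ _ := rfl

theorem isIdentity_iso_left {a a' : A} (f : a ⟶ a') (b : B) :
    IsIdentity (isoOver.iso _ ((uncurrySection K).leftHom f b)).hom :=
  .comp (isIdentity_uncurryLeft K f b) (.id _)

theorem isIdentity_iso_right (a : A) {b b' : B} (g : b ⟶ b') :
    IsIdentity (isoOver.iso _ ((uncurrySection K).rightHom a g)).hom :=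
  .comp (isIdentity_uncurryRight K a g) (.id _)

theorem isIdentity_app_map₂_id {a a' : A} (f : a ⟶ a') (b : B) :
    IsIdentity ((K.map₂ (𝟙 f)).hom.as.app b) := by
  rw [K.map₂_id]; exact .id _

theorem uncurry_map₂_right (a : A) {b b' : B} {g g' : b ⟶ b'} (β : g ⟶ g') :
    (uncurryPseudofunctor K).map₂ (a := (a, b)) (b := (a, b')) (f := (𝟙 a, g)) (g := (𝟙 a, g'))
      (Prod.mk (𝟙 (𝟙 a)) β) ≍ (K.obj a).map₂ β :=
  (IsIdentity.comp_heq _ (.whiskerLeft _ (isIdentity_app_map₂_id K (𝟙 a) b'))).trans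
    (whiskerRight_heq_of_eq_id (app_map_id K a b') _)

theorem uncurry_map₂_left {a a' : A} {f f' : a ⟶ a'} (α : f ⟶ f') (b : B) :
    (uncurryPseudofunctor K).map₂ (a := (a, b)) (b := (a', b)) (f := (f, 𝟙 b)) (g := (f', 𝟙 b))
      (Prod.mk α (𝟙 (𝟙 b))) ≍ (K.map₂ α).hom.as.app b := by
  have h : IsIdentity ((K.obj a).map₂ (𝟙 (𝟙 b))) := by
    rw [PrelaxFunctor.map₂_id]; exact .id _
  exact (IsIdentity.heq_comp (.whiskerRight h _) _).trans
    (whiskerLeft_heq_of_eq_id ((K.obj a).map_id b) _)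

/-- For `(f, 𝟙 b)` followed by `(𝟙 a', g)`, the order not covered by cubicality, the comparison
2-cell is precisely the interchange datum of `K`. -/
theorem uncurry_mapComp_heq {a a' : A} (f : a ⟶ a') {b b' : B} (g : b ⟶ b') :
    ((uncurryPseudofunctor K).mapComp ((f, 𝟙 b) : ((a, b) : A × B) ⟶ (a', b))
      ((𝟙 a', g) : ((a', b) : A × B) ⟶ (a', b'))).hom ≍ ((K.map f).hom.naturality g).hom := by
  refine (IsIdentity.heq_comp (.map₂ evaluation <| .prod
      (.comp (.map₂ (Ps.inclusion B C).toPseudofunctor (.mapComp K f (𝟙 a')))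
        (.mapComp (Ps.inclusion B C) (K.map f) (K.map (𝟙 a'))))
      (.id (𝟙 b ≫ g))) _).trans ?_
  refine evComp_heq ?_ ((K.obj a).map_id b) (app_map_id K a' b')
  exact .mapComp (K.obj a : StrictPseudofunctor B C) (𝟙 b) g

/-- On 1-cells and 2-cells in each variable the values of `K` are recovered because the generators
carry identity isomorphisms. The interchange lies over an identity, so its image is governed by the
two composites of generators: one carries an identity isomorphism by cubicality, and the other
contributes the comparison 2-cell that encodes the pseudonaturality of `K`. -/
theorem liftPairing_comp_toTarget :
    (uncurrySection K).liftPairing.comp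
      (Ps.postcomp B (isoOver.toTarget (uncurryPseudofunctor K))) = K := by
  refine Ps.functor_hext (fun _ _ => rfl) (fun _ _ _ _ => HEq.rfl) (fun a b b' g g' β => ?_)
    (fun _ _ => HEq.rfl) (fun {a a'} f {b b'} g => ?_) (fun {a a' f f'} α b => ?_)
  · exact ((isIdentity_iso_right K a g).conj_heq _
      (.inv (isIdentity_iso_right K a g'))).trans (uncurry_map₂_right K a β)
  · refine (strongTransMap_naturality_heq _ _ g).trans ?_
    -- The source composite has its factor in `B` first, so its isomorphism is an identity; next the
    -- image of the identity 2-cell is dropped, and only the inverse isomorphism of the target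
    -- composite is left.
    refine (IsIdentity.heq_comp (isoOver.isIdentity_iso_comp (isIdentity_iso_right K a g)
      (isIdentity_iso_left K f b')
      ((uncurry K).mapComp_of_fst (a := a) (z := (a', b')) g (f, 𝟙 b'))) _).trans ?_
    refine (IsIdentity.heq_comp (.map₂ (uncurryPseudofunctor K)
      ((uncurrySection K).isIdentity_liftMap f g)) _).trans ?_
    exact (isoOver.iso_comp_inv_heq (isIdentity_iso_left K f b)
      (isIdentity_iso_right K a' g)).trans (uncurry_mapComp_heq K f g)
  · exact ((isIdentity_iso_left K f b).conj_heq _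
      (.inv (isIdentity_iso_left K f' b))).trans (uncurry_map₂_left K α b)

theorem liftPairing_comp_projection {D : CategoryOver (A × B)} (S : D.Section) :
    S.liftPairing.comp (Ps.postcomp B D.projection) = pairing A B := by
  refine Ps.functor_hext (fun _ _ => rfl) (fun _ _ _ _ => HEq.rfl) (fun a b b' g g' β => HEq.rfl)
    (fun _ _ => HEq.rfl) (fun {a a'} f {b b'} g => ?_) (fun {a a' f f'} α b => HEq.rfl)
  exact strongTransMap_naturality_heq _ _ g

theorem total_cell_heq {X : Type u} [Bicategory.{w, v} X] {D : CategoryOver X}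
    {x y : D.Total} {f f' g g' : x ⟶ y} (hf : f = f') (hg : g = g') {η : f ⟶ g} {η' : f' ⟶ g'}
    (h : Total.cell η ≍ Total.cell η') : η ≍ η' := by
  subst hf hg; exact h

/-- A morphism over `A × B` leaves underlying 2-cells unchanged, so preservation of the section is
the only thing to check. -/
theorem liftPairing_comp_total {D D' : CategoryOver (A × B)} (φ : Morphism D D') (S : D.Section)
    (S' : D'.Section)
    (hl : ∀ {a a' : A} (f : a ⟶ a') (b : B), φ.map (S.left f b) = S'.left f b)
    (hr : ∀ (a : A) {b b' : B} (g : b ⟶ b'), φ.map (S.right a g) = S'.right a g) :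
    S.liftPairing.comp (Ps.postcomp B φ.total) = S'.liftPairing := by
  refine Ps.functor_hext (fun _ _ => rfl) (fun a _ _ g => heq_of_eq (THom.ext (hr a g)))
    (fun a _ _ g g' β => total_cell_heq (THom.ext (hr a g)) (THom.ext (hr a g')) HEq.rfl)
    (fun f b => heq_of_eq (THom.ext (hl f b))) (fun {a a'} f {b b'} g => ?_)
    (fun {a a' f f'} α b => total_cell_heq (THom.ext (hl f b)) (THom.ext (hl f' b)) HEq.rfl)
  refine (strongTransMap_naturality_heq _ _ g).trans (total_cell_heq (THom.ext ?_) (THom.ext ?_)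
    HEq.rfl)
  · exact (φ.map_comp _ _).trans (congrArg₂ D'.comp (hr a g) (hl f b'))
  · exact (φ.map_comp _ _).trans (congrArg₂ D'.comp (hl f b) (hr a' g))

/-- The two constructions of the naturality 2-cells differ only by images of comparison cells of
`F`, which are identities. This is also the naturality in `C` of the bijection defining a Gray
tensor product. -/
theorem postcomp_comp {T : Type u} [Bicategory.{w, v} T] [Strict T] {D : Type u₄}
    [Bicategory.{w₄, v₄} D] [Strict D]
    (U : StrictPseudofunctor A (Ps B T)) (F : StrictPseudofunctor T C)
    (H : StrictPseudofunctor C D) :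
    U.comp (Ps.postcomp B (F.comp H)) = (U.comp (Ps.postcomp B F)).comp (Ps.postcomp B H) := by
  refine Ps.functor_hext (fun _ _ => rfl) (fun _ _ _ _ => HEq.rfl) (fun a b b' g g' β => HEq.rfl)
    (fun _ _ => HEq.rfl) (fun {a a'} f {b b'} g => ?_) (fun {a a' f f'} α b => HEq.rfl)
  refine (strongTransMap_naturality_heq _ _ g).trans ?_
  refine HEq.trans ?_ (strongTransMap_naturality_heq _ _ g).symm
  change H.map₂ (F.map₂ _) ≍ H.map₂ ((F.mapComp _ _).inv ≫ F.map₂ _ ≫ (F.mapComp _ _).hom)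
  rw [PrelaxFunctor.map₂_comp, PrelaxFunctor.map₂_comp]
  exact (IsIdentity.conj_heq (.map₂ _ (.inv (.mapComp F _ _))) _ (.map₂ _ (.mapComp F _ _))).symm

end UncurrySection

/-! ### The free category with a section, and its universal property -/

section Words

open CategoryOver CategoryOver.Total

/-- Formal composites of 1-cells `(f, 𝟙 b)` and `(𝟙 a, g)`. -/
inductive Word (A : Type u₁) [Bicategory.{w₁, v₁} A] (B : Type u₂) [Bicategory.{w₂, v₂} B] :
    A × B → A × B → Type (max u₁ u₂ v₁ v₂)
  | id (x : A × B) : Word A B x x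
  | left {a a' : A} (f : a ⟶ a') (b : B) : Word A B (a, b) (a', b)
  | right (a : A) {b b' : B} (g : b ⟶ b') : Word A B (a, b) (a, b')
  | comp {x y z : A × B} (p : Word A B x y) (q : Word A B y z) : Word A B x z

variable {A : Type u₁} [Bicategory.{w₁, v₁} A] {B : Type u₂} [Bicategory.{w₂, v₂} B]

namespace Word

/-- The relations between formal composites: those of a category, and functoriality in each
variable. -/
inductive Rel : ∀ {x y : A × B}, Word A B x y → Word A B x y → Prop
  | id_comp {x y : A × B} (p : Word A B x y) : Rel (.comp (.id x) p) p
  | comp_id {x y : A × B} (p : Word A B x y) : Rel (.comp p (.id y)) p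
  | assoc {x y z w : A × B} (p : Word A B x y) (q : Word A B y z) (r : Word A B z w) :
      Rel (.comp (.comp p q) r) (.comp p (.comp q r))
  | comp_right {x y z : A × B} (p : Word A B x y) {q q' : Word A B y z} (h : Rel q q') :
      Rel (.comp p q) (.comp p q')
  | comp_left {x y z : A × B} {p p' : Word A B x y} (h : Rel p p') (q : Word A B y z) :
      Rel (.comp p q) (.comp p' q)
  | left_id (a : A) (b : B) : Rel (.left (𝟙 a) b) (.id (a, b))
  | left_comp {a a' a'' : A} (f : a ⟶ a') (f' : a' ⟶ a'') (b : B) :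
      Rel (.left (f ≫ f') b) (.comp (.left f b) (.left f' b))
  | right_id (a : A) (b : B) : Rel (.right a (𝟙 b)) (.id (a, b))
  | right_comp (a : A) {b b' b'' : B} (g : b ⟶ b') (g' : b' ⟶ b'') :
      Rel (.right a (g ≫ g')) (.comp (.right a g) (.right a g'))

/-- The composite in `A × B` of a formal composite. -/
def eval : ∀ {x y : A × B}, Word A B x y → (x ⟶ y)
  | _, _, .id x => 𝟙 x
  | _, _, .left f b => (f, 𝟙 b)
  | _, _, .right a g => (𝟙 a, g)
  | _, _, .comp p q => eval p ≫ eval q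

theorem Rel.eval_eq [Strict A] [Strict B] {x y : A × B} {p q : Word A B x y} (h : Rel p q) :
    eval p = eval q := by
  induction h with
  | id_comp p => exact Strict.id_comp (eval p)
  | comp_id p => exact Strict.comp_id (eval p)
  | assoc p q r => exact Strict.assoc (eval p) (eval q) (eval r)
  | comp_right p _ ih => exact congrArg (fun t => eval p ≫ t) ih
  | comp_left _ q ih => exact congrArg (fun t => t ≫ eval q) ih
  | left_id a b => rfl
  | left_comp f f' b => exact Prod.ext rfl (Strict.id_comp (𝟙 b)).symm
  | right_id a b => rfl
  | right_comp a g g' => exact Prod.ext (Strict.id_comp (𝟙 a)).symm rfl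

/-- The value of a formal composite in a category over `A × B` with a section. -/
def lift {D : CategoryOver (A × B)} (S : D.Section) : ∀ {x y : A × B}, Word A B x y → D.Hom x y
  | _, _, .id x => D.id x
  | _, _, .left f b => S.left f b
  | _, _, .right a g => S.right a g
  | _, _, .comp p q => D.comp (lift S p) (lift S q)

theorem Rel.lift_eq {D : CategoryOver (A × B)} (S : D.Section) {x y : A × B}
    {p q : Word A B x y} (h : Rel p q) : lift S p = lift S q := by
  induction h with
  | id_comp p => exact D.id_comp (lift S p)
  | comp_id p => exact D.comp_id (lift S p)
  | assoc p q r => exact D.assoc (lift S p) (lift S q) (lift S r)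
  | comp_right p _ ih => exact congrArg (D.comp (lift S p)) ih
  | comp_left _ q ih => exact congrArg (fun t => D.comp t (lift S q)) ih
  | left_id a b => exact S.left_id a b
  | left_comp f f' b => exact S.left_comp f f' b
  | right_id a b => exact S.right_id a b
  | right_comp a g g' => exact S.right_comp a g g'

theorem proj_lift {D : CategoryOver (A × B)} (S : D.Section) {x y : A × B}
    (p : Word A B x y) : D.proj (lift S p) = eval p := by
  induction p with
  | id x => exact D.proj_id x
  | left f b => exact S.proj_left f b
  | right a g => exact S.proj_right a g
  | comp p q ihp ihq => exact (D.proj_comp _ _).trans (congrArg₂ (fun s t => s ≫ t) ihp ihq)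

end Word

variable [Strict A] [Strict B]

/-- The category over `A × B` freely generated by a section. -/
def words (A : Type u₁) [Bicategory.{w₁, v₁} A] [Strict A] (B : Type u₂) [Bicategory.{w₂, v₂} B]
    [Strict B] : CategoryOver (A × B) where
  Hom x y := Quot (Word.Rel (A := A) (B := B) (x := x) (y := y))
  id x := Quot.mk _ (.id x)
  comp := Quot.map₂ Word.comp (fun p _ _ h => .comp_right p h) (fun _ _ q h => .comp_left h q)
  id_comp := by
    rintro x y ⟨p⟩
    exact Quot.sound (.id_comp p)
  comp_id := by
    rintro x y ⟨p⟩
    exact Quot.sound (.comp_id p)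
  assoc := by
    rintro x y z w ⟨p⟩ ⟨q⟩ ⟨r⟩
    exact Quot.sound (.assoc p q r)
  proj := Quot.lift Word.eval fun _ _ h => h.eval_eq
  proj_id _ := rfl
  proj_comp := by
    rintro x y z ⟨p⟩ ⟨q⟩
    rfl

namespace words

/-- The universal section. -/
def univSection : (words A B).Section where
  left f b := Quot.mk _ (.left f b)
  right a _ _ g := Quot.mk _ (.right a g)
  left_id a b := Quot.sound (.left_id a b)
  left_comp f f' b := Quot.sound (.left_comp f f' b)
  right_id a b := Quot.sound (.right_id a b)
  right_comp a _ _ _ g g' := Quot.sound (.right_comp a g g')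
  proj_left _ _ := rfl
  proj_right _ _ _ _ := rfl

/-- The morphism from the free category over `A × B` given by a section. -/
def desc {D : CategoryOver (A × B)} (S : D.Section) : Morphism (words A B) D where
  map := Quot.lift (Word.lift S) fun _ _ h => h.lift_eq S
  map_id _ := rfl
  map_comp := by
    rintro x y z ⟨p⟩ ⟨q⟩
    rfl
  proj_map := by
    rintro x y ⟨p⟩
    exact Word.proj_lift S p

/-- The 2-functor from `A` to `Ps(B, -)` of the total 2-category of `words A B`. -/
abbrev unit (A : Type u₁) [Bicategory.{w₁, v₁} A] [Strict A] (B : Type u₂)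
    [Bicategory.{w₂, v₂} B] [Strict B] : StrictPseudofunctor A (Ps B (words A B).Total) :=
  univSection.liftPairing

variable {C : Type u₃} [Bicategory.{w₃, v₃} C] [Strict C]

/-- Freeness maps the words into `isoOver` of the cubical functor of `K`, and `toTarget` then reads
off the 1-cell of `C`. Passing through `isoOver` avoids defining the images of 2-cells by recursion
on words. -/
theorem exists_factorization (K : StrictPseudofunctor A (Ps B C)) :
    ∃ F : StrictPseudofunctor (words A B).Total C, (unit A B).comp (Ps.postcomp B F) = K := by
  refine ⟨(desc (uncurrySection K)).total.comp (isoOver.toTarget _), ?_⟩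
  rw [postcomp_comp, liftPairing_comp_total _ univSection (uncurrySection K) (fun _ _ => rfl)
    (fun _ _ _ _ => rfl)]
  exact liftPairing_comp_toTarget K

theorem hom_induction {P : ∀ {x y : (words A B).Total}, (x ⟶ y) → Prop}
    (id : ∀ x : (words A B).Total, P (𝟙 x))
    (left : ∀ {a a' : A} (f : a ⟶ a') (b : B), P (univSection.leftHom f b))
    (right : ∀ (a : A) {b b' : B} (g : b ⟶ b'), P (univSection.rightHom a g))
    (comp : ∀ {x y z : (words A B).Total} (f : x ⟶ y) (g : y ⟶ z), P f → P g → P (f ≫ g))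
    {x y : (words A B).Total} (f : x ⟶ y) : P f := by
  obtain ⟨_, q, rfl⟩ := f
  obtain ⟨p, rfl⟩ := Quot.exists_rep q
  induction p with
  | id x => exact id x
  | left f b => exact left f b
  | right a g => exact right a g
  | comp p q ihp ihq => exact comp _ _ ihp ihq

/-- The normal form of a 1-cell over `p`. -/
abbrev normal {x y : A × B} (p : x ⟶ y) : Total.of (words A B) x ⟶ Total.of (words A B) y :=
  univSection.rightHom x.1 p.2 ≫ univSection.leftHom p.1 y.2

/-- The isomorphism of a 1-cell with its normal form. -/
abbrev normalIso {x y : (words A B).Total} (f : x ⟶ y) : f ≅ normal (base f) :=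
  isoMk (Iso.prod (λ_ (base f).1).symm (ρ_ (base f).2).symm)

/-- In `A × B` a 1-cell coincides with its normal form by the strict unit laws. Upstairs the two
words may differ, so the isomorphism is in general not an identity there. -/
theorem isIdentity_normalIso {x y : (words A B).Total} (f : x ⟶ y) :
    IsIdentity (cell (normalIso f).hom) :=
  .prod (.inv (.leftUnitor _)) (.inv (.rightUnitor _))

/-- The 2-cell between `(𝟙 a, g)` and `(𝟙 a, g')` given by a 2-cell of `B`. -/
abbrev rightCell (a : A) {b b' : B} {g g' : b ⟶ b'} (β : g ⟶ g') :
    univSection.rightHom a g ⟶ univSection.rightHom a g' := Total.mkCell (Prod.mk (𝟙 (𝟙 a)) β)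

/-- The 2-cell between `(f, 𝟙 b)` and `(f', 𝟙 b)` given by a 2-cell of `A`. -/
abbrev leftCell {a a' : A} {f f' : a ⟶ a'} (α : f ⟶ f') (b : B) :
    univSection.leftHom f b ⟶ univSection.leftHom f' b := Total.mkCell (Prod.mk α (𝟙 (𝟙 b)))

/-- The interchange of `(𝟙 a, g)` and `(f, 𝟙 b)`. -/
abbrev interchange {a a' : A} (f : a ⟶ a') {b b' : B} (g : b ⟶ b') :
    univSection.rightHom a g ≫ univSection.leftHom f b' ≅
      univSection.leftHom f b ≫ univSection.rightHom a' g :=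
  (univSection.liftMap f).naturality g

/-- A 2-cell upstairs is just a pair of 2-cells, and the equation is checked in each component. It
shows that the 2-cells of the generators and the isomorphisms `normalIso` generate all 2-cells. -/
theorem cell_eq_normal {x y : (words A B).Total} {f g : x ⟶ y} (σ : f ⟶ g) :
    σ = (normalIso f).hom ≫ (rightCell x.ob.1 (cell σ).2 ▷ univSection.leftHom (base f).1 y.ob.2 ≫
      univSection.rightHom x.ob.1 (base g).2 ◁ leftCell (cell σ).1 y.ob.2) ≫
        (normalIso g).inv :=
  Prod.ext
    (by simp : (cell σ).1 = (λ_ (base f).1).inv ≫ (𝟙 (𝟙 x.ob.1) ▷ (base f).1 ≫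
      𝟙 x.ob.1 ◁ (cell σ).1) ≫ (λ_ (base g).1).hom)
    (by simp : (cell σ).2 = (ρ_ (base f).2).inv ≫ ((cell σ).2 ▷ 𝟙 y.ob.2 ≫
      (base g).2 ◁ 𝟙 (𝟙 y.ob.2)) ≫ (ρ_ (base g).2).hom)

end words

end Words

/-! ### Closure properties of the 2-cells on which two 2-functors agree -/

section StrictHEq

variable {B : Type u₁} [Bicategory.{w₁, v₁} B] {C : Type u₂} [Bicategory.{w₂, v₂} C]
  {F G : StrictPseudofunctor B C}

theorem map_id_heq (hobj : ∀ x, F.obj x = G.obj x) (x : B) : F.map (𝟙 x) ≍ G.map (𝟙 x) := by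
  rw [F.map_id, G.map_id, hobj]

theorem map_comp_heq (hobj : ∀ x, F.obj x = G.obj x) {x y z : B} {f : x ⟶ y} {g : y ⟶ z}
    (hf : F.map f ≍ G.map f) (hg : F.map g ≍ G.map g) : F.map (f ≫ g) ≍ G.map (f ≫ g) := by
  rw [F.map_comp, G.map_comp]
  exact hom_comp_heq (hobj x) (hobj y) (hobj z) hf hg

/-- The condition that two 2-functors with the same values on 1-cells agree on a 2-cell. -/
def AgreeOn (F G : StrictPseudofunctor B C) {x y : B} {f g : x ⟶ y} (η : f ⟶ g) : Prop :=
  F.map₂ η ≍ G.map₂ η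

namespace AgreeOn

theorem of_isIdentity (hobj : ∀ x, F.obj x = G.obj x)
    (hmap : ∀ {x y : B} (f : x ⟶ y), F.map f ≍ G.map f) {x y : B} {f g : x ⟶ y} {η : f ⟶ g}
    (h : IsIdentity η) : AgreeOn F G η := by
  obtain ⟨rfl, rfl⟩ := h
  change F.map₂ (𝟙 f) ≍ G.map₂ (𝟙 f)
  rw [PrelaxFunctor.map₂_id, PrelaxFunctor.map₂_id]
  exact eqToHom_hom_heq (hobj x) (hobj y) (hmap f) rfl rfl

theorem comp (hobj : ∀ x, F.obj x = G.obj x)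
    (hmap : ∀ {x y : B} (f : x ⟶ y), F.map f ≍ G.map f) {x y : B} {f g h : x ⟶ y} {η : f ⟶ g}
    {θ : g ⟶ h} (hη : AgreeOn F G η) (hθ : AgreeOn F G θ) : AgreeOn F G (η ≫ θ) := by
  change F.map₂ (η ≫ θ) ≍ G.map₂ (η ≫ θ)
  rw [PrelaxFunctor.map₂_comp, PrelaxFunctor.map₂_comp]
  exact cell_comp_heq (hobj x) (hobj y) (hmap f) (hmap g) (hmap h) hη hθ

theorem inv (hobj : ∀ x, F.obj x = G.obj x)
    (hmap : ∀ {x y : B} (f : x ⟶ y), F.map f ≍ G.map f) {x y : B} {f g : x ⟶ y} {η : f ≅ g}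
    (hη : AgreeOn F G η.hom) : AgreeOn F G η.inv :=
  iso_inv_heq (hobj x) (hobj y) (hmap f) (hmap g) (η := F.map₂Iso η) (η' := G.map₂Iso η) hη

theorem whiskerLeft (hobj : ∀ x, F.obj x = G.obj x)
    (hmap : ∀ {x y : B} (f : x ⟶ y), F.map f ≍ G.map f) {x y z : B} (f : x ⟶ y) {g h : y ⟶ z}
    {η : g ⟶ h} (hη : AgreeOn F G η) : AgreeOn F G (f ◁ η) := by
  change F.map₂ (f ◁ η) ≍ G.map₂ (f ◁ η)
  rw [F.map₂_whisker_left, G.map₂_whisker_left]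
  exact (IsIdentity.conj_heq (.mapComp F f g) _ (.inv (.mapComp F f h))).trans <|
    (whiskerLeft_heq (hobj x) (hobj y) (hobj z) (hmap f) (hmap g) (hmap h) hη).trans
      (IsIdentity.conj_heq (.mapComp G f g) _ (.inv (.mapComp G f h))).symm

theorem whiskerRight (hobj : ∀ x, F.obj x = G.obj x)
    (hmap : ∀ {x y : B} (f : x ⟶ y), F.map f ≍ G.map f) {x y z : B} {f g : x ⟶ y}
    {η : f ⟶ g} (hη : AgreeOn F G η) (h : y ⟶ z) : AgreeOn F G (η ▷ h) := by
  change F.map₂ (η ▷ h) ≍ G.map₂ (η ▷ h)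
  rw [F.map₂_whisker_right, G.map₂_whisker_right]
  exact (IsIdentity.conj_heq (.mapComp F f h) _ (.inv (.mapComp F g h))).trans <|
    (whiskerRight_heq (hobj x) (hobj y) (hobj z) (hmap f) (hmap g) hη (hmap h)).trans
      (IsIdentity.conj_heq (.mapComp G f h) _ (.inv (.mapComp G g h))).symm

end AgreeOn

end StrictHEq

/-! ### Composing normal forms -/

section WordsUniqueness

open CategoryOver CategoryOver.Total

/-- For a 2-cell to be an identity upstairs, equality of its boundary words is needed in addition to
the condition on the underlying 2-cell. -/
theorem isIdentity_of_cell {X : Type u} [Bicategory.{w, v} X] {D : CategoryOver X}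
    {x y : D.Total} {f g : x ⟶ y} {η : f ⟶ g} (h : f = g) (hη : IsIdentity (Total.cell η)) :
    IsIdentity η := by
  subst h
  obtain ⟨_, hη⟩ := hη
  exact ⟨rfl, hη⟩

variable {A : Type u₁} [Bicategory.{w₁, v₁} A] {B : Type u₂} [Bicategory.{w₂, v₂} B]
  [Strict A] [Strict B] {C : Type u₃} [Bicategory.{w₃, v₃} C] [Strict C]

namespace words

theorem leftHom_id (a : A) (b : B) :
    univSection.leftHom (𝟙 a) b = 𝟙 (Total.of (words A B) (a, b)) :=
  THom.ext (univSection.left_id a b)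

theorem rightHom_id (a : A) (b : B) :
    univSection.rightHom a (𝟙 b) = 𝟙 (Total.of (words A B) (a, b)) :=
  THom.ext (univSection.right_id a b)

theorem leftHom_comp {a a' a'' : A} (f : a ⟶ a') (f' : a' ⟶ a'') (b : B) :
    (univSection (A := A) (B := B)).leftHom (f ≫ f') b =
      univSection.leftHom f b ≫ univSection.leftHom f' b :=
  THom.ext (univSection.left_comp f f' b)

theorem rightHom_comp (a : A) {b b' b'' : B} (g : b ⟶ b') (g' : b' ⟶ b'') :
    (univSection (A := A) (B := B)).rightHom a (g ≫ g') =
      univSection.rightHom a g ≫ univSection.rightHom a g' :=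
  THom.ext (univSection.right_comp a g g')

/-- The comparison of the composite of two normal forms with the normal form of the composite. -/
abbrev normalComp {x y z : A × B} (p : x ⟶ y) (q : y ⟶ z) :
    normal p ≫ normal q ⟶ normal (p ≫ q) :=
  eqToHom (by simp only [normal, Strict.assoc]) ≫
    -- The product of two normal forms reads right, left, right, left. The inverse interchange swaps
    -- the two middle letters, after which functoriality merges equal kinds.
    univSection.rightHom x.1 p.2 ◁ (interchange p.1 q.2).inv ▷ univSection.leftHom q.1 z.2 ≫
      eqToHom (by
        simp only [normal, Strict.assoc]
        erw [leftHom_comp, rightHom_comp]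
        simp only [Strict.assoc])

end words

end WordsUniqueness

/-! ### Consequences of an equality of 2-functors into `Ps(B, C)` -/

section PsHEq

variable {A : Type u₁} [Bicategory.{w₁, v₁} A] {B : Type u₂} [Bicategory.{w₂, v₂} B]
  {C : Type u₃} [Bicategory.{w₃, v₃} C]

theorem Ps.swap_heq {K K' : StrictPseudofunctor A (Ps B C)} (h : K = K') {a a' : A} (f : a ⟶ a')
    {b b' : B} (g : b ⟶ b') :
    ((K.map f).hom.naturality g).hom ≍ ((K'.map f).hom.naturality g).hom := by
  subst h; rfl

theorem Ps.app_heq {K K' : StrictPseudofunctor A (Ps B C)} (h : K = K') {a a' : A} (f : a ⟶ a')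
    (b : B) : (K.map f).hom.app b ≍ (K'.map f).hom.app b := by
  subst h; rfl

theorem Ps.map_heq {K K' : StrictPseudofunctor A (Ps B C)} (h : K = K') (a : A) {b b' : B}
    (g : b ⟶ b') : (K.obj a).map g ≍ (K'.obj a).map g := by
  subst h; rfl

theorem Ps.map₂_heq {K K' : StrictPseudofunctor A (Ps B C)} (h : K = K') (a : A) {b b' : B}
    {g g' : b ⟶ b'} (β : g ⟶ g') : (K.obj a).map₂ β ≍ (K'.obj a).map₂ β := by
  subst h; rfl

theorem Ps.app₂_heq {K K' : StrictPseudofunctor A (Ps B C)} (h : K = K') {a a' : A}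
    {f f' : a ⟶ a'} (α : f ⟶ f') (b : B) :
    (K.map₂ α).hom.as.app b ≍ (K'.map₂ α).hom.as.app b := by
  subst h; rfl

theorem Ps.obj_eq {K K' : StrictPseudofunctor A (Ps B C)} (h : K = K') (a : A) (b : B) :
    (K.obj a).obj b = (K'.obj a).obj b := by
  subst h; rfl

end PsHEq

/-! ### Uniqueness of factorizations through the words -/

section WordsInjective

open CategoryOver CategoryOver.Total

variable {A : Type u₁} [Bicategory.{w₁, v₁} A] {B : Type u₂} [Bicategory.{w₂, v₂} B]
  [Strict A] [Strict B] {C : Type u₃} [Bicategory.{w₃, v₃} C] [Strict C]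

namespace words

variable {F G : StrictPseudofunctor (words A B).Total C}

theorem obj_eq_of_comp_eq
    (h : (unit A B).comp (Ps.postcomp B F) = (unit A B).comp (Ps.postcomp B G))
    (x : (words A B).Total) : F.obj x = G.obj x :=
  Ps.obj_eq h x.ob.1 x.ob.2

theorem map_heq_of_comp_eq
    (h : (unit A B).comp (Ps.postcomp B F) = (unit A B).comp (Ps.postcomp B G))
    {x y : (words A B).Total} (f : x ⟶ y) : F.map f ≍ G.map f := by
  induction f using hom_induction with
  | id x => exact map_id_heq (obj_eq_of_comp_eq h) x
  | left f b => exact Ps.app_heq h f b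
  | right a g => exact Ps.map_heq h a g
  | comp f g hf hg => exact map_comp_heq (obj_eq_of_comp_eq h) hf hg

theorem agreeOn_rightCell
    (h : (unit A B).comp (Ps.postcomp B F) = (unit A B).comp (Ps.postcomp B G))
    (a : A) {b b' : B} {g g' : b ⟶ b'} (β : g ⟶ g') :
    AgreeOn F G (rightCell a β) :=
  Ps.map₂_heq h a β

theorem agreeOn_leftCell
    (h : (unit A B).comp (Ps.postcomp B F) = (unit A B).comp (Ps.postcomp B G))
    {a a' : A} {f f' : a ⟶ a'} (α : f ⟶ f') (b : B) :
    AgreeOn F G (leftCell α b) :=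
  Ps.app₂_heq h α b

/-- The interchange is the naturality 2-cell of the unit, so its images under `F` and `G` are the
naturality 2-cells of the two composites, which are assumed equal. -/
theorem agreeOn_interchange
    (h : (unit A B).comp (Ps.postcomp B F) = (unit A B).comp (Ps.postcomp B G))
    {a a' : A} (f : a ⟶ a') {b b' : B} (g : b ⟶ b') :
    AgreeOn F G (interchange f g).hom :=
  (strongTransMap_naturality_heq _ _ g).symm.trans <| (Ps.swap_heq h f g).trans
    (strongTransMap_naturality_heq _ _ g)

theorem agreeOn_normalComp
    (h : (unit A B).comp (Ps.postcomp B F) = (unit A B).comp (Ps.postcomp B G))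
    {x y z : A × B} (p : x ⟶ y) (q : y ⟶ z) :
    AgreeOn F G (normalComp p q) := by
  have h₀ := obj_eq_of_comp_eq h
  have h₁ {x y : (words A B).Total} (f : x ⟶ y) := map_heq_of_comp_eq h f
  exact .comp h₀ h₁ (.of_isIdentity h₀ h₁ (.hom _)) <|
    .comp h₀ h₁ (.whiskerLeft h₀ h₁ _ (.whiskerRight h₀ h₁
      (.inv h₀ h₁ (agreeOn_interchange h _ _)) _)) (.of_isIdentity h₀ h₁ (.hom _))

theorem isIdentity_normalComp {x y z : A × B} (p : x ⟶ y) (q : y ⟶ z) :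
    IsIdentity (cell (normalComp p q)) := by
  have hi : IsIdentity (cell (interchange p.1 q.2).inv) :=
    .inv (η := (words A B).projection.map₂Iso (interchange p.1 q.2))
      (univSection.isIdentity_liftMap p.1 q.2)
  exact IsIdentity.comp (C := A × B) (IsIdentity.cell (.hom _)) <|
    IsIdentity.comp (C := A × B) (IsIdentity.whiskerLeft (C := A × B) _ (.whiskerRight hi _))
      (IsIdentity.cell (.hom _))

/-- By induction on the word. An identity or a generator equals its normal form, so the isomorphism
is an identity. For a composite, normalizing both factors and then swapping the middle letters gives
the same 2-cell as normalizing at once, because both lie over identities of `A × B`. Only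
interchanges and identities are involved, and on these the 2-functors agree. -/
theorem agreeOn_normalIso
    (h : (unit A B).comp (Ps.postcomp B F) = (unit A B).comp (Ps.postcomp B G))
    {x y : (words A B).Total} (f : x ⟶ y) : AgreeOn F G (normalIso f).hom := by
  have h₀ := obj_eq_of_comp_eq h
  have h₁ {x y : (words A B).Total} (f : x ⟶ y) := map_heq_of_comp_eq h f
  induction f using hom_induction with
  | id x =>
    refine .of_isIdentity h₀ h₁ (isIdentity_of_cell ?_ (isIdentity_normalIso _))
    exact (Strict.id_comp _).symm.trans
      (congrArg₂ (fun s t => s ≫ t) (rightHom_id x.ob.1 x.ob.2).symm (leftHom_id x.ob.1 x.ob.2).symm)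
  | left f b =>
    refine .of_isIdentity h₀ h₁ (isIdentity_of_cell ?_ (isIdentity_normalIso _))
    exact (Strict.id_comp _).symm.trans
      (congrArg (fun s => s ≫ univSection.leftHom f b) (rightHom_id _ b).symm)
  | right a g =>
    refine .of_isIdentity h₀ h₁ (isIdentity_of_cell ?_ (isIdentity_normalIso _))
    exact (Strict.comp_id _).symm.trans
      (congrArg (fun s => univSection.rightHom a g ≫ s) (leftHom_id a _).symm)
  | comp f g hf hg =>
    have e : (normalIso (f ≫ g)).hom = (normalIso f).hom ▷ g ≫ normal (base f) ◁ (normalIso g).hom ≫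
        normalComp (base f) (base g) :=
      IsIdentity.eq (C := A × B) (isIdentity_normalIso _) <|
        IsIdentity.comp (C := A × B) (.whiskerRight (isIdentity_normalIso f) _) <|
          IsIdentity.comp (C := A × B) (.whiskerLeft _ (isIdentity_normalIso g))
            (isIdentity_normalComp _ _)
    rw [e]
    exact .comp h₀ h₁ (.whiskerRight h₀ h₁ hf g) <|
      .comp h₀ h₁ (.whiskerLeft h₀ h₁ _ hg) (agreeOn_normalComp h _ _)

theorem injective_comp_postcomp :
    Function.Injective fun F : StrictPseudofunctor (words A B).Total C =>
      (unit A B).comp (Ps.postcomp B F) := by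
  intro F G h
  have h₀ := obj_eq_of_comp_eq h
  have h₁ {x y : (words A B).Total} (f : x ⟶ y) := map_heq_of_comp_eq h f
  refine strictPseudofunctor_hext h₀ h₁ fun η => ?_
  change AgreeOn F G η
  rw [cell_eq_normal η]
  exact .comp h₀ h₁ (agreeOn_normalIso h _) <| .comp h₀ h₁
    (.comp h₀ h₁ (.whiskerRight h₀ h₁ (agreeOn_rightCell h _ _) _)
      (.whiskerLeft h₀ h₁ _ (agreeOn_leftCell h _ _))) (.inv h₀ h₁ (agreeOn_normalIso h _))

theorem bijective_comp_postcomp :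
    Function.Bijective fun F : StrictPseudofunctor (words A B).Total C =>
      (unit A B).comp (Ps.postcomp B F) :=
  ⟨injective_comp_postcomp, exists_factorization⟩

end words

end WordsInjective

/-! ### Cubical functors and composition with a 2-functor -/

section UncurryComp

variable {A : Type u₁} [Bicategory.{w₁, v₁} A] {B : Type u₂} [Bicategory.{w₂, v₂} B]
  {C : Type u₃} [Bicategory.{w₃, v₃} C] {D : Type u₄} [Bicategory.{w₄, v₄} D] [Strict C]

theorem IsIdentity.map₂_whiskerLeft (H : StrictPseudofunctor C D) {x y z : C} (f : x ⟶ y)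
    {g h : y ⟶ z} {η : g ⟶ h} (p : IsIdentity (H.map₂ η)) : IsIdentity (H.map₂ (f ◁ η)) := by
  rw [H.map₂_whisker_left]
  exact .comp (.mapComp H _ _) (.comp (.whiskerLeft _ p) (.inv (.mapComp H _ _)))

theorem IsIdentity.map₂_whiskerRight (H : StrictPseudofunctor C D) {x y z : C} {f g : x ⟶ y}
    {η : f ⟶ g} (p : IsIdentity (H.map₂ η)) (h : y ⟶ z) : IsIdentity (H.map₂ (η ▷ h)) := by
  rw [H.map₂_whisker_right]
  exact .comp (.mapComp H _ _) (.comp (.whiskerRight p _) (.inv (.mapComp H _ _)))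

theorem IsIdentity.map₂_comp (H : StrictPseudofunctor C D) {x y : C} {f g h : x ⟶ y}
    {η : f ⟶ g} {θ : g ⟶ h} (p : IsIdentity (H.map₂ η)) (q : IsIdentity (H.map₂ θ)) :
    IsIdentity (H.map₂ (η ≫ θ)) := by
  rw [PrelaxFunctor.map₂_comp]
  exact .comp p q

theorem IsIdentity.map₂_of_strongTransMap (H : StrictPseudofunctor C D) {F G : B ⥤ᵖ C}
    (η : F ⟶ G) {b b' : B} {g : b ⟶ b'}
    (h : IsIdentity ((strongTransMap η H.toPseudofunctor).naturality g).hom) :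
    IsIdentity (H.map₂ (η.naturality g).hom) := by
  have e : H.map₂ (η.naturality g).hom = (H.mapComp _ _).hom ≫
      ((strongTransMap η H.toPseudofunctor).naturality g).hom ≫ (H.mapComp _ _).inv := by
    change _ = (H.mapComp _ _).hom ≫
      ((H.mapComp _ _).inv ≫ H.map₂ (η.naturality g).hom ≫ (H.mapComp _ _).hom) ≫
        (H.mapComp _ _).inv
    simp
  rw [e]
  exact .comp (.mapComp H _ _) (.comp h (.inv (.mapComp H _ _)))

variable [Strict D]

/-- The naturality 2-cell is the only factor of the comparison that need not be an identity in `C`;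
by hypothesis `H` makes it one, and `H` preserves the other identities. -/
theorem IsIdentity.map₂_uncurry_mapComp (K : StrictPseudofunctor A (Ps B C))
    (H : StrictPseudofunctor C D) {x y z : A × B} (f : x ⟶ y) (g : y ⟶ z)
    (h : IsIdentity (((K.comp (Ps.postcomp B H)).map f.1).hom.naturality g.2).hom) :
    IsIdentity (H.map₂ ((uncurryPseudofunctor K).mapComp f g).hom) := by
  have hn := IsIdentity.map₂_of_strongTransMap H (K.map f.1).hom h
  refine .map₂_comp H (.map₂ _ <| .map₂ evaluation <| .prod
      (.comp (.map₂ (Ps.inclusion B C).toPseudofunctor (.mapComp K f.1 g.1))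
        (.mapComp (Ps.inclusion B C) (K.map f.1) (K.map g.1)))
      (.id (f.2 ≫ g.2))) ?_
  refine .map₂_comp H (.map₂ _ (.whiskerRight
    (.mapComp (K.obj x.1 : StrictPseudofunctor B C) f.2 g.2) _)) ?_
  refine .map₂_comp H (.map₂ _ (.associator _ _ _)) (.map₂_comp H (.map₂_whiskerLeft H _ ?_)
    (.map₂ _ (.inv (.associator _ _ _))))
  exact .map₂_comp H (.map₂ _ (.inv (.associator _ _ _)))
    (.map₂_comp H (.map₂_whiskerRight H hn _) (.map₂ _ (.associator _ _ _)))

/-- The invertible icon between the composite of the cubical functor of `K` with a 2-functor `H`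
and the pseudofunctor of the composite of `K` with `Ps(B, H)`, in case the latter has identity
naturality 2-cells. -/
def uncurryCompIcon (K : StrictPseudofunctor A (Ps B C)) (H : StrictPseudofunctor C D)
    (h : ∀ {a a' : A} (f : a ⟶ a') {b b' : B} (g : b ⟶ b'),
      IsIdentity (((K.comp (Ps.postcomp B H)).map f).hom.naturality g).hom) :
    Icon ((uncurryPseudofunctor K).comp H.toPseudofunctor)
      (uncurryPseudofunctor (K.comp (Ps.postcomp B H))) where
  obj_eq _ := rfl
  app f := (H.mapComp _ _).hom
  naturality {x y f g} η := by
    change H.map₂ ((K.obj x.1).map₂ η.2 ▷ (K.map f.1).hom.app y.2 ≫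
      (K.obj x.1).map g.2 ◁ (K.map₂ η.1).hom.as.app y.2) ≫ (H.mapComp _ _).hom =
        (H.mapComp _ _).hom ≫ H.map₂ ((K.obj x.1).map₂ η.2) ▷ H.map ((K.map f.1).hom.app y.2) ≫
          H.map ((K.obj x.1).map g.2) ◁ H.map₂ ((K.map₂ η.1).hom.as.app y.2)
    simp
  -- The components are comparison cells of the 2-functor `H`, hence identities. Here and in the
  -- next field both sides are parallel identity 2-cells.
  app_id x := IsIdentity.eq
    (.comp (.mapComp H _ _) (.uncurry_mapId (K.comp (Ps.postcomp B H)) x))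
    (.comp (.comp (.map₂ _ (.uncurry_mapId K x)) (.mapId H _)) (.hom _))
  app_comp {x y z} f g := IsIdentity.eq
    (.comp (.mapComp H _ _) (.uncurry_mapComp (K.comp (Ps.postcomp B H)) f g (h _ _)))
    (.comp (.comp (.map₂_uncurry_mapComp K H f g (h _ _)) (.mapComp H _ _))
      (.comp (.whiskerRight (.mapComp H _ _) _) (.comp (.whiskerLeft _ (.mapComp H _ _)) (.hom _))))

/-- The invertible icon between the cubical functor of `pairing A B` and the identity. -/
def uncurryPairingIcon (A : Type u₁) [Bicategory.{w₁, v₁} A] [Strict A] (B : Type u₂)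
    [Bicategory.{w₂, v₂} B] [Strict B] :
    Icon (uncurryPseudofunctor (pairing A B)) (Pseudofunctor.id (A × B)) where
  obj_eq _ := rfl
  -- The cubical functor of the pairing takes `f` to `(𝟙 a, f.2) ≫ (f.1, 𝟙 b)`, that is, to `(𝟙 a ≫
  -- f.1, f.2 ≫ 𝟙 b)`.
  app f := Prod.mk (λ_ f.1).hom (ρ_ f.2).hom
  naturality {x y f g} η := Prod.ext
    (by simp : (𝟙 (𝟙 x.1) ▷ f.1 ≫ 𝟙 x.1 ◁ η.1) ≫ (λ_ g.1).hom = (λ_ f.1).hom ≫ η.1)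
    (by simp : (η.2 ▷ 𝟙 y.2 ≫ g.2 ◁ 𝟙 (𝟙 y.2)) ≫ (ρ_ g.2).hom = (ρ_ f.2).hom ≫ η.2)
  app_id x := IsIdentity.eq (C := A × B)
    (.comp (.prod (.leftUnitor _) (.rightUnitor _)) (.id _))
    (.comp (.uncurry_mapId _ x) (.hom _))
  app_comp {x y z} f g := IsIdentity.eq (C := A × B)
    (.comp (.prod (.leftUnitor _) (.rightUnitor _)) (.id _))
    (.comp (.uncurry_mapComp _ f g (.pairingMap B _ _))
      (.comp (.whiskerRight (.prod (.leftUnitor _) (.rightUnitor _)) _)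
        (.comp (.whiskerLeft _ (.prod (.leftUnitor _) (.rightUnitor _))) (.hom _))))

end UncurryComp

theorem strictPseudofunctor_id_comp {C : Type u₁} [Bicategory.{w₁, v₁} C] {D : Type u₂}
    [Bicategory.{w₂, v₂} D] (F : StrictPseudofunctor C D) :
    (StrictPseudofunctor.id C).comp F = F :=
  strictPseudofunctor_hext (fun _ => rfl) (fun _ => HEq.rfl) (fun _ => HEq.rfl)

theorem strictPseudofunctor_comp_comp_of_eq {X : Type u₁} [Bicategory.{w₁, v₁} X] {Y : Type u₂}
    [Bicategory.{w₂, v₂} Y] {Z : Type u₃} [Bicategory.{w₃, v₃} Z] {W : Type u₄}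
    [Bicategory.{w₄, v₄} W] {F : StrictPseudofunctor X Y} {P : StrictPseudofunctor Y Z}
    {Q : StrictPseudofunctor X Z} (h : F.comp P = Q) (G : Z ⥤ᵖ W) :
    F.toPseudofunctor.comp (P.toPseudofunctor.comp G) = Q.toPseudofunctor.comp G := by
  subst h
  exact (Icon.pseudofunctor_comp_assoc F.toPseudofunctor P.toPseudofunctor G).symm

/-! ### Existence of the Gray tensor product and the equivalence between `Q` and `R` -/

namespace GrayTensor

variable {A B : TwoCat.{u}}

/-- The Gray tensor product, as the 2-category of formal composites. -/
noncomputable def ofWords (A B : TwoCat.{u}) : GrayTensor A B where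
  tensor := ⟨(words A B).Total⟩
  homEquiv C := Equiv.ofBijective
    (fun F : StrictPseudofunctor (words A B).Total C => (words.unit A B).comp (Ps.postcomp B F))
    words.bijective_comp_postcomp
  homEquiv_comp F H := postcomp_comp (words.unit A B) F H

variable (T : GrayTensor A B)

/-- The 2-functor `A ⥤ Ps(B, A ⊗ B)` corresponding to the identity. -/
abbrev unit : StrictPseudofunctor A (Ps B T.tensor) :=
  T.homEquiv T.tensor (StrictPseudofunctor.id T.tensor)

/-- By naturality of the representing bijection, as in the Yoneda lemma: the bijection sends a
2-functor to its composite with the unit, and `Q` was chosen to be sent to the pairing. -/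
theorem unit_comp_postcomp_comparison :
    T.unit.comp (Ps.postcomp B T.comparison) = pairing A B := by
  refine (T.homEquiv_comp (StrictPseudofunctor.id T.tensor) T.comparison).symm.trans ?_
  rw [strictPseudofunctor_id_comp]
  exact Equiv.apply_symm_apply (T.homEquiv (A.prod B)) (pairing A B)

/-- The 2-functor from `A ⊗ B` to the total 2-category of `isoOver R`. -/
def toIsoOver :
    StrictPseudofunctor T.tensor (isoOver (uncurryPseudofunctor T.unit)).Total :=
  (T.homEquiv ⟨(isoOver (uncurryPseudofunctor T.unit)).Total⟩).symm
    (uncurrySection T.unit).liftPairing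

/-- Two 2-functors out of the tensor agree if they correspond to the same 2-functor into `Ps(B, -)`;
here both correspond to the unit, which is recovered from its own cubical functor `R`. -/
theorem toIsoOver_comp_toTarget :
    T.toIsoOver.comp (isoOver.toTarget (uncurryPseudofunctor T.unit)) =
      StrictPseudofunctor.id T.tensor := by
  apply (T.homEquiv T.tensor).injective
  refine (T.homEquiv_comp (C := ⟨(isoOver (uncurryPseudofunctor T.unit)).Total⟩) _ _).trans ?_
  refine (congrArg (fun K => StrictPseudofunctor.comp K (Ps.postcomp B _))
    (Equiv.apply_symm_apply _ _)).trans ?_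
  exact liftPairing_comp_toTarget T.unit

theorem toIsoOver_comp_projection :
    T.toIsoOver.comp (isoOver (uncurryPseudofunctor T.unit)).projection = T.comparison := by
  apply (T.homEquiv (A.prod B)).injective
  refine (T.homEquiv_comp (C := ⟨(isoOver (uncurryPseudofunctor T.unit)).Total⟩) _ _).trans ?_
  refine (congrArg (fun K => StrictPseudofunctor.comp K (Ps.postcomp B _))
    (Equiv.apply_symm_apply _ _)).trans ?_
  exact (liftPairing_comp_projection _).trans (Equiv.apply_symm_apply _ _).symm

/-- `Q` followed by `R`, through the total 2-category of `isoOver R`. -/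
theorem toIsoOver_comp_projection_comp :
    T.toIsoOver.toPseudofunctor.comp
      ((isoOver (uncurryPseudofunctor T.unit)).projection.toPseudofunctor.comp
        (uncurryPseudofunctor T.unit)) =
      T.comparison.toPseudofunctor.comp (uncurryPseudofunctor T.unit) :=
  strictPseudofunctor_comp_comp_of_eq T.toIsoOver_comp_projection (uncurryPseudofunctor T.unit)

/-- Whisker the icon of `isoOver R` with `toIsoOver`: its source becomes the identity and its target
becomes `Q` followed by `R`. -/
theorem nonempty_QR_iso_id : Nonempty (T.Q ≫ T.R ≅ 𝟙 T.tensor) := by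
  obtain ⟨i⟩ := nonempty_iso_of_icon (X := T.tensor) (Y := T.tensor)
    (Icon.whiskerLeft T.toIsoOver.toPseudofunctor (isoOver.icon (uncurryPseudofunctor T.unit)))
    (fun f => (isoOver.iso (uncurryPseudofunctor T.unit) (T.toIsoOver.map f)).isIso_hom)
  have e : T.toIsoOver.toPseudofunctor.comp
      (isoOver.toTarget (uncurryPseudofunctor T.unit)).toPseudofunctor =
        Pseudofunctor.id T.tensor :=
    congrArg (fun F : StrictPseudofunctor T.tensor T.tensor => F.toPseudofunctor)
      T.toIsoOver_comp_toTarget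
  exact ⟨(eqToIso (C := T.tensor ⟶ T.tensor) T.toIsoOver_comp_projection_comp).symm ≪≫ i.symm ≪≫
    eqToIso (C := T.tensor ⟶ T.tensor) e⟩

/-- Composing the unit with `Q` gives the pairing, whose naturality 2-cells are identities. So `R`
followed by `Q` is isomorphic to the cubical functor of the pairing, which is isomorphic to the
identity by unitors. -/
theorem nonempty_RQ_iso_id : Nonempty (T.R ≫ T.Q ≅ 𝟙 (A.prod B)) := by
  have h {a a' : A} (f : a ⟶ a') {b b' : B} (g : b ⟶ b') :
      IsIdentity (((T.unit.comp (Ps.postcomp B T.comparison)).map f).hom.naturality g).hom := by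
    rw [unit_comp_postcomp_comparison]
    exact .pairingMap B f g
  obtain ⟨i⟩ := nonempty_iso_of_icon (X := A.prod B) (Y := A.prod B)
    (uncurryCompIcon T.unit T.comparison h)
    (fun f => (T.comparison.mapComp ((T.unit.obj _).map f.2) _).isIso_hom)
  obtain ⟨j⟩ := nonempty_iso_of_icon (X := A.prod B) (Y := A.prod B) (uncurryPairingIcon A B)
    (fun f => (Iso.prod (λ_ f.1) (ρ_ f.2)).isIso_hom)
  exact ⟨i ≪≫ eqToIso (congrArg uncurryPseudofunctor T.unit_comp_postcomp_comparison) ≪≫ j⟩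

theorem locallyFullyFaithful_comparison :
    LocallyFullyFaithful T.comparison.toPseudofunctor := by
  obtain ⟨i⟩ := T.nonempty_QR_iso_id
  obtain ⟨j⟩ := T.nonempty_RQ_iso_id
  have hi {x y : T.tensor} (f g : x ⟶ y) :
      Function.Bijective fun η : f ⟶ g => T.R.map₂ (T.Q.map₂ η) :=
    map₂_bijective_of_icon i.hom i.inv i.hom_inv_id i.inv_hom_id f g
  have hj {x y : A.prod B} (f g : x ⟶ y) :
      Function.Bijective fun η : f ⟶ g => T.Q.map₂ (T.R.map₂ η) :=
    map₂_bijective_of_icon j.hom j.inv j.hom_inv_id j.inv_hom_id f g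
  -- Two-out-of-six on 2-cells. For fullness, the image of `θ` under `R` is hit by `Q` followed by
  -- `R`; applying `Q` and cancelling the injective composite of `R` and `Q` shows that the preimage
  -- is sent to `θ`.
  refine fun x y => ⟨⟨fun {f g} θ => ?_⟩, ⟨fun {f g η θ} h => ?_⟩⟩
  · obtain ⟨η, h⟩ := (hi f g).2 (T.R.map₂ θ)
    exact ⟨η, (hj _ _).1 (congrArg T.Q.map₂ h)⟩
  · exact (hi f g).1 (congrArg T.R.map₂ h)

end GrayTensor

end GrayTensorProduct

theorem mainTheorem4 (A B : GrayTensorProduct.TwoCat.{u}) :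
    Nonempty (GrayTensorProduct.GrayTensor A B) ∧
      ∀ T : GrayTensorProduct.GrayTensor A B,
        Nonempty (T.Q ≫ T.R ≅ 𝟙 T.tensor) ∧
        Nonempty (T.R ≫ T.Q ≅ 𝟙 (A.prod B)) ∧
        GrayTensorProduct.LocallyFullyFaithful T.comparison.toPseudofunctor :=
  ⟨⟨.ofWords A B⟩, fun T =>
    ⟨T.nonempty_QR_iso_id, T.nonempty_RQ_iso_id, T.locallyFullyFaithful_comparison⟩⟩
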